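/- **Setting.** Let $\Gamma$ be a Coxeter graph with Coxeter matrix $M=(m_{s,t})_{s,t\in S}$, where $S$ is a finite or infinite set, and let $(W,S)$ be its Coxeter system. A symmetry of $\Gamma$ is a permutation $g$ of $S$ with $m_{g(s),g(t)}=m_{s,t}$ for all $s,t\in S$. Let $G$ be a group of symmetries of $\Gamma$; it acts on $S$ and on $W$, and $W^G$ denotes the subgroup of elements of $W$ fixed by $G$. *Root basis.* Let $V=\bigoplus_{s\in S}\mathbb R\alpha_s$ and, for each $s\in S$, let $\sigma_s$ be a linear reflection of $V$ with $\sigma_s(\alpha_s)=-\alpha_s$, such that $\sigma_s\sigma_t$ has order $m_{s,t}$ for all $s,t\in S$. Let $W$ act on $V$ by $s\mapsto\sigma_s$ and put $\Phi=\{w(\alpha_s): w\in W,\ s\in S\}$. Let $\Phi^+$ (resp. $\Phi^-$) be the set of elements of $\Phi$ whose coordinates in $(\alpha_s)_{s\in S}$ are all $\ge 0$ (resp. all $\le 0$). Suppose that these data form a reduced root basis, i.e. $\Phi=\Phi^+\sqcup\Phi^-$ and $\mathbb R\alpha_s\cap\Phi=\{\alpha_s,-\alpha_s\}$ for all $s\in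 S$, which is symmetric with respect to $G$, i.e. $\sigma_{g(s)}=g\sigma_sg^{-1}$ for all $g\in G$ and $s\in S$, where $g(\alpha_s)=\alpha_{g(s)}$. (The canonical root basis of $\Gamma$ is an example.) *The $\hat\Phi^+$-basis property.* Let $\mathcal S$ be the set of finite $G$-orbits $X\subseteq S$ such that the subgroup $W_X=\langle X\rangle$ of $W$ is finite. For $X\in\mathcal S$ let $u_X$ be the longest element of $W_X$, let $\hat\alpha_X=\sum_{s\in X}\alpha_s$, and let $\omega_X=\{\alpha_s: s\in X\}$. Let $\hat\Phi$ be the set of the vectors $w(\hat\alpha_X)$, where $X\in\mathcal S$ and $w$ lies in the subgroup generated by $\{u_Y: Y\in\mathcal S\}$, and let $\hat\Phi^+$ be the set of elements of $\hat\Phi$ that are linear combinations of the $\hat\alpha_X$, $X\in\mathcal S$, with nonnegative coefficients. There is a well-defined injective map $F$ from $\hat\Phi^+$ to the set of finite $G$-orbits in $\Phi^+$, given by $F(w(\hat\alpha_X))=w(\omega_X)$ for $X\in\mathcal S$ and $w\in W^G$. Let $\mathbb K$ be a field, and let $E$ be the $\mathbb K$-vector space with basis $(e_\alpha)_{\alpha\in\Phi^+}$,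 on which $G$ acts by $g(e_\alpha)=e_{g(\alpha)}$. One says that $(\Gamma,G)$ has the $\hat\Phi^+$-basis property if $\big\{\sum_{\alpha\in F(\hat\beta)}e_\alpha : \hat\beta\in\hat\Phi^+\big\}$ is a basis of the subspace $E^G$ of $G$-fixed vectors. **Proposition.** Suppose that $\Gamma$ is connected, that $G$ is non-trivial, and that all the orbits of $S$ under $G$ are finite. If $(\Gamma,G)$ has the $\hat\Phi^+$-basis property, then $\Gamma$ is (isomorphic to) one of the following simply laced Coxeter graphs: - $A_{2m+1}$ ($m\ge1$), $D_m$ ($m\ge4$), or $E_6$; - the affine graphs $\tilde A_{2m+1}$ ($m\ge1$), $\tilde D_m$ ($m\ge4$), $\tilde E_6$, or $\tilde E_7$; - ${}_\infty A_\infty$, the two-sided infinite path; - $D_\infty$, the graph with vertices $s_1,s_2,s_3,\dots$ that consists of the infinite path $s_2,s_3,s_4,\dots$ and the edge $s_1s_3$. -/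

import Mathlib

/-! Coxeter graphs are encoded by Mathlib's `CoxeterMatrix`, in which the entry `0` stands for `∞`.
The Coxeter group is `M.Group` and its generators are `M.simple s`. -/

noncomputable section

namespace CoxeterMatrix

variable {S : Type*} (M : CoxeterMatrix S)

/-- The underlying simple graph of the Coxeter graph: distinct `s`, `t` are joined by an edge when
`m_{s,t} ≥ 3` (including `∞`, encoded by `0`), that is, when `m_{s,t} ≠ 2`. -/
def coxeterGraph : SimpleGraph S where
  Adj s t := s ≠ t ∧ M s t ≠ 2
  symm := ⟨fun s t h => ⟨h.1.symm, by rw [M.symmetric]; exact h.2⟩⟩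
  loopless := ⟨fun _ h => h.1 rfl⟩

/-- `Sym(Γ)`: the permutations `g` of `S` with `m_{g(s),g(t)} = m_{s,t}` for all `s, t`. -/
def symmetryGroup : Subgroup (Equiv.Perm S) where
  carrier := {g | ∀ s t, M (g s) (g t) = M s t}
  mul_mem' {g h} hg hh s t := by
    simp only [Set.mem_ofPred_eq, Equiv.Perm.mul_apply] at *
    rw [hg, hh]
  one_mem' := by simp
  inv_mem' {g} hg s t := by
    simp only [Set.mem_ofPred_eq] at hg
    rw [← hg (g⁻¹ s) (g⁻¹ t)]
    simp

/-- The endomorphism of `W` induced by a symmetry `g` of the Coxeter graph: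
it sends the generator `s` to the generator `g(s)`. -/
def symmetryAct (g : M.symmetryGroup) : M.Group →* M.Group :=
  M.toCoxeterSystem.lift ⟨fun s => M.simple (g • s), fun s t => by
    have h := M.toCoxeterSystem.simple_mul_simple_pow (g • s) (g • t)
    rw [show M (g • s) (g • t) = M s t from g.2 s t] at h
    exact h⟩

@[simp] lemma symmetryAct_simple (g : M.symmetryGroup) (s : S) :
    M.symmetryAct g (M.simple s) = M.simple (g • s) :=
  M.toCoxeterSystem.lift_apply_simple _ s

variable {M}

/-- `W^G`: the elements of `W` that are fixed by every element of `G`. -/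
def fixedSubgroup (G : Subgroup M.symmetryGroup) : Subgroup M.Group where
  carrier := {w | ∀ g ∈ G, M.symmetryAct g w = w}
  mul_mem' {v w} hv hw g hg := by rw [map_mul, hv g hg, hw g hg]
  one_mem' g _ := map_one _
  inv_mem' {w} hw g hg := by rw [map_inv, hw g hg]

variable (M) in
/-- The standard parabolic subgroup `W_X` of `W` generated by `X ⊆ S`. -/
def parabolic (X : Set S) : Subgroup M.Group :=
  Subgroup.closure (M.simple '' X)

variable (M) in
/-- `u` is the longest element of `W_X`: it lies in `W_X`, and `lg(s u) < lg(u)` for all `s ∈ X`. -/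
def IsLongest (X : Set S) (u : M.Group) : Prop :=
  u ∈ M.parabolic X ∧
    ∀ s ∈ X, M.toCoxeterSystem.length (M.simple s * u) < M.toCoxeterSystem.length u

/-- The set `𝒮` of the finite orbits `X` of `S` under `G` such that `W_X` is finite. -/
def sphericalOrbits (G : Subgroup M.symmetryGroup) : Set (Set S) :=
  {X | (∃ s : S, X = MulAction.orbit G s) ∧ X.Finite ∧ Finite (M.parabolic X)}

/-- The subgroup of `W` generated by the longest elements `u_X`, `X ∈ 𝒮`. -/
def longestSubgroup (G : Subgroup M.symmetryGroup) : Subgroup M.Group :=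
  Subgroup.closure {u | ∃ X ∈ sphericalOrbits G, M.IsLongest X u}

/-- Two Coxeter graphs are isomorphic: a bijection between the vertices preserves the entries. -/
def IsIsomorphic {S' : Type*} (M : CoxeterMatrix S) (N : CoxeterMatrix S') : Prop :=
  ∃ e : S ≃ S', ∀ s t, N (e s) (e t) = M s t

open Classical in
/-- The simply laced Coxeter graph with underlying graph `T`: no edge is labelled. -/
def ofGraph {V : Type*} (T : SimpleGraph V) : CoxeterMatrix V where
  M := Matrix.of fun i j => if i = j then 1 else if T.Adj i j then 3 else 2
  isSymm := by
    ext i j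
    simp [Matrix.transpose_apply, eq_comm, SimpleGraph.adj_comm]
  diagonal i := by simp
  off_diagonal i j h := by
    simp only [Matrix.of_apply, h, if_false]
    split_ifs <;> decide

/-- The Coxeter graph `D_m` (`m ≥ 4`). The number `i` stands for Bourbaki's vertex `s_{i+1}`: the
path `s_1, …, s_{m-1}` together with the edge between `s_{m-2}` and `s_m`. (Mathlib's
`CoxeterMatrix.D` also joins `s_{m-1}` and `s_m`, which gives a triangle, so it is not used.) -/
def typeD (m : ℕ) : CoxeterMatrix (Fin m) :=
  ofGraph (SimpleGraph.fromRel fun i j : Fin m =>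
    ((i : ℕ) + 1 = j ∧ (j : ℕ) + 1 < m) ∨ ((i : ℕ) + 3 = m ∧ (j : ℕ) + 1 = m))

/-- The affine Coxeter graph `Ã_m` (`m ≥ 2`), a circuit with `m + 1` vertices. -/
def affineA (m : ℕ) : CoxeterMatrix (Fin (m + 1)) :=
  ofGraph (SimpleGraph.cycleGraph (m + 1))

/-- The affine Coxeter graph `D̃_m` (`m ≥ 4`), with vertices `s_0, …, s_m`: the path
`s_1, …, s_{m-1}` together with the edges `s_0 s_2` and `s_{m-2} s_m`. -/
def affineD (m : ℕ) : CoxeterMatrix (Fin (m + 1)) :=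
  ofGraph (SimpleGraph.fromRel fun i j : Fin (m + 1) =>
    ((i : ℕ) = 0 ∧ (j : ℕ) = 2) ∨
    (1 ≤ (i : ℕ) ∧ (i : ℕ) + 1 = j ∧ (j : ℕ) < m) ∨
    ((i : ℕ) + 2 = m ∧ (j : ℕ) = m))

/-- The affine Coxeter graph `Ẽ_6`: the path `s_1, s_3, s_4, s_5, s_6` together with the branch
`s_4, s_2, s_0`. -/
def affineE₆ : CoxeterMatrix (Fin 7) :=
  ofGraph (SimpleGraph.fromRel fun i j : Fin 7 =>
    (i, j) ∈ ({(1, 3), (3, 4), (4, 5), (5, 6), (4, 2), (2, 0)} : Finset (Fin 7 × Fin 7)))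

/-- The affine Coxeter graph `Ẽ_7`: the path `s_0, s_1, s_3, s_4, s_5, s_6, s_7` together with the
edge `s_4 s_2`. -/
def affineE₇ : CoxeterMatrix (Fin 8) :=
  ofGraph (SimpleGraph.fromRel fun i j : Fin 8 =>
    (i, j) ∈
      ({(0, 1), (1, 3), (3, 4), (4, 5), (5, 6), (6, 7), (4, 2)} : Finset (Fin 8 × Fin 8)))

/-- The locally spherical Coxeter graph `_∞A_∞`: the two-sided infinite path. -/
def biinfiniteA : CoxeterMatrix ℤ :=
  ofGraph (SimpleGraph.fromRel fun i j : ℤ => i + 1 = j)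

/-- The locally spherical Coxeter graph `D_∞`. The number `i` stands for the vertex `s_{i+1}`: the
one-sided infinite path `s_2, s_3, s_4, …` together with the edge `s_1 s_3`. -/
def infiniteD : CoxeterMatrix ℕ :=
  ofGraph (SimpleGraph.fromRel fun i j : ℕ => (i = 0 ∧ j = 2) ∨ (1 ≤ i ∧ i + 1 = j))

end CoxeterMatrix

/-- A root prebasis `(S, V, Π, R)` whose Coxeter matrix is `M`. Here `V = ⊕_{s ∈ S} ℝ α_s` is modelled
by `S →₀ ℝ` with `α_s = single s 1`. A linear reflection `σ_s` with `σ_s(α_s) = -α_s` is the same thing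
as a linear form `coroot s` with `coroot s (α_s) = 2`, through `σ_s(x) = x - coroot s (x) • α_s`.
The order of `σ_s σ_t` is `m_{s,t}`, where `0` means infinite order. -/
structure RootPrebasis {S : Type*} (M : CoxeterMatrix S) where
  coroot : S → Module.Dual ℝ (S →₀ ℝ)
  coroot_self : ∀ s, coroot s (Finsupp.single s 1) = 2
  orderOf_mul : ∀ s t,
    orderOf (Module.reflection (coroot_self s) * Module.reflection (coroot_self t)) = M s t

namespace RootPrebasis

variable {S : Type*} {M : CoxeterMatrix S} (B : RootPrebasis M)

/-- The simple root `α_s`. -/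
abbrev simpleRoot (s : S) : S →₀ ℝ := Finsupp.single s 1

/-- The reflection `σ_s`. -/
def refl (s : S) : (S →₀ ℝ) ≃ₗ[ℝ] (S →₀ ℝ) := Module.reflection (B.coroot_self s)

/-- The linear representation `f : W → GL(V)` that sends `s` to `σ_s`. -/
def rep : M.Group →* ((S →₀ ℝ) ≃ₗ[ℝ] (S →₀ ℝ)) :=
  M.toCoxeterSystem.lift ⟨B.refl, fun s t => by
    rw [← B.orderOf_mul s t]
    exact pow_orderOf_eq_one _⟩

@[simp] lemma rep_simple (s : S) : B.rep (M.simple s) = B.refl s :=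
  M.toCoxeterSystem.lift_apply_simple _ s

/-- `Φ = {w(α_s) : s ∈ S, w ∈ W}`. -/
def roots : Set (S →₀ ℝ) := {β | ∃ (w : M.Group) (s : S), β = B.rep w (simpleRoot s)}

/-- `Φ⁺`: the roots all of whose coordinates are nonnegative. -/
def posRoots : Set (S →₀ ℝ) := {β | β ∈ B.roots ∧ ∀ s, 0 ≤ β s}

/-- `Φ⁻`: the roots all of whose coordinates are nonpositive. -/
def negRoots : Set (S →₀ ℝ) := {β | β ∈ B.roots ∧ ∀ s, β s ≤ 0}

/-- A root basis is a root prebasis such that `Φ` is the disjoint union of `Φ⁺` and `Φ⁻`. -/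
def IsRootBasis : Prop :=
  B.roots = B.posRoots ∪ B.negRoots ∧ Disjoint B.posRoots B.negRoots

/-- A reduced root basis is a root basis with `ℝ α_s ∩ Φ = {α_s, -α_s}` for all `s`. -/
def IsReduced : Prop :=
  B.IsRootBasis ∧
    ∀ s, (Submodule.span ℝ {simpleRoot s} : Set (S →₀ ℝ)) ∩ B.roots =
      {simpleRoot s, -simpleRoot s}

/-- The action of a symmetry on `V`, given by `g(α_s) = α_{g(s)}`. -/
def actV (g : M.symmetryGroup) : (S →₀ ℝ) ≃ₗ[ℝ] (S →₀ ℝ) :=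
  Finsupp.domLCongr (g : Equiv.Perm S)

@[simp] lemma actV_simpleRoot (g : M.symmetryGroup) (s : S) :
    actV g (simpleRoot s) = simpleRoot (g • s) := by
  simp [actV, simpleRoot, Subgroup.smul_def]

/-- The root basis is symmetric with respect to `G`: `σ_{g(s)} = g σ_s g⁻¹` for `g ∈ G`, `s ∈ S`. -/
def IsSymmetric (G : Subgroup M.symmetryGroup) : Prop :=
  ∀ g ∈ G, ∀ s, B.refl (g • s) = actV g * B.refl s * (actV g)⁻¹

variable {B} {G : Subgroup M.symmetryGroup}

/-- The representation `f` is equivariant: `f(g(w)) = g f(w) g⁻¹`. -/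
lemma IsSymmetric.rep_symmetryAct (hB : B.IsSymmetric G) {g : M.symmetryGroup} (hg : g ∈ G)
    (w : M.Group) : B.rep (M.symmetryAct g w) = actV g * B.rep w * (actV g)⁻¹ := by
  refine M.toCoxeterSystem.simple_induction
    (p := fun w => B.rep (M.symmetryAct g w) = actV g * B.rep w * (actV g)⁻¹) w (fun s => ?_) ?_ (fun v w hv hw => ?_)
  · rw [CoxeterMatrix.toCoxeterSystem_simple, CoxeterMatrix.symmetryAct_simple, rep_simple,
      rep_simple]
    exact hB g hg s
  · simp
  · rw [map_mul, map_mul, map_mul, hv, hw]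
    group

lemma IsSymmetric.actV_mem_posRoots (hB : B.IsSymmetric G) {g : M.symmetryGroup} (hg : g ∈ G)
    {β : S →₀ ℝ} (hβ : β ∈ B.posRoots) : actV g β ∈ B.posRoots := by
  obtain ⟨⟨w, s, rfl⟩, hpos⟩ := hβ
  refine ⟨⟨M.symmetryAct g w, g • s, ?_⟩, fun t => ?_⟩
  · rw [hB.rep_symmetryAct hg, ← actV_simpleRoot, LinearEquiv.mul_apply, LinearEquiv.mul_apply]
    congr 2
    exact ((actV g).symm_apply_apply _).symm
  · simpa [actV, Finsupp.domLCongr_apply, Finsupp.domCongr_apply] using hpos _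

/-- The action of `g ∈ G` on the set `Φ⁺`. -/
def actPos (hB : B.IsSymmetric G) (g : G) (β : B.posRoots) : B.posRoots :=
  ⟨actV (g : M.symmetryGroup) β, hB.actV_mem_posRoots g.2 β.2⟩

/-- The subspace `E^G` of the vector space `E` over `K` with basis `(e_β)_{β ∈ Φ⁺}`; here `E` is
`B.posRoots →₀ K`, `e_β` is `single β 1`, and `g ∈ G` acts linearly by `g(e_β) = e_{g(β)}`. -/
def fixedE (K : Type*) [Field K] (hB : B.IsSymmetric G) : Submodule K (B.posRoots →₀ K) :=
  ⨅ g : G, LinearMap.eqLocus (Finsupp.lmapDomain K K (actPos hB g)) LinearMap.id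

variable (B)

/-- `ê_ω = ∑_{α ∈ ω} e_α`, for a finite subset `ω` of `Φ⁺`. -/
def sumE (K : Type*) [Field K] (ω : Set (S →₀ ℝ)) : B.posRoots →₀ K :=
  ∑ᶠ (α : B.posRoots) (_ : (α : S →₀ ℝ) ∈ ω), Finsupp.single α 1

/-- `α̂_X = ∑_{s ∈ X} α_s`, for a finite subset `X` of `S`. -/
def hatRoot (X : Set S) : S →₀ ℝ := ∑ᶠ s ∈ X, simpleRoot s

/-- `ω_X = {α_s : s ∈ X}`. -/
def simpleOrbit (X : Set S) : Set (S →₀ ℝ) := simpleRoot '' X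

/-- The root system `Φ̂` of the equivariant root basis `B̂`: its simple roots are the `α̂_X`, `X ∈ 𝒮`,
its simple reflections are the restrictions of the `f(u_X)`, and `Φ̂` consists of the images of the
simple roots under the group generated by the simple reflections. -/
def hatRoots (G : Subgroup M.symmetryGroup) : Set (S →₀ ℝ) :=
  {β | ∃ w ∈ CoxeterMatrix.longestSubgroup G, ∃ X ∈ CoxeterMatrix.sphericalOrbits G,
    β = B.rep w (hatRoot X)}

/-- `Φ̂⁺`: the elements of `Φ̂` that are linear combinations of the `α̂_X`, `X ∈ 𝒮`, with
nonnegative coefficients. -/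
def hatPosRoots (G : Subgroup M.symmetryGroup) : Set (S →₀ ℝ) :=
  {β | β ∈ B.hatRoots G ∧ ∃ c : CoxeterMatrix.sphericalOrbits G →₀ ℝ,
    (∀ X, 0 ≤ c X) ∧ β = c.sum fun X a => a • hatRoot (X : Set S)}

/-- The graph of the map `F` from `Φ̂⁺` to the set of finite orbits of `Φ⁺` under `G`:
`F(w(α̂_X)) = w(ω_X)` for `X ∈ 𝒮` and `w ∈ W^G`. -/
def IsF (G : Subgroup M.symmetryGroup) (β : S →₀ ℝ) (ω : Set (S →₀ ℝ)) : Prop :=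
  ∃ X ∈ CoxeterMatrix.sphericalOrbits G, ∃ w ∈ CoxeterMatrix.fixedSubgroup G,
    β = B.rep w (hatRoot X) ∧ ω = B.rep w '' simpleOrbit X

/-- The subset `{ê_{F(β)} : β ∈ Φ̂⁺}` of `E^G`. -/
def hatBasis (K : Type*) [Field K] (G : Subgroup M.symmetryGroup) : Set (B.posRoots →₀ K) :=
  {x | ∃ β ∈ B.hatPosRoots G, ∃ ω, B.IsF G β ω ∧ x = B.sumE K ω}

variable {B}

/-- The `Φ̂⁺`-basis property: the set `{ê_{F(β)} : β ∈ Φ̂⁺}` is a basis of `E^G`. -/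
def HatBasisProperty (K : Type*) [Field K] (hB : B.IsSymmetric G) : Prop :=
  LinearIndepOn K id (B.hatBasis K G) ∧ Submodule.span K (B.hatBasis K G) = fixedE K hB

end RootPrebasis

end

/-!
The hypotheses enter through two facts about roots.

* Every positive root `β` is `w(α_r)` with `w ∈ W^G` (`RootPrebasis.exists_fixed_rep_eq`): the sum
  of the `e_γ` over the orbit of `β` is a fixed vector, so it is a combination of the `ê_{F(β̂)}`.
* Hence a root is orthogonal to all its other images under `G`
  (`RootPrebasis.IsPair.actV_eq_or_apply_eq_zero`). For simple roots this is
  `RootPrebasis.coroot_eq_zero_of_orbit`, and elements of `W^G` commute with `G`.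

The rest is a classification of the graphs that carry such roots, formalized by the structure
`OrthogonalRoots`. It lives on `(root, coroot)` pairs and needs neither an invariant form nor
integral coefficients; reflecting a simple root through the vertices of a finite connected set
gives a root with that set as its support (`OrthogonalRoots.IsRootOn.exists_of_finConn`). Applying
orthogonality to these roots shows that there is no edge between a connected set and a disjoint
image of it, that every nontrivial `g ∈ G` has a fixed vertex `c` with a neighbour moved by `g`
(`OrthogonalRoots.exists_branch`), and that every edge is simple (`OrthogonalRoots.mul_eq_one`).

If the graph has a cycle, a shortest path of moved vertices between two fixed ones forms, together
with its image under `g`, a cycle of even length, and this cycle exhausts the graph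
(`OrthogonalRoots.exists_iso_cycleGraph`).

If the graph is a tree, all simple roots can be rescaled to have the same length, and one gets a
set of integral roots (`TreeRoots`). The subtree of fixed vertices, rooted at `c`, is then combined
with the branches of moved vertices. All of these start at `c`, up to `g` there is only one of them,
and it is a path (`TreeRoots.moved_child_of_fixed`, `TreeRoots.child_unique`); `g` permutes two or
three copies of it (`TreeRoots.perm_orbit`). The trees that have this shape but are not in the list
contain one of finitely many small configurations, and in each of these an explicit sequence of
simple reflections leads to a root `x` with `g(x) ≠ x` and `(x, g(x)) ≠ 0`
(`TreeRoots.false_of_configuration`). The graph `Ẽ₇` is excluded in this way too.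
-/

/-! ### Roots and coroots of a reduced root basis -/

noncomputable section

namespace RootPrebasis

variable {S : Type*} {M : CoxeterMatrix S} (B : RootPrebasis M)

lemma refl_apply (s : S) (x : S →₀ ℝ) :
    B.refl s x = x - B.coroot s x • simpleRoot s :=
  Module.reflection_apply x (B.coroot_self s)

@[simp] lemma refl_refl (s : S) (x : S →₀ ℝ) : B.refl s (B.refl s x) = x :=
  Module.involutive_reflection (B.coroot_self s) x

lemma simpleRoot_mem_roots (s : S) : simpleRoot s ∈ B.roots := ⟨1, s, by simp⟩

lemma rep_mem_roots (w : M.Group) {β : S →₀ ℝ} (hβ : β ∈ B.roots) : B.rep w β ∈ B.roots := by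
  obtain ⟨v, s, rfl⟩ := hβ
  exact ⟨w * v, s, by simp⟩

lemma refl_mem_roots (s : S) {β : S →₀ ℝ} (hβ : β ∈ B.roots) : B.refl s β ∈ B.roots := by
  rw [← B.rep_simple]
  exact B.rep_mem_roots _ hβ

lemma neg_mem_roots {β : S →₀ ℝ} (hβ : β ∈ B.roots) : -β ∈ B.roots := by
  obtain ⟨v, s, rfl⟩ := hβ
  refine ⟨v * M.simple s, s, ?_⟩
  have h2 : B.refl s (simpleRoot s) = -simpleRoot s :=
    Module.reflection_apply_self (B.coroot_self s)
  rw [map_mul, LinearEquiv.mul_apply, rep_simple, h2, map_neg]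

lemma ne_zero_of_mem_roots {β : S →₀ ℝ} (hβ : β ∈ B.roots) : β ≠ 0 := by
  obtain ⟨v, s, rfl⟩ := hβ
  rw [Ne, LinearEquiv.map_eq_zero_iff]
  simp [simpleRoot]

variable {B}

lemma IsRootBasis.nonneg_or_nonpos (h : B.IsRootBasis) {β : S →₀ ℝ} (hβ : β ∈ B.roots) :
    (∀ s, 0 ≤ β s) ∨ (∀ s, β s ≤ 0) := by
  rw [h.1] at hβ
  exact hβ.imp And.right And.right

lemma IsRootBasis.nonneg_of_pos (h : B.IsRootBasis) {β : S →₀ ℝ} (hβ : β ∈ B.roots) {t : S}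
    (ht : 0 < β t) (s : S) : 0 ≤ β s :=
  (h.nonneg_or_nonpos hβ).elim (fun h => h s) fun h => absurd (h t) ht.not_ge

lemma IsRootBasis.coroot_nonpos (h : B.IsRootBasis) {s t : S} (hst : s ≠ t) :
    B.coroot s (simpleRoot t) ≤ 0 := by
  have := h.nonneg_of_pos (B.refl_mem_roots s (B.simpleRoot_mem_roots t)) (t := t)
    (by simp [refl_apply, hst]) s
  simpa [refl_apply, hst.symm, hst] using this

/-- Otherwise `σ_t σ_s(α_t)` would have coordinates of both signs. -/
lemma IsRootBasis.one_le_mul (h : B.IsRootBasis) {s t : S} (hst : s ≠ t)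
    (h0 : B.coroot s (simpleRoot t) ≠ 0) :
    1 ≤ B.coroot s (simpleRoot t) * B.coroot t (simpleRoot s) := by
  have h1 := h.coroot_nonpos hst
  have := h.nonneg_of_pos (B.refl_mem_roots t (B.refl_mem_roots s (B.simpleRoot_mem_roots t)))
    (t := s) (by
      simpa [refl_apply, hst.symm, hst] using lt_of_le_of_ne h1 h0) t
  have h2 := B.coroot_self t
  simp [refl_apply, hst.symm, -Finsupp.smul_single] at this h2 ⊢
  rw [h2] at this
  linarith

lemma IsRootBasis.coroot_eq_zero_comm (h : B.IsRootBasis) {s t : S} (hst : s ≠ t)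
    (h0 : B.coroot s (simpleRoot t) = 0) : B.coroot t (simpleRoot s) = 0 := by
  by_contra h1
  have := h.one_le_mul hst.symm h1
  rw [h0, mul_zero] at this
  linarith

lemma smul_simpleRoot_inj {t : S} {a b : ℝ} : a • simpleRoot t = b • simpleRoot t ↔ a = b :=
  ⟨fun h => by simpa [simpleRoot] using congrArg (fun v => v t) h, fun h => by rw [h]⟩

lemma matrix_eq_two_of_coroot_eq_zero {s t : S} (hst : s ≠ t)
    (h1 : B.coroot s (simpleRoot t) = 0) (h2 : B.coroot t (simpleRoot s) = 0) : M s t = 2 := by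
  have hM : orderOf (B.refl s * B.refl t) = M s t := B.orderOf_mul s t
  have hsq : (B.refl s * B.refl t) ^ 2 = 1 := by
    ext1 x
    have e1 := B.coroot_self s
    have e2 := B.coroot_self t
    simp only [pow_two, LinearEquiv.mul_apply, refl_apply, map_sub, map_smul, h1, h2, e1, e2,
      LinearEquiv.coe_one, id]
    module
  have hd := orderOf_dvd_of_pow_eq_one hsq
  rw [hM] at hd
  have := M.off_diagonal s t hst
  rcases (Nat.dvd_prime Nat.prime_two).1 hd with h | h
  · exact absurd h this
  · exact h

lemma coroot_eq_zero_of_matrix_eq_two {s t : S} (hst : s ≠ t) (h : M s t = 2) :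
    B.coroot s (simpleRoot t) = 0 := by
  have hM : orderOf (B.refl s * B.refl t) = M s t := B.orderOf_mul s t
  have hsq : (B.refl s * B.refl t) ^ 2 = 1 := by
    rw [← h, ← hM, pow_orderOf_eq_one]
  have h3 : B.refl s (B.refl t (simpleRoot t)) = B.refl t (B.refl s (simpleRoot t)) := by
    have := congrArg (fun f => f (B.refl t (B.refl s (simpleRoot t)))) hsq
    simpa [pow_two, LinearEquiv.mul_apply] using this
  have h4 := congrArg (fun v => v s) h3
  have e2 := B.coroot_self t
  simp [refl_apply, hst, -Finsupp.smul_single] at h4 e2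
  simp [e2] at h4
  linarith

lemma matrix_eq_three_of_mul_eq_one {s t : S} (hst : s ≠ t)
    (h : B.coroot s (simpleRoot t) * B.coroot t (simpleRoot s) = 1) : M s t = 3 := by
  have hM : orderOf (B.refl s * B.refl t) = M s t := B.orderOf_mul s t
  -- the braid relation
  have hbraid : ∀ x, B.refl s (B.refl t (B.refl s x)) = B.refl t (B.refl s (B.refl t x)) := by
    intro x
    have e1 := B.coroot_self s
    have e2 := B.coroot_self t
    simp only [refl_apply, map_sub, map_smul, e1, e2]
    match_scalars
    · ring
    · linear_combination (-B.coroot s x) * h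
    · linear_combination (B.coroot t x) * h
  have hcube : (B.refl s * B.refl t) ^ 3 = 1 := by
    ext1 x
    have := hbraid (B.refl t (B.refl s (B.refl t x)))
    simp only [pow_succ, pow_zero, one_mul, LinearEquiv.mul_apply, LinearEquiv.coe_one, id]
    rw [hbraid]
    simp
  have hd := orderOf_dvd_of_pow_eq_one hcube
  rw [hM] at hd
  have := M.off_diagonal s t hst
  rcases (Nat.dvd_prime Nat.prime_three).1 hd with h | h
  · exact absurd h this
  · exact h

/-- A root determines its coroot: the reflections in `W` attached to proportional roots agree.
Otherwise their product would be a nontrivial unipotent element, and it or its inverse would map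
some simple root to a vector with coordinates of both signs. -/
lemma IsReduced.coroot_rep (h : B.IsReduced) {v : M.Group} {s t : S} {μ : ℝ}
    (hv : B.rep v (simpleRoot s) = μ • simpleRoot t) (y : S →₀ ℝ) :
    B.coroot s (B.rep v⁻¹ y) = μ * B.coroot t y := by
  have hμ : μ = 1 ∨ μ = -1 := by
    have h1 : μ • simpleRoot t ∈ (Submodule.span ℝ {simpleRoot t} : Set (S →₀ ℝ)) ∩ B.roots :=
      ⟨Submodule.smul_mem _ _ (Submodule.mem_span_singleton_self _),
        hv ▸ B.rep_mem_roots v (B.simpleRoot_mem_roots s)⟩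
    rw [h.2 t] at h1
    rcases h1 with h1 | h1
    · left; simpa [simpleRoot] using congrArg (fun v => v t) h1
    · right; simpa [simpleRoot] using congrArg (fun v => v t) h1
  have hμ2 : μ * μ = 1 := by rcases hμ with rfl | rfl <;> norm_num
  -- the linear form `c` measures the difference of the two coroots
  let c : (S →₀ ℝ) → ℝ := fun y => μ * B.coroot s (B.rep v⁻¹ y)
  have hvi : B.rep v⁻¹ (simpleRoot t) = μ • simpleRoot s := by
    have : B.rep v⁻¹ (B.rep v (simpleRoot s)) = simpleRoot s := by
      rw [← LinearEquiv.mul_apply, ← map_mul]; simp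
    rw [hv, map_smul] at this
    rw [← this, smul_smul, hμ2, one_smul]
  have hvv : ∀ x, B.rep v (B.rep v⁻¹ x) = x := fun x => by
    rw [← LinearEquiv.mul_apply, ← map_mul]; simp
  have hu : ∀ x, B.rep (v * M.simple s * v⁻¹) x = x - c x • simpleRoot t := by
    intro x
    simp only [map_mul, LinearEquiv.mul_apply, rep_simple, refl_apply, map_sub, map_smul, hvv, hv, c]
    module
  have key : ∀ r, c (simpleRoot r) = B.coroot t (simpleRoot r) := by
    intro r
    have e2 := B.coroot_self t
    have e1 := B.coroot_self s
    have ct : c (simpleRoot t) = 2 := by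
      simp only [c, hvi, map_smul, e1, smul_eq_mul]
      linear_combination 2 * hμ2
    by_cases hr : r = t
    · subst hr; rw [ct, e2]
    have p1 := h.1.nonneg_of_pos (B.rep_mem_roots (v * M.simple s * v⁻¹)
      (B.refl_mem_roots t (B.simpleRoot_mem_roots r))) (t := r)
      (by rw [hu]; simp [refl_apply, hr]) t
    have p2 := h.1.nonneg_of_pos (B.refl_mem_roots t (B.rep_mem_roots (v * M.simple s * v⁻¹)
      (B.simpleRoot_mem_roots r))) (t := r)
      (by rw [hu]; simp [refl_apply, hr]) t
    have hc : c (simpleRoot r - B.coroot t (simpleRoot r) • simpleRoot t) =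
        c (simpleRoot r) - B.coroot t (simpleRoot r) * c (simpleRoot t) := by
      simp only [c, map_sub, map_smul, smul_eq_mul]; ring
    rw [hu, refl_apply, hc, ct] at p1
    rw [hu, refl_apply] at p2
    simp only [map_sub, map_smul, e2, smul_eq_mul] at p2
    simp [hr] at p1 p2
    linarith
  have hlin : μ • ((B.coroot s).comp (B.rep v⁻¹ : (S →₀ ℝ) →ₗ[ℝ] (S →₀ ℝ))) = B.coroot t := by
    refine Finsupp.lhom_ext' fun r => LinearMap.ext_ring ?_
    simpa [c] using key r
  have := congrArg (fun f => μ * f y) hlin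
  simp only [LinearMap.smul_apply, LinearMap.comp_apply, smul_eq_mul, LinearEquiv.coe_coe] at this
  rw [← this, ← mul_assoc, hμ2, one_mul]

variable (B) in
/-- `(x, φ)` is a (scaled) root with its coroot: up to a nonzero scalar, `x = w(α_s)` and
`φ = coroot s ∘ w⁻¹`. The scalar makes the notion independent of the lengths of the roots. -/
def IsPair (x : S →₀ ℝ) (φ : Module.Dual ℝ (S →₀ ℝ)) : Prop :=
  ∃ (c : ℝ) (w : M.Group) (s : S), c ≠ 0 ∧ x = c • B.rep w (simpleRoot s) ∧
    ∀ y, φ y = c⁻¹ * B.coroot s (B.rep w⁻¹ y)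

lemma isPair_simple (s : S) : B.IsPair (simpleRoot s) (B.coroot s) :=
  ⟨1, 1, s, one_ne_zero, by simp, by simp⟩

lemma rep_inv_rep (w : M.Group) (x : S →₀ ℝ) : B.rep w⁻¹ (B.rep w x) = x := by
  rw [← LinearEquiv.mul_apply, ← map_mul]; simp

lemma rep_rep_inv (w : M.Group) (x : S →₀ ℝ) : B.rep w (B.rep w⁻¹ x) = x := by
  rw [← LinearEquiv.mul_apply, ← map_mul]; simp

lemma IsPair.smul {x : S →₀ ℝ} {φ : Module.Dual ℝ (S →₀ ℝ)} (h : B.IsPair x φ) {c : ℝ}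
    (hc : c ≠ 0) : B.IsPair (c • x) (c⁻¹ • φ) := by
  obtain ⟨d, w, s, hd, rfl, hφ⟩ := h
  refine ⟨c * d, w, s, mul_ne_zero hc hd, by rw [smul_smul], fun y => ?_⟩
  rw [LinearMap.smul_apply, hφ, smul_eq_mul, mul_inv, mul_assoc]

lemma IsPair.apply_self {x : S →₀ ℝ} {φ : Module.Dual ℝ (S →₀ ℝ)} (h : B.IsPair x φ) :
    φ x = 2 := by
  obtain ⟨d, w, s, hd, rfl, hφ⟩ := h
  have := B.coroot_self s
  rw [hφ, map_smul, map_smul, rep_inv_rep, this, smul_eq_mul]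
  field_simp

lemma IsPair.reflect {x y : S →₀ ℝ} {φ ψ : Module.Dual ℝ (S →₀ ℝ)} (hx : B.IsPair x φ)
    (hy : B.IsPair y ψ) : B.IsPair (x - ψ x • y) (φ - φ y • ψ) := by
  obtain ⟨c, w, s, hc, rfl, hφ⟩ := hx
  obtain ⟨d, v, t, hd, rfl, hψ⟩ := hy
  have hr : ∀ z, B.rep (v * M.simple t * v⁻¹) z =
      z - B.coroot t (B.rep v⁻¹ z) • B.rep v (simpleRoot t) := by
    intro z
    simp only [map_mul, LinearEquiv.mul_apply, rep_simple, refl_apply, map_sub, map_smul,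
      rep_rep_inv]
  refine ⟨c, v * M.simple t * v⁻¹ * w, s, hc, ?_, fun z => ?_⟩
  · rw [map_mul, LinearEquiv.mul_apply, hr, hψ, map_smul, map_smul, smul_eq_mul, smul_sub,
      smul_smul, smul_smul]
    congr 2
    field_simp
  · have hinv : (v * M.simple t * v⁻¹ * w)⁻¹ = w⁻¹ * (v * M.simple t * v⁻¹) := by
      have : (M.simple t)⁻¹ = M.simple t := M.toCoxeterSystem.inv_simple t
      simp [mul_inv_rev, mul_assoc, this]
    rw [hinv, map_mul, LinearEquiv.mul_apply, hr, LinearMap.sub_apply, LinearMap.smul_apply, hφ,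
      hφ, hψ]
    simp only [map_sub, map_smul, smul_eq_mul]
    field_simp

lemma IsReduced.isPair_unique (h : B.IsReduced) {x : S →₀ ℝ} {φ ψ : Module.Dual ℝ (S →₀ ℝ)}
    (hφ : B.IsPair x φ) (hψ : B.IsPair x ψ) : φ = ψ := by
  obtain ⟨c, w, s, hc, rfl, hφ⟩ := hφ
  obtain ⟨d, v, t, hd, hx, hψ⟩ := hψ
  ext1 r
  ext1
  change φ (Finsupp.lsingle (R := ℝ) r 1) = ψ (Finsupp.lsingle (R := ℝ) r 1)
  rw [hφ, hψ]
  have hv : B.rep (v⁻¹ * w) (simpleRoot s) = (c⁻¹ * d) • simpleRoot t := by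
    rw [map_mul, LinearEquiv.mul_apply, mul_smul, ← rep_inv_rep (B := B) v (simpleRoot t), ← map_smul,
      ← map_smul, ← hx, smul_smul, inv_mul_cancel₀ hc, one_smul]
  have := h.coroot_rep hv (B.rep v⁻¹ (Finsupp.lsingle (R := ℝ) r 1))
  rw [mul_inv_rev, inv_inv, map_mul, LinearEquiv.mul_apply, rep_rep_inv] at this
  rw [this]
  have hcd : c⁻¹ * (c⁻¹ * d) = d⁻¹ := by
    -- `c⁻¹ d = ±1` because the root basis is reduced
    have h1 : (c⁻¹ * d) • simpleRoot t ∈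
        (Submodule.span ℝ {simpleRoot t} : Set (S →₀ ℝ)) ∩ B.roots :=
      ⟨Submodule.smul_mem _ _ (Submodule.mem_span_singleton_self _),
        hv ▸ B.rep_mem_roots _ (B.simpleRoot_mem_roots s)⟩
    rw [h.2 t] at h1
    have h2 : c⁻¹ * d = 1 ∨ c⁻¹ * d = -1 := by
      rcases h1 with h1 | h1
      · left; simpa [simpleRoot] using congrArg (fun v => v t) h1
      · right; simpa [simpleRoot] using congrArg (fun v => v t) h1
    have h3 : (c⁻¹ * d) * (c⁻¹ * d) = 1 := by rcases h2 with h2 | h2 <;> rw [h2] <;> norm_num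
    field_simp at h3 ⊢
    exact h3
  rw [← mul_assoc, hcd]

end RootPrebasis
end

/-! ### Orthogonality of the roots in one orbit -/

noncomputable section

namespace RootPrebasis

variable {S : Type*} {M : CoxeterMatrix S} {B : RootPrebasis M} {G : Subgroup M.symmetryGroup}

lemma smul_mem_orbit_iff (g : G) {s t : S} :
    g • t ∈ MulAction.orbit G s ↔ t ∈ MulAction.orbit G s := by
  rw [← MulAction.orbit_eq_iff, MulAction.orbit_smul, MulAction.orbit_eq_iff]

lemma actV_apply (g : M.symmetryGroup) (x : S →₀ ℝ) (s : S) : actV g x s = x (g⁻¹ • s) := rfl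

lemma actV_smul_apply (g : M.symmetryGroup) (x : S →₀ ℝ) (s : S) : actV g x (g • s) = x s := by
  rw [actV_apply, inv_smul_smul]

lemma actV_mul (g h : M.symmetryGroup) (x : S →₀ ℝ) : actV (g * h) x = actV g (actV h x) := by
  ext s
  simp [actV_apply, mul_smul]

lemma actV_eq_sum (g : M.symmetryGroup) (x : S →₀ ℝ) :
    actV g x = ∑ s ∈ x.support, Finsupp.single (g • s) (x s) := by
  conv_lhs => rw [← x.sum_single, Finsupp.sum, map_sum]
  refine Finset.sum_congr rfl fun s _ => ?_
  simp [actV, Subgroup.smul_def]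

lemma finite_range_actV (hfin : ∀ s : S, (MulAction.orbit G s).Finite) (x : S →₀ ℝ) :
    (Set.range fun g : G => actV (g : M.symmetryGroup) x).Finite := by
  have h1 : (Set.pi Set.univ fun s : x.support => MulAction.orbit G (s : S)).Finite :=
    Set.Finite.pi fun s => hfin s
  refine (h1.image fun f => ∑ s : x.support, Finsupp.single (f s) (x s)).subset ?_
  rintro _ ⟨g, rfl⟩
  refine ⟨fun s => g • (s : S), fun s _ => ⟨g, rfl⟩, ?_⟩
  simp only
  rw [actV_eq_sum]
  exact Finset.sum_coe_sort x.support
    fun s => Finsupp.single ((g : M.symmetryGroup) • s) (x s)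

lemma actPos_mul (hB : B.IsSymmetric G) (g h : G) (β : B.posRoots) :
    actPos hB (g * h) β = actPos hB g (actPos hB h β) :=
  Subtype.ext (actV_mul _ _ _)

lemma actPos_one (hB : B.IsSymmetric G) (β : B.posRoots) : actPos hB 1 β = β := by
  refine Subtype.ext ?_
  ext s
  simp [actPos, actV_apply]

lemma sumE_apply_eq_zero (K : Type*) [Field K] {ω : Set (S →₀ ℝ)} {β : B.posRoots}
    (h : (β : S →₀ ℝ) ∉ ω) : B.sumE K ω β = 0 := by
  refine finsum_induction (fun f : B.posRoots →₀ K => f β = 0) rfl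
    (fun x y hx hy => by simp [hx, hy]) fun α => ?_
  refine finsum_induction (fun f : B.posRoots →₀ K => f β = 0) rfl
    (fun x y hx hy => by simp [hx, hy]) fun hα => ?_
  exact Finsupp.single_eq_of_ne fun e => h (e ▸ hα)

/-- The only consequence of the `Φ̂⁺`-basis property that is needed: every positive root is the
image of a simple root under an element of `W^G`. The sum of the `e_γ` over the orbit of a positive
root `β` is `G`-fixed, so some basis vector `ê_ω` has a nonzero coefficient at `β`, that is,
`β ∈ ω`. -/
lemma exists_fixed_rep_eq {K : Type*} [Field K] (hfin : ∀ s : S, (MulAction.orbit G s).Finite)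
    (hB : B.IsSymmetric G) (hbasis : HatBasisProperty K hB) {β : S →₀ ℝ} (hβ : β ∈ B.posRoots) :
    ∃ w ∈ CoxeterMatrix.fixedSubgroup G, ∃ r, β = B.rep w (simpleRoot r) := by
  classical
  set b : B.posRoots := ⟨β, hβ⟩ with hb
  let O : Set B.posRoots := Set.range fun g : G => actPos hB g b
  have hO : O.Finite := by
    refine Set.Finite.of_finite_image (f := Subtype.val) ?_ Subtype.val_injective.injOn
    rw [← Set.range_comp]
    exact finite_range_actV hfin β
  let x : B.posRoots →₀ K := ∑ γ ∈ hO.toFinset, Finsupp.single γ 1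
  have hx : x ∈ fixedE K hB := by
    simp only [fixedE, Submodule.mem_iInf, LinearMap.mem_eqLocus, LinearMap.id_apply]
    intro g
    simp only [x, map_sum, Finsupp.lmapDomain_apply, Finsupp.mapDomain_single]
    refine Finset.sum_nbij' (actPos hB g) (actPos hB g⁻¹) ?_ ?_ ?_ ?_ ?_
    · simp only [Set.Finite.mem_toFinset]
      rintro _ ⟨h, rfl⟩
      exact ⟨g * h, actPos_mul hB g h b⟩
    · simp only [Set.Finite.mem_toFinset]
      rintro _ ⟨h, rfl⟩
      exact ⟨g⁻¹ * h, actPos_mul hB g⁻¹ h b⟩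
    · intro a _
      rw [← actPos_mul, inv_mul_cancel, actPos_one]
    · intro a _
      rw [← actPos_mul, mul_inv_cancel, actPos_one]
    · intro a _
      rfl
  have hxb : x b = 1 := by
    have hmem : b ∈ hO.toFinset := by
      rw [Set.Finite.mem_toFinset]
      exact ⟨1, actPos_one hB b⟩
    simp [x, Finsupp.finsetSum_apply, Finsupp.single_apply, hmem]
  rw [← hbasis.2] at hx
  by_contra! hne
  have hle : Submodule.span K (B.hatBasis K G) ≤ LinearMap.ker (Finsupp.lapply (R := K) b) := by
    rw [Submodule.span_le]
    rintro _ ⟨γ, -, ω, ⟨X, -, w, hw, -, rfl⟩, rfl⟩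
    refine sumE_apply_eq_zero K ?_
    rintro ⟨_, ⟨r, -, rfl⟩, h⟩
    exact hne w hw r h.symm
  have := hle hx
  rw [LinearMap.mem_ker, Finsupp.lapply_apply, hxb] at this
  exact one_ne_zero this

lemma IsSymmetric.rep_actV (hB : B.IsSymmetric G) {w : M.Group}
    (hw : w ∈ CoxeterMatrix.fixedSubgroup G) {g : M.symmetryGroup} (hg : g ∈ G) (x : S →₀ ℝ) :
    B.rep w (actV g x) = actV g (B.rep w x) := by
  have h := hB.rep_symmetryAct hg w
  rw [hw g hg] at h
  conv_lhs => rw [h]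
  simp only [LinearEquiv.mul_apply]
  congr 2
  exact (actV g).symm_apply_apply x

lemma IsSymmetric.coroot_actV (hB : B.IsSymmetric G) {g : M.symmetryGroup} (hg : g ∈ G) (s : S)
    (x : S →₀ ℝ) : B.coroot (g • s) (actV g x) = B.coroot s x := by
  have h := congrArg (fun f => f (actV g x)) (hB g hg s)
  simp only [LinearEquiv.mul_apply] at h
  have h2 : (actV g)⁻¹ (actV g x) = x := (actV g).symm_apply_apply x
  rw [h2, refl_apply, refl_apply, map_sub, map_smul, actV_simpleRoot] at h
  exact smul_simpleRoot_inj.1 (sub_right_injective h)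

/-- Distinct simple roots in one `G`-orbit are orthogonal. Otherwise there is a non-simple positive
root `β` whose support lies in one orbit `X`. It has the form `w(α_r)` with `w ∈ W^G`, and then `w`
maps the sum of the simple roots in the orbit of `r` to a multiple of the sum over `X`, which forces
each `α_s`, `s ∈ X`, to be a positive combination of the roots in the orbit of `β`. -/
lemma coroot_eq_zero_of_orbit (hfin : ∀ s : S, (MulAction.orbit G s).Finite) (hr : B.IsReduced)
    (hB : B.IsSymmetric G)
    (hpos : ∀ β ∈ B.posRoots, ∃ w ∈ CoxeterMatrix.fixedSubgroup G, ∃ r,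
      β = B.rep w (simpleRoot r))
    {g : M.symmetryGroup} (hg : g ∈ G) {s : S} (hgs : g • s ≠ s) :
    B.coroot s (simpleRoot (g • s)) = 0 := by
  classical
  by_contra h0
  set t := g • s with ht
  set p := -B.coroot s (simpleRoot t) with hp
  have hp0 : 0 < p := by
    have := lt_of_le_of_ne (hr.1.coroot_nonpos (Ne.symm hgs)) h0
    linarith
  set β := B.refl s (simpleRoot t) with hβ
  have hβe : β = simpleRoot t + p • simpleRoot s := by rw [hβ, refl_apply, hp]; module
  have hβs : β s = p := by simp [hβe, hgs]
  have hβt : β t = 1 := by simp [hβe, hgs.symm]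
  have hβX : ∀ x, x ∉ MulAction.orbit G s → β x = 0 := by
    intro x hx
    have h1 : x ≠ s := by rintro rfl; exact hx (MulAction.mem_orbit_self _)
    have h2 : x ≠ t := by rintro rfl; exact hx ⟨⟨g, hg⟩, rfl⟩
    simp [hβe, h1, h2]
  have hβroot : β ∈ B.roots := B.refl_mem_roots s (B.simpleRoot_mem_roots t)
  have hβnn : ∀ x, 0 ≤ β x := hr.1.nonneg_of_pos hβroot (t := t) (by rw [hβt]; exact one_pos)
  obtain ⟨w, hw, r, hwr⟩ := hpos β ⟨hβroot, hβnn⟩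
  have hact : ∀ h : G, B.rep w (simpleRoot (h • r)) = actV (h : M.symmetryGroup) β := by
    intro h
    rw [show h • r = (h : M.symmetryGroup) • r from rfl, ← actV_simpleRoot,
      hB.rep_actV hw h.2, hwr]
  set X := (hfin s).toFinset with hX
  set Y := (hfin r).toFinset with hY
  set v : S →₀ ℝ := ∑ y ∈ Y, simpleRoot y with hv
  have hvapp : ∀ z, v z = if z ∈ Y then 1 else 0 := by
    intro z
    simp [hv, Finsupp.finsetSum_apply, Finsupp.single_apply]
  have hvG : ∀ h : G, actV (h : M.symmetryGroup) v = v := by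
    intro h
    ext z
    rw [actV_apply, hvapp, hvapp]
    congr 1
    simp only [hY, Set.Finite.mem_toFinset, eq_iff_iff]
    exact smul_mem_orbit_iff h⁻¹
  have hterm : ∀ y ∈ Y, ∀ x, 0 ≤ B.rep w (simpleRoot y) x := by
    intro y hy x
    obtain ⟨h, rfl⟩ := (Set.Finite.mem_toFinset _).1 hy
    simp only
    rw [hact, actV_apply]
    exact hβnn _
  have hterm0 : ∀ y ∈ Y, ∀ x, x ∉ X → B.rep w (simpleRoot y) x = 0 := by
    intro y hy x hx
    obtain ⟨h, rfl⟩ := (Set.Finite.mem_toFinset _).1 hy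
    simp only
    rw [hact, actV_apply]
    refine hβX _ fun hx' => hx ?_
    rw [hX, Set.Finite.mem_toFinset]
    exact (smul_mem_orbit_iff h⁻¹).1 hx'
  have hrY : r ∈ Y := (Set.Finite.mem_toFinset _).2 (MulAction.mem_orbit_self r)
  have hwv : ∀ x, B.rep w v x = ∑ y ∈ Y, B.rep w (simpleRoot y) x := by
    intro x
    rw [hv, map_sum, Finsupp.finsetSum_apply]
  have hlam : ∀ h : G, B.rep w v (h • s) = B.rep w v s := by
    intro h
    conv_lhs => rw [← hvG h, hB.rep_actV hw h.2]
    exact actV_smul_apply _ _ _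
  set l := B.rep w v s with hl
  have hl0 : 0 < l := by
    rw [hl, hwv]
    refine lt_of_lt_of_le ?_ (Finset.single_le_sum (fun y hy => hterm y hy s) hrY)
    rw [← hwr, hβs]
    exact hp0
  have hwvX : B.rep w v = l • ∑ x ∈ X, simpleRoot x := by
    ext x
    by_cases hx : x ∈ X
    · obtain ⟨h, rfl⟩ := (Set.Finite.mem_toFinset _).1 hx
      simp only
      rw [hlam]
      simp only [Finsupp.smul_apply, Finsupp.finsetSum_apply, Finsupp.single_apply,
        Finset.sum_ite_eq', smul_eq_mul]
      rw [if_pos hx, mul_one]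
    · rw [hwv, Finset.sum_eq_zero fun y hy => hterm0 y hy x hx]
      simp [Finsupp.single_apply, hx]
  have hvX : v = l • ∑ x ∈ X, B.rep w⁻¹ (simpleRoot x) := by
    rw [← rep_inv_rep (B := B) w v, hwvX, map_smul, map_sum]
  have hwi := (CoxeterMatrix.fixedSubgroup G).inv_mem hw
  have hinv : ∀ h : G, B.rep w⁻¹ (simpleRoot (h • s)) =
      actV (h : M.symmetryGroup) (B.rep w⁻¹ (simpleRoot s)) := by
    intro h
    rw [show h • s = (h : M.symmetryGroup) • s from rfl, ← actV_simpleRoot, hB.rep_actV hwi h.2]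
  have hvz : ∀ z, v z = l * ∑ x ∈ X, B.rep w⁻¹ (simpleRoot x) z := by
    intro z
    conv_lhs => rw [hvX]
    simp
  have hsX : s ∈ X := (Set.Finite.mem_toFinset _).2 (MulAction.mem_orbit_self s)
  rcases hr.1.nonneg_or_nonpos (B.rep_mem_roots w⁻¹ (B.simpleRoot_mem_roots s)) with hc | hc
  · have hc' : ∀ x ∈ X, ∀ z, 0 ≤ B.rep w⁻¹ (simpleRoot x) z := by
      intro x hx z
      obtain ⟨h, rfl⟩ := (Set.Finite.mem_toFinset _).1 hx
      simp only
      rw [hinv, actV_apply]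
      exact hc _
    have hcY : ∀ z, z ∉ Y → B.rep w⁻¹ (simpleRoot s) z = 0 := by
      intro z hz
      have h1 := hvz z
      rw [hvapp, if_neg hz] at h1
      have h2 := (mul_eq_zero.1 h1.symm).resolve_left hl0.ne'
      exact (Finset.sum_eq_zero_iff_of_nonneg fun x hx => hc' x hx z).1 h2 s hsX
    set c := B.rep w⁻¹ (simpleRoot s) with hcdef
    have hcsum : c = ∑ y ∈ Y, c y • simpleRoot y := by
      ext z
      by_cases hz : z ∈ Y
      · simp [Finsupp.finsetSum_apply, Finsupp.single_apply, hz]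
      · rw [hcY z hz]
        simp [Finsupp.finsetSum_apply, Finsupp.single_apply, hz]
    obtain ⟨y, hy⟩ : ∃ y, c y ≠ 0 := by
      by_contra! hall
      exact B.ne_zero_of_mem_roots (B.rep_mem_roots w⁻¹ (B.simpleRoot_mem_roots s))
        (Finsupp.ext hall)
    have hyY : y ∈ Y := by
      by_contra hyY
      exact hy (hcY y hyY)
    have hcy : 0 < c y := lt_of_le_of_ne (hc y) hy.symm
    have hαs : simpleRoot s = ∑ y ∈ Y, c y • B.rep w (simpleRoot y) := by
      rw [← rep_rep_inv (B := B) w (simpleRoot s), ← hcdef]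
      conv_lhs => rw [hcsum]
      simp only [map_sum, map_smul]
    obtain ⟨h, rfl⟩ := (Set.Finite.mem_toFinset _).1 hyY
    -- one of the two elements of the support of `h(β)` differs from `s`
    have hbad : ∀ x : S, 0 < β x → h • x = s := by
      intro x hx
      by_contra hne
      have h1 := congrArg (fun f => f (h • x)) hαs
      simp only [Finsupp.finsetSum_apply, Finsupp.smul_apply, smul_eq_mul] at h1
      rw [Finsupp.single_eq_of_ne hne] at h1
      have h2 := (Finset.sum_eq_zero_iff_of_nonneg fun y hy =>
        mul_nonneg (hc y) (hterm y hy (h • x))).1 h1.symm _ hyY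
      simp only at h2 hcy
      rw [hact] at h2
      have h3 : actV (h : M.symmetryGroup) β (h • x) = β x := actV_smul_apply _ _ _
      rw [h3] at h2
      exact (mul_pos hcy hx).ne' h2
    have e1 := hbad s (by rw [hβs]; exact hp0)
    have e2 := hbad t (by rw [hβt]; exact one_pos)
    exact hgs (smul_left_cancel h (e2.trans e1.symm))
  · have hc' : ∀ x ∈ X, ∀ z, B.rep w⁻¹ (simpleRoot x) z ≤ 0 := by
      intro x hx z
      obtain ⟨h, rfl⟩ := (Set.Finite.mem_toFinset _).1 hx
      simp only
      rw [hinv, actV_apply]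
      exact hc _
    have h1 := hvz r
    rw [hvapp, if_pos hrY] at h1
    have h2 := mul_nonpos_of_nonneg_of_nonpos hl0.le
      (Finset.sum_nonpos fun x hx => hc' x hx r)
    linarith

/-- The key orthogonality: a root is orthogonal to all its other images under `G`. -/
lemma IsPair.actV_eq_or_apply_eq_zero (hfin : ∀ s : S, (MulAction.orbit G s).Finite)
    (hr : B.IsReduced) (hB : B.IsSymmetric G)
    (hpos : ∀ β ∈ B.posRoots, ∃ w ∈ CoxeterMatrix.fixedSubgroup G, ∃ r,
      β = B.rep w (simpleRoot r))
    {x : S →₀ ℝ} {φ : Module.Dual ℝ (S →₀ ℝ)} (h : B.IsPair x φ) {g : M.symmetryGroup}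
    (hg : g ∈ G) : actV g x = x ∨ φ (actV g x) = 0 := by
  obtain ⟨d, w, hw, r, hd, rfl⟩ : ∃ (d : ℝ) (w : M.Group),
      w ∈ CoxeterMatrix.fixedSubgroup G ∧ ∃ r, d ≠ 0 ∧ x = d • B.rep w (simpleRoot r) := by
    obtain ⟨c, v, s, hc, rfl, -⟩ := h
    have hroot := B.rep_mem_roots v (B.simpleRoot_mem_roots s)
    rcases hr.1.nonneg_or_nonpos hroot with hn | hn
    · obtain ⟨w, hw, r, e⟩ := hpos _ ⟨hroot, hn⟩
      exact ⟨c, w, hw, r, hc, by rw [e]⟩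
    · obtain ⟨w, hw, r, e⟩ := hpos _ ⟨B.neg_mem_roots hroot, fun z => by
        simpa using hn z⟩
      exact ⟨-c, w, hw, r, neg_ne_zero.2 hc, by rw [← e, neg_smul, smul_neg, neg_neg]⟩
  by_cases hgr : g • r = r
  · left
    rw [map_smul, ← hB.rep_actV hw hg, actV_simpleRoot, hgr]
  · right
    let ψ : Module.Dual ℝ (S →₀ ℝ) :=
      d⁻¹ • (B.coroot r).comp (B.rep w⁻¹ : (S →₀ ℝ) →ₗ[ℝ] (S →₀ ℝ))
    have hψ : B.IsPair (d • B.rep w (simpleRoot r)) ψ := ⟨d, w, r, hd, rfl, fun y => rfl⟩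
    rw [hr.isPair_unique h hψ]
    simp only [ψ, LinearMap.smul_apply, LinearMap.comp_apply, LinearEquiv.coe_coe, map_smul]
    rw [← hB.rep_actV hw hg, rep_inv_rep, actV_simpleRoot,
      coroot_eq_zero_of_orbit hfin hr hB hpos hg hgr]
    simp

end RootPrebasis
end

/-! ### Finite connected sets of vertices -/

namespace SimpleGraph

variable {S : Type*} {Γ : SimpleGraph S}

/-- The finite set `T` of vertices is nonempty and induces a connected subgraph, expressed through
cuts: every proper nonempty subset `U` of `T` is joined by an edge to its complement in `T`. -/
def FinConn (Γ : SimpleGraph S) (T : Finset S) : Prop :=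
  T.Nonempty ∧ ∀ U ⊆ T, U.Nonempty → U ≠ T → ∃ u ∈ U, ∃ v ∈ T, v ∉ U ∧ Γ.Adj u v

namespace FinConn

lemma singleton (s : S) : Γ.FinConn {s} := by
  refine ⟨Finset.singleton_nonempty s, fun U hU hne hU' => ?_⟩
  exact absurd ((Finset.subset_singleton_iff.1 hU).resolve_left hne.ne_empty) hU'

variable [DecidableEq S]

/-- A connected finite set can be built up from any of its elements by adding one vertex at a time,
each new vertex being adjacent to an earlier one. -/
lemma induction {T : Finset S} (hT : Γ.FinConn T) {s : S} (hs : s ∈ T) {Q : Finset S → Prop}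
    (base : Q {s})
    (step : ∀ U ⊆ T, s ∈ U → Q U → ∀ u ∈ U, ∀ v ∈ T, v ∉ U → Γ.Adj u v → Q (insert v U)) :
    Q T := by
  have key : ∀ n, ∀ U ⊆ T, s ∈ U → Q U → T.card - U.card = n → Q T := by
    intro n
    induction n with
    | zero =>
      intro U hU _ hQ hc
      have : U = T := Finset.eq_of_subset_of_card_le hU (by omega)
      exact this ▸ hQ
    | succ n ih =>
      intro U hU hsU hQ hc
      have hne : U ≠ T := by rintro rfl; omega
      obtain ⟨u, hu, v, hv, hvU, huv⟩ := hT.2 U hU ⟨s, hsU⟩ hne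
      refine ih (insert v U) (Finset.insert_subset hv hU) (Finset.mem_insert_of_mem hsU)
        (step U hU hsU hQ u hu v hv hvU huv) ?_
      rw [Finset.card_insert_of_notMem hvU]
      omega
  exact key _ {s} (Finset.singleton_subset_iff.2 hs) (Finset.mem_singleton_self s) base rfl

lemma union {T T' : Finset S} (hT : Γ.FinConn T) (hT' : Γ.FinConn T')
    (h : (∃ x ∈ T, x ∈ T') ∨ ∃ x ∈ T, ∃ y ∈ T', Γ.Adj x y) : Γ.FinConn (T ∪ T') := by
  refine ⟨hT.1.mono Finset.subset_union_left, fun U hU hne hU' => ?_⟩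
  by_contra! hcut
  have h1 : ∀ T₁ ⊆ T ∪ T', Γ.FinConn T₁ → (∃ x ∈ T₁, x ∈ U) → T₁ ⊆ U := by
    rintro T₁ hT₁ hc ⟨x, hx, hxU⟩
    by_contra hsub
    obtain ⟨u, hu, v, hv, hvU, huv⟩ := hc.2 (U ∩ T₁) Finset.inter_subset_right
      ⟨x, Finset.mem_inter.2 ⟨hxU, hx⟩⟩ fun e => hsub fun y hy =>
        (Finset.mem_inter.1 (e.symm ▸ hy : y ∈ U ∩ T₁)).1
    exact hcut u (Finset.mem_inter.1 hu).1 v (hT₁ hv)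
      (fun hvU' => hvU (Finset.mem_inter.2 ⟨hvU', hv⟩)) huv
  have hT1 := h1 T Finset.subset_union_left hT
  have hT2 := h1 T' Finset.subset_union_right hT'
  have h3 : T ⊆ U ∧ T' ⊆ U := by
    have h4 : T ⊆ U ∨ T' ⊆ U := by
      obtain ⟨x, hx⟩ := hne
      rcases Finset.mem_union.1 (hU hx) with h | h
      · exact Or.inl (hT1 ⟨x, h, hx⟩)
      · exact Or.inr (hT2 ⟨x, h, hx⟩)
    rcases h with ⟨x, hx, hx'⟩ | ⟨x, hx, y, hy, hxy⟩
    · rcases h4 with h4 | h4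
      · exact ⟨h4, hT2 ⟨x, hx', h4 hx⟩⟩
      · exact ⟨hT1 ⟨x, hx, h4 hx'⟩, h4⟩
    · rcases h4 with h4 | h4
      · refine ⟨h4, hT2 ⟨y, hy, ?_⟩⟩
        by_contra hyU
        exact hcut x (h4 hx) y (Finset.mem_union_right _ hy) hyU hxy
      · refine ⟨hT1 ⟨x, hx, ?_⟩, h4⟩
        by_contra hxU
        exact hcut y (h4 hy) x (Finset.mem_union_left _ hx) hxU hxy.symm
  exact hU' (Finset.Subset.antisymm hU (Finset.union_subset h3.1 h3.2))

lemma insert {T : Finset S} (hT : Γ.FinConn T) {u v : S} (hu : u ∈ T) (huv : Γ.Adj u v) :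
    Γ.FinConn (insert v T) := by
  rw [Finset.insert_eq, Finset.union_comm]
  exact hT.union (singleton v) (Or.inr ⟨u, hu, v, Finset.mem_singleton_self v, huv⟩)

lemma of_walk {u v : S} (p : Γ.Walk u v) : Γ.FinConn p.support.toFinset := by
  induction p with
  | nil => simpa using singleton _
  | cons h p ih =>
    rw [Walk.support_cons, List.toFinset_cons]
    exact ih.insert (List.mem_toFinset.2 p.start_mem_support) h.symm

lemma exists_walk {T : Finset S} (hT : Γ.FinConn T) {a b : S} (ha : a ∈ T) (hb : b ∈ T) :
    ∃ p : Γ.Walk a b, ∀ x ∈ p.support, x ∈ T := by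
  refine hT.induction ha (Q := fun U => U ⊆ T → ∀ b ∈ U, ∃ p : Γ.Walk a b, ∀ x ∈ p.support, x ∈ T)
    ?_ ?_ subset_rfl b hb
  · intro _ b hb
    rw [Finset.mem_singleton.1 hb]
    exact ⟨Walk.nil, by simpa using ha⟩
  · intro U hU _ hQ u hu v hv _ huv _ b hb
    rcases Finset.mem_insert.1 hb with rfl | hb
    · obtain ⟨p, hp⟩ := hQ hU u hu
      refine ⟨p.concat huv, fun x hx => ?_⟩
      rw [Walk.support_concat] at hx
      rcases by simpa using hx with hx | rfl
      · exact hp x hx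
      · exact hv
    · exact hQ hU b hb

omit [DecidableEq S] in
/-- A connected finite set that meets both `A` and its complement contains an edge from the
complement of `A` to `A`. -/
lemma exists_adj {T : Finset S} (hT : Γ.FinConn T) {A : Set S} {a b : S} (ha : a ∈ T) (hb : b ∈ T)
    (haA : a ∉ A) (hbA : b ∈ A) : ∃ u ∈ T, ∃ v ∈ T, u ∉ A ∧ v ∈ A ∧ Γ.Adj u v := by
  classical
  obtain ⟨u, hu, v, hv, hvU, huv⟩ := hT.2 (T.filter (· ∉ A)) (Finset.filter_subset _ _)
    ⟨a, Finset.mem_filter.2 ⟨ha, haA⟩⟩ (fun e => (Finset.mem_filter.1 (show b ∈ T.filter (· ∉ A) from e.symm ▸ hb)).2 hbA)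
  refine ⟨u, (Finset.mem_filter.1 hu).1, v, hv, (Finset.mem_filter.1 hu).2, ?_, huv⟩
  by_contra hvA
  exact hvU (Finset.mem_filter.2 ⟨hv, hvA⟩)

end FinConn

/-- In a walk to a vertex of `A` one may stop at the first vertex of `A`. -/
lemma Walk.exists_first {A : Set S} {s a : S} (p : Γ.Walk s a) (ha : a ∈ A) :
    ∃ m ∈ A, ∃ q : Γ.Walk s m, (∀ x ∈ q.support, x ∈ p.support) ∧
      ∀ x ∈ q.support, x ∈ A → x = m := by
  induction p with
  | nil => exact ⟨_, ha, Walk.nil, by simp, by simp⟩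
  | @cons u v w h p ih =>
    by_cases hu : u ∈ A
    · exact ⟨u, hu, Walk.nil, by simp, by simp⟩
    · obtain ⟨m, hm, q, hq1, hq2⟩ := ih ha
      refine ⟨m, hm, Walk.cons h q, ?_, ?_⟩
      · intro x hx
        rw [Walk.support_cons, List.mem_cons] at hx ⊢
        exact hx.imp id (hq1 x)
      · intro x hx hxA
        rw [Walk.support_cons, List.mem_cons] at hx
        rcases hx with rfl | hx
        · exact absurd hxA hu
        · exact hq2 x hx hxA

/-- A walk from a vertex outside of `A` to `A` provides a finite connected set `T` that contains
its starting point, is disjoint from `A`, and is adjacent to some vertex of `A`. -/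
lemma Walk.exists_finConn_adj [DecidableEq S] {A : Set S} {s a : S} (p : Γ.Walk s a)
    (hs : s ∉ A) (ha : a ∈ A) : ∃ T, Γ.FinConn T ∧ s ∈ T ∧ (∀ x ∈ T, x ∉ A ∧ x ∈ p.support) ∧
      ∃ u ∈ T, ∃ m ∈ A, m ∈ p.support ∧ Γ.Adj u m := by
  induction p with
  | nil => exact absurd ha hs
  | @cons u v w h q ih =>
    by_cases hv : v ∈ A
    · exact ⟨{u}, FinConn.singleton u, Finset.mem_singleton_self u, by simpa using hs,
        u, Finset.mem_singleton_self u, v, hv, by simp, h⟩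
    · obtain ⟨T, hT, hvT, hTA, x, hx, m, hm, hmq, hxm⟩ := ih hv ha
      refine ⟨insert u T, hT.insert hvT h.symm, Finset.mem_insert_self _ _, ?_, x,
        Finset.mem_insert_of_mem hx, m, hm, by simp [hmq], hxm⟩
      intro y hy
      rcases Finset.mem_insert.1 hy with rfl | hy
      · exact ⟨hs, by simp⟩
      · exact ⟨(hTA y hy).1, by simp [(hTA y hy).2]⟩

end SimpleGraph

/-! ### Roots supported on connected sets -/

noncomputable section

variable {S : Type*}

/-- The linear action of a permutation of `S` on `S →₀ ℝ` by permutation of the coordinates. -/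
def permV (g : Equiv.Perm S) : (S →₀ ℝ) ≃ₗ[ℝ] (S →₀ ℝ) := Finsupp.domLCongr g

lemma permV_apply (g : Equiv.Perm S) (x : S →₀ ℝ) (s : S) : permV g x s = x (g⁻¹ s) := rfl

lemma permV_apply_apply (g : Equiv.Perm S) (x : S →₀ ℝ) (s : S) : permV g x (g s) = x s := by
  rw [permV_apply]
  simp

@[simp] lemma permV_single (g : Equiv.Perm S) (s : S) (c : ℝ) :
    permV g (Finsupp.single s c) = Finsupp.single (g s) c := by
  simp [permV]

lemma permV_one (x : S →₀ ℝ) : permV 1 x = x := by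
  ext s
  simp [permV_apply]

lemma permV_mul (g h : Equiv.Perm S) (x : S →₀ ℝ) : permV (g * h) x = permV g (permV h x) := by
  ext s
  simp [permV_apply]

/-- The root-theoretic input of the classification, extracted from a root basis that is symmetric
under `G` and has the `Φ̂⁺`-basis property: the coroots `a s` of the simple roots, the collection
`IsPair` of all scaled pairs (root, coroot), and the orthogonality of distinct roots in one
`G`-orbit. The graph `Γ` records which simple roots are not orthogonal. -/
structure OrthogonalRoots (Γ : SimpleGraph S) (G : Subgroup (Equiv.Perm S)) where
  a : S → Module.Dual ℝ (S →₀ ℝ)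
  IsPair : (S →₀ ℝ) → Module.Dual ℝ (S →₀ ℝ) → Prop
  isPair_simple (s : S) : IsPair (Finsupp.single s 1) (a s)
  smul {x φ} (h : IsPair x φ) {c : ℝ} (hc : c ≠ 0) : IsPair (c • x) (c⁻¹ • φ)
  reflect {x φ y ψ} (hx : IsPair x φ) (hy : IsPair y ψ) : IsPair (x - ψ x • y) (φ - φ y • ψ)
  apply_self {x φ} (h : IsPair x φ) : φ x = 2
  unique {x φ ψ} (h : IsPair x φ) (h' : IsPair x ψ) : φ = ψ
  perm {x φ} (h : IsPair x φ) {g : Equiv.Perm S} (hg : g ∈ G) :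
    IsPair (permV g x) (φ.comp (permV g⁻¹ : (S →₀ ℝ) →ₗ[ℝ] (S →₀ ℝ)))
  orth {x φ} (h : IsPair x φ) {g : Equiv.Perm S} (hg : g ∈ G) :
    permV g x = x ∨ φ (permV g x) = 0
  a_perm {g : Equiv.Perm S} (hg : g ∈ G) (s : S) (x : S →₀ ℝ) : a (g s) (permV g x) = a s x
  a_nonpos {s t : S} (h : s ≠ t) : a s (Finsupp.single t 1) ≤ 0
  adj_iff {s t : S} : Γ.Adj s t ↔ s ≠ t ∧ a s (Finsupp.single t 1) ≠ 0
  one_le {s t : S} (h : Γ.Adj s t) :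
    1 ≤ a s (Finsupp.single t 1) * a t (Finsupp.single s 1)

namespace OrthogonalRoots

variable {Γ : SimpleGraph S} {G : Subgroup (Equiv.Perm S)} (D : OrthogonalRoots Γ G)

lemma a_neg {s t : S} (h : Γ.Adj s t) : D.a s (Finsupp.single t 1) < 0 :=
  lt_of_le_of_ne (D.a_nonpos h.ne) (D.adj_iff.1 h).2

lemma a_eq_zero {s t : S} (hst : s ≠ t) (h : ¬Γ.Adj s t) : D.a s (Finsupp.single t 1) = 0 := by
  by_contra h0
  exact h (D.adj_iff.2 ⟨hst, h0⟩)

lemma a_self (s : S) : D.a s (Finsupp.single s 1) = 2 := D.apply_self (D.isPair_simple s)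

include D in
lemma adj_perm {g : Equiv.Perm S} (hg : g ∈ G) (s t : S) : Γ.Adj (g s) (g t) ↔ Γ.Adj s t := by
  rw [D.adj_iff, D.adj_iff, ← permV_single g t, D.a_perm hg, g.injective.ne_iff]

lemma a_perm_single {g : Equiv.Perm S} (hg : g ∈ G) (s t : S) :
    D.a (g s) (Finsupp.single (g t) 1) = D.a s (Finsupp.single t 1) := by
  rw [← permV_single, D.a_perm hg]

/-- The coroot of a `g`-fixed root is `g`-invariant. -/
lemma apply_permV_of_fixed {x : S →₀ ℝ} {φ : Module.Dual ℝ (S →₀ ℝ)} (h : D.IsPair x φ)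
    {g : Equiv.Perm S} (hg : g ∈ G) (hx : permV g x = x) (y : S →₀ ℝ) :
    φ (permV g y) = φ y := by
  have h1 := D.perm h hg
  rw [hx] at h1
  have h2 := congrArg (fun f => f (permV g y)) (D.unique h h1)
  simp only [LinearMap.comp_apply, LinearEquiv.coe_coe] at h2
  rw [h2, ← permV_mul, inv_mul_cancel, permV_one]

/-- A `g`-fixed root `x` and a root `y` moved by `g` are orthogonal or generate a root system of
type `A₂`: the reflection of `x` in `y` and its image under `g` have to be orthogonal. -/
lemma mul_eq_zero_or_one {x y : S →₀ ℝ} {φ ψ : Module.Dual ℝ (S →₀ ℝ)} (hx : D.IsPair x φ)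
    (hy : D.IsPair y ψ) {g : Equiv.Perm S} (hg : g ∈ G) (hgx : permV g x = x)
    (hgy : permV g y ≠ y) : φ y * ψ x = 0 ∨ φ y * ψ x = 1 := by
  have hψ : ψ (permV g y) = 0 := (D.orth hy hg).resolve_left hgy
  have hφ := D.apply_permV_of_fixed hx hg hgx y
  have h2 := D.apply_self hx
  rcases D.orth (D.reflect hx hy) hg with h | h
  · left
    rw [map_sub, map_smul, hgx] at h
    have h3 : ψ x • (permV g y - y) = 0 := by
      rw [smul_sub, sub_eq_zero]
      exact sub_right_injective h
    rw [(smul_eq_zero.1 h3).resolve_right (sub_ne_zero.2 hgy), mul_zero]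
  · right
    rw [map_sub, map_smul, hgx] at h
    simp only [LinearMap.sub_apply, map_sub, map_smul, LinearMap.smul_apply, smul_eq_mul, hψ, hφ,
      h2] at h
    linarith

/-- The linear form `∑ d_s a_s`. -/
def form (d : S →₀ ℝ) : Module.Dual ℝ (S →₀ ℝ) := Finsupp.linearCombination ℝ D.a d

/-- `x` is a positive root with support `T`, and `∑ d_s a_s` is its coroot, also with support `T`.
The normalization `x_s d_s ≥ 1` replaces integrality of the coefficients. -/
structure IsRootOn (T : Finset S) (x d : S →₀ ℝ) : Prop where
  pair : D.IsPair x (D.form d)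
  x_pos : ∀ s ∈ T, 0 < x s
  x_zero : ∀ s ∉ T, x s = 0
  d_pos : ∀ s ∈ T, 0 < d s
  d_zero : ∀ s ∉ T, d s = 0
  one_le : ∀ s ∈ T, 1 ≤ x s * d s

lemma form_eq_sum {T : Finset S} {d : S →₀ ℝ} (h : ∀ s ∉ T, d s = 0) (y : S →₀ ℝ) :
    D.form d y = ∑ s ∈ T, d s * D.a s y := by
  have h1 : d.support ⊆ T := fun s hs => by
    by_contra hsT
    exact (Finsupp.mem_support_iff.1 hs) (h s hsT)
  rw [form, Finsupp.linearCombination_apply, Finsupp.sum_of_support_subset _ h1 _ (by simp),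
    LinearMap.sum_apply]
  simp

lemma apply_eq_sum {T : Finset S} {x : S →₀ ℝ} (h : ∀ s ∉ T, x s = 0)
    (φ : Module.Dual ℝ (S →₀ ℝ)) : φ x = ∑ s ∈ T, x s * φ (Finsupp.single s 1) := by
  have h1 : x.support ⊆ T := fun s hs => by
    by_contra hsT
    exact (Finsupp.mem_support_iff.1 hs) (h s hsT)
  conv_lhs => rw [← x.sum_single, Finsupp.sum_of_support_subset _ h1 _ (by simp), map_sum]
  refine Finset.sum_congr rfl fun s _ => ?_
  rw [← smul_eq_mul, ← map_smul, Finsupp.smul_single, smul_eq_mul, mul_one]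

namespace IsRootOn

variable {D} {T : Finset S} {x d : S →₀ ℝ}

lemma a_le_sum (h : D.IsRootOn T x d) {v : S} (hv : v ∉ T) {U : Finset S} (hU : U ⊆ T) :
    D.a v x ≤ ∑ t ∈ U, x t * D.a v (Finsupp.single t 1) := by
  rw [apply_eq_sum h.x_zero]
  refine Finset.sum_le_sum_of_subset_of_nonpos' hU fun t ht _ => ?_
  exact mul_nonpos_of_nonneg_of_nonpos (h.x_pos t ht).le
    (D.a_nonpos (ne_of_mem_of_not_mem ht hv).symm)

lemma form_le_sum (h : D.IsRootOn T x d) {v : S} (hv : v ∉ T) {U : Finset S} (hU : U ⊆ T) :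
    D.form d (Finsupp.single v 1) ≤ ∑ t ∈ U, d t * D.a t (Finsupp.single v 1) := by
  rw [form_eq_sum D h.d_zero]
  refine Finset.sum_le_sum_of_subset_of_nonpos' hU fun t ht _ => ?_
  exact mul_nonpos_of_nonneg_of_nonpos (h.d_pos t ht).le
    (D.a_nonpos (ne_of_mem_of_not_mem ht hv))

lemma a_nonpos (h : D.IsRootOn T x d) {v : S} (hv : v ∉ T) : D.a v x ≤ 0 := by
  simpa using h.a_le_sum hv (Finset.empty_subset T)

lemma form_nonpos (h : D.IsRootOn T x d) {v : S} (hv : v ∉ T) :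
    D.form d (Finsupp.single v 1) ≤ 0 := by
  simpa using h.form_le_sum hv (Finset.empty_subset T)

lemma a_le (h : D.IsRootOn T x d) {v u : S} (hv : v ∉ T) (hu : u ∈ T) :
    D.a v x ≤ x u * D.a v (Finsupp.single u 1) := by
  simpa using h.a_le_sum hv (Finset.singleton_subset_iff.2 hu)

lemma form_le (h : D.IsRootOn T x d) {v u : S} (hv : v ∉ T) (hu : u ∈ T) :
    D.form d (Finsupp.single v 1) ≤ d u * D.a u (Finsupp.single v 1) := by
  simpa using h.form_le_sum hv (Finset.singleton_subset_iff.2 hu)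

lemma le_mul_of_adj (h : D.IsRootOn T x d) {v u : S} (hv : v ∉ T) (hu : u ∈ T)
    (huv : Γ.Adj u v) :
    (x u * d u) * (D.a u (Finsupp.single v 1) * D.a v (Finsupp.single u 1)) ≤
      D.a v x * D.form d (Finsupp.single v 1) := by
  have h1 := h.a_le hv hu
  have h2 := h.form_le hv hu
  have h3 := D.a_neg huv
  have h4 := D.a_neg huv.symm
  have h5 := h.x_pos u hu
  have h6 := h.d_pos u hu
  have h7 : 0 ≤ -(x u * D.a v (Finsupp.single u 1)) := by
    have := mul_neg_of_pos_of_neg h5 h4; linarith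
  have h8 : 0 ≤ -(d u * D.a u (Finsupp.single v 1)) := by
    have := mul_neg_of_pos_of_neg h6 h3; linarith
  have := mul_le_mul (neg_le_neg h1) (neg_le_neg h2) h8 (h7.trans (neg_le_neg h1))
  linarith

lemma one_le_mul_of_adj (h : D.IsRootOn T x d) {v u : S} (hv : v ∉ T) (hu : u ∈ T)
    (huv : Γ.Adj u v) : x u * d u ≤ D.a v x * D.form d (Finsupp.single v 1) := by
  refine le_trans ?_ (h.le_mul_of_adj hv hu huv)
  exact le_mul_of_one_le_right (mul_pos (h.x_pos u hu) (h.d_pos u hu)).le (D.one_le huv)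

lemma four_le_mul_of_adj (h : D.IsRootOn T x d) {v u u' : S} (hv : v ∉ T) (hu : u ∈ T)
    (huv : Γ.Adj u v) (hu' : u' ∈ T) (huv' : Γ.Adj u' v) (hne : u ≠ u') :
    4 ≤ D.a v x * D.form d (Finsupp.single v 1) := by
  classical
  have hsub : ({u, u'} : Finset S) ⊆ T := by
    simp [Finset.insert_subset_iff, hu, hu']
  have h1 := h.a_le_sum hv hsub
  have h2 := h.form_le_sum hv hsub
  rw [Finset.sum_pair hne] at h1 h2
  -- the contributions `A`, `A'` of the two neighbours satisfy `A B ≥ 1` and `A' B' ≥ 1`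
  have key : ∀ w ∈ T, Γ.Adj w v → ∃ A B : ℝ, 0 < A ∧ 0 < B ∧ 1 ≤ A * B ∧
      x w * D.a v (Finsupp.single w 1) = -A ∧ d w * D.a w (Finsupp.single v 1) = -B := by
    intro w hw hwv
    have h3 := D.a_neg hwv
    have h4 := D.a_neg hwv.symm
    refine ⟨_, _, ?_, ?_, ?_, (neg_neg _).symm, (neg_neg _).symm⟩
    · have := mul_neg_of_pos_of_neg (h.x_pos w hw) h4; linarith
    · have := mul_neg_of_pos_of_neg (h.d_pos w hw) h3; linarith
    · have := one_le_mul_of_one_le_of_one_le (h.one_le w hw) (D.one_le hwv)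
      linarith
  obtain ⟨A, B, hA, hB, hAB, e1, e2⟩ := key u hu huv
  obtain ⟨A', B', hA', hB', hAB', e1', e2'⟩ := key u' hu' huv'
  rw [e1, e1'] at h1
  rw [e2, e2'] at h2
  have h9 := mul_le_mul (neg_le_neg h1) (neg_le_neg h2) (by linarith) (by linarith)
  have h10 : 2 ≤ A * B' + A' * B := by
    have hm : 1 ≤ (A * B') * (A' * B) := by
      have := one_le_mul_of_one_le_of_one_le hAB hAB'
      linarith
    have hp1 := mul_pos hA hB'
    have hp2 := mul_pos hA' hB
    nlinarith [sq_nonneg (A * B' - A' * B)]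
  nlinarith

variable [DecidableEq S]

/-- A root supported on `T` extends to a root supported on `T ∪ {v}`, for `v` adjacent to `T`. -/
lemma extend (h : D.IsRootOn T x d) {v u : S} (hv : v ∉ T) (hu : u ∈ T) (huv : Γ.Adj u v) :
    ∃ x' d', D.IsRootOn (insert v T) x' d' ∧ (∀ s, s ≠ v → x' s = x s ∧ d' s = d s) ∧
      x' v = -D.a v x ∧ d' v = -D.form d (Finsupp.single v 1) := by
  have hx : ∀ s, s ≠ v → (x - D.a v x • Finsupp.single v (1 : ℝ)) s = x s := fun s hs => by
    simp [hs]
  have hd : ∀ s, s ≠ v →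
      (d - D.form d (Finsupp.single v 1) • Finsupp.single v (1 : ℝ)) s = d s := fun s hs => by
    simp [hs]
  have hxv : (x - D.a v x • Finsupp.single v (1 : ℝ)) v = -D.a v x := by
    simp [h.x_zero v hv]
  have hdv : (d - D.form d (Finsupp.single v 1) • Finsupp.single v (1 : ℝ)) v =
      -D.form d (Finsupp.single v 1) := by
    simp [h.d_zero v hv]
  have hmul := h.one_le_mul_of_adj hv hu huv
  have hone := h.one_le u hu
  have h1 : D.a v x < 0 := by
    refine lt_of_le_of_ne (h.a_nonpos hv) fun e => ?_
    rw [e, zero_mul] at hmul; linarith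
  have h2 : D.form d (Finsupp.single v 1) < 0 := by
    refine lt_of_le_of_ne (h.form_nonpos hv) fun e => ?_
    rw [e, mul_zero] at hmul; linarith
  refine ⟨_, _, ⟨?_, ?_, ?_, ?_, ?_, ?_⟩, fun s hs => ⟨hx s hs, hd s hs⟩, hxv, hdv⟩
  · have := D.reflect h.pair (D.isPair_simple v)
    convert this using 1
    simp [form, -Finsupp.smul_single]
  · intro s hs
    rcases Finset.mem_insert.1 hs with rfl | hs
    · rw [hxv]; linarith
    · rw [hx s (ne_of_mem_of_not_mem hs hv)]; exact h.x_pos s hs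
  · intro s hs
    rw [Finset.mem_insert, not_or] at hs
    rw [hx s hs.1, h.x_zero s hs.2]
  · intro s hs
    rcases Finset.mem_insert.1 hs with rfl | hs
    · rw [hdv]; linarith
    · rw [hd s (ne_of_mem_of_not_mem hs hv)]; exact h.d_pos s hs
  · intro s hs
    rw [Finset.mem_insert, not_or] at hs
    rw [hd s hs.1, h.d_zero s hs.2]
  · intro s hs
    rcases Finset.mem_insert.1 hs with rfl | hs
    · rw [hxv, hdv]; linarith
    · have hne := ne_of_mem_of_not_mem hs hv
      rw [hx s hne, hd s hne]; exact h.one_le s hs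

lemma exists_of_finConn (D : OrthogonalRoots Γ G) {T : Finset S} (hT : Γ.FinConn T) {s : S}
    (hs : s ∈ T) : ∃ x d, D.IsRootOn T x d ∧ x s = 1 ∧ d s = 1 := by
  refine hT.induction hs (Q := fun U => ∃ x d, D.IsRootOn U x d ∧ x s = 1 ∧ d s = 1) ?_ ?_
  · refine ⟨Finsupp.single s 1, Finsupp.single s 1, ⟨?_, ?_, ?_, ?_, ?_, ?_⟩, by simp, by simp⟩
    · convert D.isPair_simple s
      simp [form]
    · simp
    · intro t ht; exact Finsupp.single_eq_of_ne (by simpa using ht)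
    · simp
    · intro t ht; exact Finsupp.single_eq_of_ne (by simpa using ht)
    · simp
  · rintro U - hsU ⟨x, d, h, hx, hd⟩ u hu v - hv huv
    obtain ⟨x', d', h', hs', -⟩ := h.extend hv hu huv
    obtain ⟨e1, e2⟩ := hs' s (ne_of_mem_of_not_mem hsU hv)
    exact ⟨x', d', h', by rw [e1, hx], by rw [e2, hd]⟩

omit [DecidableEq S] in
/-- A root with support `T` is moved by `g` if the set `T` is. -/
lemma permV_ne (h : D.IsRootOn T x d) {g : Equiv.Perm S} {t : S} (ht : t ∈ T) (hgt : g t ∉ T) :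
    permV g x ≠ x := by
  intro e
  have h1 := permV_apply_apply g x t
  rw [e, h.x_zero _ hgt] at h1
  exact (h.x_pos t ht).ne h1

end IsRootOn

variable {D} {T : Finset S} {x d : S →₀ ℝ} {g : Equiv.Perm S}

/-- A root `x` on `T` that is moved by `g` and a `g`-fixed vertex `w ∉ T` have at most a simple
edge in common. -/
lemma IsRootOn.mul_le_one (h : D.IsRootOn T x d) (hg : g ∈ G) (hx : permV g x ≠ x) {w : S}
    (hgw : g w = w) : D.a w x * D.form d (Finsupp.single w 1) ≤ 1 := by
  have := D.mul_eq_zero_or_one (D.isPair_simple w) h.pair hg (by rw [permV_single, hgw]) hx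
  rcases this with h | h <;> rw [h]
  exact zero_le_one

lemma eq_of_adj_of_adj [DecidableEq S] (D : OrthogonalRoots Γ G) (hT : Γ.FinConn T) (hg : g ∈ G)
    {t : S} (ht : t ∈ T) (hgt : g t ∉ T) {w u u' : S} (hgw : g w = w) (hw : w ∉ T) (hu : u ∈ T)
    (hu' : u' ∈ T) (huw : Γ.Adj u w) (huw' : Γ.Adj u' w) : u = u' := by
  obtain ⟨x, d, h, -, -⟩ := IsRootOn.exists_of_finConn D hT ht
  by_contra hne
  have h1 := h.mul_le_one hg (h.permV_ne ht hgt) hgw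
  have h2 := h.four_le_mul_of_adj hw hu huw hu' huw' hne
  linarith

lemma mul_eq_one_of_fixed [DecidableEq S] (D : OrthogonalRoots Γ G) (hT : Γ.FinConn T)
    (hg : g ∈ G) {t : S} (ht : t ∈ T) (hgt : g t ∉ T) {w u : S} (hgw : g w = w) (hw : w ∉ T)
    (hu : u ∈ T) (huw : Γ.Adj u w) :
    D.a u (Finsupp.single w 1) * D.a w (Finsupp.single u 1) = 1 := by
  obtain ⟨x, d, h, -, -⟩ := IsRootOn.exists_of_finConn D hT ht
  have h1 := h.mul_le_one hg (h.permV_ne ht hgt) hgw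
  have h2 := h.le_mul_of_adj hw hu huw
  have h3 := h.one_le u hu
  have h4 := D.one_le huw
  nlinarith

/-- There are no edges between a connected set `T` and its image under `g`, if they are disjoint. -/
lemma not_adj_perm [DecidableEq S] (D : OrthogonalRoots Γ G) (hT : Γ.FinConn T) (hg : g ∈ G)
    (hdisj : ∀ t ∈ T, g t ∉ T) {u v : S} (hu : u ∈ T) (hv : v ∈ T) : ¬Γ.Adj u (g v) := by
  intro huv
  obtain ⟨x, d, h, -, -⟩ := IsRootOn.exists_of_finConn D hT hu
  have h0 := (D.orth h.pair hg).resolve_left (h.permV_ne hu (hdisj u hu))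
  have hterm : ∀ t ∈ T, D.a t (permV g x) = ∑ s ∈ T, x s * D.a t (Finsupp.single (g s) 1) := by
    intro t _
    have := apply_eq_sum h.x_zero ((D.a t).comp (permV g : (S →₀ ℝ) →ₗ[ℝ] (S →₀ ℝ)))
    simpa using this
  have hsign : ∀ t ∈ T, ∀ s ∈ T, x s * D.a t (Finsupp.single (g s) 1) ≤ 0 := fun t ht s hs =>
    mul_nonpos_of_nonneg_of_nonpos (h.x_pos s hs).le
      (D.a_nonpos (ne_of_mem_of_not_mem ht (hdisj s hs)))
  have hle : ∀ t ∈ T, D.a t (permV g x) ≤ 0 := fun t ht => by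
    rw [hterm t ht]; exact Finset.sum_nonpos (hsign t ht)
  have hlt : D.a u (permV g x) < 0 := by
    rw [hterm u hu]
    refine lt_of_le_of_lt (Finset.sum_le_sum_of_subset_of_nonpos'
      (Finset.singleton_subset_iff.2 hv) fun s hs _ => hsign u hu s hs) ?_
    rw [Finset.sum_singleton]
    exact mul_neg_of_pos_of_neg (h.x_pos v hv) (D.a_neg huv)
  rw [form_eq_sum D h.d_zero] at h0
  have : ∑ t ∈ T, d t * D.a t (permV g x) < 0 := by
    refine lt_of_le_of_lt (Finset.sum_le_sum_of_subset_of_nonpos'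
      (Finset.singleton_subset_iff.2 hu) fun t ht _ =>
        mul_nonpos_of_nonneg_of_nonpos (h.d_pos t ht).le (hle t ht)) ?_
    rw [Finset.sum_singleton]
    exact mul_neg_of_pos_of_neg (h.d_pos u hu) hlt
  linarith

/-- Vertices in the same orbit are not adjacent. -/
lemma not_adj_orbit (D : OrthogonalRoots Γ G) (hg : g ∈ G) (s : S) : ¬Γ.Adj s (g s) := by
  classical
  intro h
  exact D.not_adj_perm (SimpleGraph.FinConn.singleton s) hg
    (by simpa using h.ne') (Finset.mem_singleton_self s) (Finset.mem_singleton_self s) h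

end OrthogonalRoots
end

/-! ### Fixed vertices and simplicity of the edges -/

noncomputable section

variable {S : Type*}

namespace SimpleGraph.Walk

variable {Γ : SimpleGraph S}

lemma exists_between {a b x y : S} (q : Γ.Walk a b) (hx : x ∈ q.support) (hy : y ∈ q.support) :
    ∃ r : Γ.Walk x y, r.length ≤ q.length ∧ ∀ z ∈ r.support, z ∈ q.support := by
  classical
  have h1 : ∀ {a b y : S} (q : Γ.Walk a b), y ∈ q.support →
      ∃ r : Γ.Walk a y, r.length ≤ q.length ∧ ∀ z ∈ r.support, z ∈ q.support := fun q hy =>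
    ⟨q.takeUntil _ hy, q.length_takeUntil_le_length hy, fun z hz => q.support_takeUntil_subset_support hy hz⟩
  induction q with
  | nil =>
    rw [support_nil, List.mem_singleton] at hx hy
    subst hx; subst hy
    exact ⟨nil, le_rfl, by simp⟩
  | @cons u v w h q ih =>
    by_cases hxu : x = u
    · subst hxu
      exact h1 _ hy
    by_cases hyu : y = u
    · subst hyu
      obtain ⟨r, hr1, hr2⟩ := h1 _ hx
      exact ⟨r.reverse, by simpa using hr1, by simpa using hr2⟩
    obtain ⟨r, hr1, hr2⟩ := ih (by simpa [hxu] using hx) (by simpa [hyu] using hy)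
    exact ⟨r, by simp; omega, fun z hz => by simp [hr2 z hz]⟩

lemma exists_strip {x y : S} (r : Γ.Walk x y) (hxy : x ≠ y) :
    ∃ u, ∃ q : Γ.Walk x u, Γ.Adj u y ∧ q.length < r.length ∧ ∀ z ∈ q.support, z ∈ r.support := by
  induction r with
  | nil => exact absurd rfl hxy
  | @cons u v w h r ih =>
    by_cases hvw : v = w
    · subst hvw
      exact ⟨u, nil, h, by simp, by simp⟩
    · obtain ⟨z, q, hz, hlen, hsub⟩ := ih hvw
      refine ⟨z, cons h q, hz, by simpa using hlen, fun z hz => ?_⟩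
      rw [support_cons, List.mem_cons] at hz ⊢
      exact hz.imp id (hsub z)

end SimpleGraph.Walk

namespace OrthogonalRoots

variable {Γ : SimpleGraph S} {G : Subgroup (Equiv.Perm S)} {D : OrthogonalRoots Γ G}
  {T : Finset S} {x d : S →₀ ℝ} {g : Equiv.Perm S}

/-- No vertex `v` is connected with `g v` through vertices that are moved by `g`: on a shortest
such connection, the vertices before `g v` and their images under `g` would be disjoint, but joined
by an edge. -/
lemma perm_notMem_of_moved (D : OrthogonalRoots Γ G) (hT : Γ.FinConn T) (hg : g ∈ G)
    (hmov : ∀ t ∈ T, g t ≠ t) {t : S} (ht : t ∈ T) : g t ∉ T := by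
  classical
  have key : ∀ n, ∀ (v u : S) (q : Γ.Walk v u), q.length = n → (∀ z ∈ q.support, g z ≠ z) →
      ¬Γ.Adj u (g v) := by
    intro n
    induction n using Nat.strong_induction_on with
    | _ n ih =>
      intro v u q hq hmov huv
      by_cases hex : ∃ z ∈ q.support, g z ∈ q.support
      · obtain ⟨z, hz, hgz⟩ := hex
        obtain ⟨r, hr1, hr2⟩ := q.exists_between hz hgz
        obtain ⟨u', q', hu', hlen, hsub⟩ := r.exists_strip (hmov z hz).symm
        exact ih _ (by omega) z u' q' rfl (fun y hy => hmov y (hr2 y (hsub y hy))) hu'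
      · push Not at hex
        exact D.not_adj_perm (SimpleGraph.FinConn.of_walk q) hg
          (fun t ht => by simpa using hex t (by simpa using ht))
          (by simp) (by simp) huv
  intro hgt
  obtain ⟨r, hr⟩ := hT.exists_walk ht hgt
  obtain ⟨u, q, hu, -, hsub⟩ := r.exists_strip (hmov t ht).symm
  exact key _ t u q rfl (fun z hz => hmov z (hr z (hsub z hz))) hu

/-- A nontrivial symmetry has a fixed vertex with a neighbour that is moved. -/
lemma exists_branch (D : OrthogonalRoots Γ G) (hΓ : Γ.Connected) (hg : g ∈ G) (hg1 : g ≠ 1) :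
    ∃ c t, g c = c ∧ Γ.Adj c t ∧ g t ≠ t := by
  classical
  obtain ⟨v, hv⟩ : ∃ v, g v ≠ v := by
    by_contra! h
    exact hg1 (Equiv.ext h)
  by_cases hfix : ∃ c, g c = c
  · obtain ⟨c, hc⟩ := hfix
    obtain ⟨p⟩ := hΓ.preconnected v c
    obtain ⟨T, -, -, hTA, u, hu, m, hm, -, hum⟩ :=
      p.exists_finConn_adj (A := {c | g c = c}) hv hc
    exact ⟨m, u, hm, hum.symm, (hTA u hu).1⟩
  · push Not at hfix
    obtain ⟨p⟩ := hΓ.preconnected v (g v)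
    exact absurd (by simp) (D.perm_notMem_of_moved (SimpleGraph.FinConn.of_walk p) hg
      (fun t _ => hfix t) (t := v) (by simp))

lemma apply_permV_eq_zero {y : S →₀ ℝ} {ψ : Module.Dual ℝ (S →₀ ℝ)} (hy : D.IsPair y ψ)
    {h : Equiv.Perm S} (hh : h ∈ G) (hne : permV h y ≠ y) : ψ (permV h y) = 0 :=
  (D.orth hy hh).resolve_left hne

lemma permV_inv_permV (h : Equiv.Perm S) (y : S →₀ ℝ) : permV h⁻¹ (permV h y) = y := by
  rw [← permV_mul, inv_mul_cancel, permV_one]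

lemma permV_inv_ne {h : Equiv.Perm S} {y : S →₀ ℝ} (hne : permV h y ≠ y) : permV h⁻¹ y ≠ y := by
  intro e
  apply hne
  conv_lhs => rw [← e, ← permV_mul, mul_inv_cancel, permV_one]

/-- Let `c` be a fixed simple root and `y` a moved root that is not orthogonal to `c`. Then the
orbit of `y` under `g` has two or three elements, and adding (a multiple of) their sum to `c` gives
a `g`-fixed root. -/
lemma exists_fixed_root (hg : g ∈ G) {c : S} (hc : g c = c) {y : S →₀ ℝ}
    {ψ : Module.Dual ℝ (S →₀ ℝ)} (hy : D.IsPair y ψ) (hgy : permV g y ≠ y)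
    (h0 : D.a c y * ψ (Finsupp.single c 1) ≠ 0) :
    D.a c y * ψ (Finsupp.single c 1) = 1 ∧ ∃ k : ℕ, (k = 2 ∨ k = 3) ∧ permV (g ^ k) y = y ∧
      ∃ x φ, D.IsPair x φ ∧ permV g x = x ∧
        (∀ w, D.a w x = D.a w (Finsupp.single c 1) -
          ψ (Finsupp.single c 1) * ∑ i ∈ Finset.range k, D.a w (permV (g ^ i) y)) ∧
        (∀ w, φ (Finsupp.single w 1) = D.a c (Finsupp.single w 1) -
          D.a c y * ∑ i ∈ Finset.range k, ψ (permV (g ^ i)⁻¹ (Finsupp.single w 1))) := by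
  set e : S →₀ ℝ := Finsupp.single c 1 with he
  have hge : permV g e = e := by rw [he, permV_single, hc]
  have hgie : permV g⁻¹ e = e := by
    conv_lhs => rw [← hge]
    rw [permV_inv_permV]
  have hpair := D.isPair_simple c
  have hpq : D.a c y * ψ e = 1 :=
    (D.mul_eq_zero_or_one hpair hy hg hge hgy).resolve_left h0
  refine ⟨hpq, ?_⟩
  have hac : ∀ z, D.a c (permV g z) = D.a c z := D.apply_permV_of_fixed hpair hg hge
  have hg2 : permV (g ^ 2) y = permV g (permV g y) := by rw [pow_two, permV_mul]
  have hg3 : permV (g ^ 3) y = permV g (permV g (permV g y)) := by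
    rw [pow_succ', pow_two, permV_mul, permV_mul]
  have hψ1 : D.IsPair (permV g y) (ψ.comp (permV g⁻¹ : (S →₀ ℝ) →ₗ[ℝ] (S →₀ ℝ))) := D.perm hy hg
  set ψ₁ := ψ.comp (permV g⁻¹ : (S →₀ ℝ) →ₗ[ℝ] (S →₀ ℝ)) with hψ₁
  have hψ₁a : ∀ z, ψ₁ z = ψ (permV g⁻¹ z) := fun z => rfl
  have z1 : ψ (permV g y) = 0 := apply_permV_eq_zero hy hg hgy
  have z2 : ψ (permV g⁻¹ y) = 0 := apply_permV_eq_zero hy (G.inv_mem hg) (permV_inv_ne hgy)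
  have hψe : ψ₁ e = ψ e := by rw [hψ₁a, hgie]
  have y2 := D.apply_self hy
  have c2 : D.a c e = 2 := D.a_self c
  have hx2 := D.reflect (D.reflect hpair hy) hψ1
  have s1 : ψ₁ (e - ψ e • y) = ψ e := by
    rw [map_sub, map_smul, hψe, hψ₁a, z2, smul_zero, sub_zero]
  have s2 : (D.a c - D.a c y • ψ) (permV g y) = D.a c y := by
    rw [LinearMap.sub_apply, LinearMap.smul_apply, z1, smul_zero, sub_zero, hac]
  rw [← he, s1, s2] at hx2
  set x₂ := e - ψ e • y - ψ e • permV g y with hx₂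
  set φ₂ := D.a c - D.a c y • ψ - D.a c y • ψ₁ with hφ₂
  have hinv0 : ∀ w : S, permV (g ^ 0)⁻¹ (Finsupp.single w (1 : ℝ)) = Finsupp.single w 1 := by
    intro w; rw [pow_zero, inv_one, permV_one]
  by_cases hk2 : permV g (permV g y) = y
  · refine ⟨2, Or.inl rfl, by rw [hg2, hk2], x₂, φ₂, hx2, ?_, ?_, ?_⟩
    · rw [hx₂, map_sub, map_sub, map_smul, map_smul, hge, hk2]
      abel
    · intro w
      simp only [hx₂, Finset.sum_range_succ, Finset.sum_range_zero, pow_zero, pow_one, permV_one,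
        map_sub, map_smul, smul_eq_mul]
      ring
    · intro w
      simp only [hφ₂, Finset.sum_range_succ, Finset.sum_range_zero, pow_one, hinv0,
        LinearMap.sub_apply, LinearMap.smul_apply, smul_eq_mul, hψ₁a]
      ring
  · have hg2mem := G.pow_mem hg 2
    have z3 : ψ (permV g (permV g y)) = 0 := by
      rw [← hg2]
      exact apply_permV_eq_zero hy hg2mem (by rwa [hg2])
    have hk3 : permV g (permV g (permV g y)) = y := by
      by_contra hk3
      -- four distinct roots in the orbit: the image of `x₂` under `g²` is not orthogonal to `x₂`
      have z4 : ψ (permV g (permV g (permV g y))) = 0 := by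
        rw [← hg3]
        exact apply_permV_eq_zero hy (G.pow_mem hg 3) (by rwa [hg3])
      have hgx : permV (g ^ 2) x₂ =
          e - ψ e • permV g (permV g y) - ψ e • permV g (permV g (permV g y)) := by
        rw [hx₂, pow_two, permV_mul]
        simp only [map_sub, map_smul, hge]
      have hval : φ₂ (permV (g ^ 2) x₂) = -2 := by
        rw [hgx, hφ₂]
        simp only [LinearMap.sub_apply, LinearMap.smul_apply, map_sub, map_smul, hac, z3, z4, hψ₁a,
          permV_inv_permV, smul_eq_mul, c2, hgie, z1]
        linear_combination (-4) * hpq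
      rcases D.orth hx2 hg2mem with h | h
      · have := D.apply_self hx2
        rw [← h, hval] at this
        norm_num at this
      · rw [hval] at h
        norm_num at h
    have hψ2 := D.perm hψ1 hg
    set ψ₂ := ψ₁.comp (permV g⁻¹ : (S →₀ ℝ) →ₗ[ℝ] (S →₀ ℝ)) with hψ₂
    have hψ₂a : ∀ z, ψ₂ z = ψ (permV g⁻¹ (permV g⁻¹ z)) := fun z => rfl
    have hi : permV g⁻¹ y = permV g (permV g y) := by
      conv_lhs => rw [← hk3]
      rw [permV_inv_permV]
    have hx3 := D.reflect hx2 hψ2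
    have t1 : ψ₂ x₂ = ψ e := by
      rw [hx₂]
      simp only [map_sub, map_smul, hψ₂a, hgie, hi, permV_inv_permV, z1, z3, smul_zero, sub_zero]
    have t2 : φ₂ (permV g (permV g y)) = D.a c y := by
      rw [hφ₂]
      simp only [LinearMap.sub_apply, LinearMap.smul_apply, hac, z3, hψ₁a, permV_inv_permV, z1,
        smul_zero, sub_zero]
    rw [t1, t2] at hx3
    refine ⟨3, Or.inr rfl, by rw [hg3, hk3], _, _, hx3, ?_, ?_, ?_⟩
    · rw [hx₂]
      simp only [map_sub, map_smul, hge, hk3]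
      abel
    · intro w
      simp only [hx₂, Finset.sum_range_succ, Finset.sum_range_zero, pow_zero, pow_one, permV_one,
        map_sub, map_smul, smul_eq_mul, hg2]
      ring
    · intro w
      have hinv2 : permV (g ^ 2)⁻¹ (Finsupp.single w (1 : ℝ)) =
          permV g⁻¹ (permV g⁻¹ (Finsupp.single w 1)) := by
        rw [pow_two, mul_inv_rev, permV_mul]
      simp only [hφ₂, Finset.sum_range_succ, Finset.sum_range_zero, pow_one, hinv0, hinv2,
        LinearMap.sub_apply, LinearMap.smul_apply, smul_eq_mul, hψ₁a, hψ₂a]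
      ring

lemma mul_eq_one_of_moved (D : OrthogonalRoots Γ G) (hT : Γ.FinConn T) (hg : g ∈ G)
    (hmov : ∀ t ∈ T, g t ≠ t) {c u s w : S} (hc : g c = c) (hu : u ∈ T) (huc : Γ.Adj u c)
    (hs : s ∈ T) (hw : w ∉ T) (hgw : g w ≠ w) (hsw : Γ.Adj s w) :
    D.a s (Finsupp.single w 1) * D.a w (Finsupp.single s 1) = 1 := by
  classical
  have hdisj : ∀ t ∈ T, g t ∉ T := fun t ht => D.perm_notMem_of_moved hT hg hmov ht
  have hcT : c ∉ T := fun h => hmov c h hc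
  obtain ⟨y, d, h, -, -⟩ := IsRootOn.exists_of_finConn D hT hs
  have hcy := h.one_le_mul_of_adj hcT hu huc
  have hcu := h.one_le u hu
  obtain ⟨hpq, k, hk, hky, x, φ, hpair, hgx, hax, hφ⟩ := exists_fixed_root hg hc h.pair
    (h.permV_ne hs (hdisj s hs)) (by intro e; rw [e] at hcy; linarith)
  have hp := h.a_nonpos hcT
  have hq := h.form_nonpos hcT
  have hnot : ∀ i < k, (g ^ i)⁻¹ w ∉ T := by
    intro i hi hv
    set v := (g ^ i)⁻¹ w with hvdef
    have hwv : w = (g ^ i) v := by simp [hvdef]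
    have hi3 : i = 0 ∨ i = 1 ∨ (i = 2 ∧ k = 3) := by omega
    rcases hi3 with rfl | rfl | ⟨rfl, rfl⟩
    · simp only [pow_zero, Equiv.Perm.one_apply] at hwv
      exact hw (hwv ▸ hv)
    · rw [pow_one] at hwv
      exact D.not_adj_perm hT hg hdisj hs hv (hwv ▸ hsw)
    · have hg3v : g w ∈ T := by
        by_contra hnot
        have h1 := permV_apply_apply (g ^ 3) y v
        rw [hky, pow_succ', Equiv.Perm.mul_apply, ← hwv, h.x_zero _ hnot] at h1
        exact (h.x_pos v hv).ne h1
      exact D.not_adj_perm hT hg hdisj hg3v hs ((D.adj_perm hg s w).2 hsw).symm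
  have hk0 : 0 < k := by omega
  have hsum1 : ∑ i ∈ Finset.range k, D.form d (permV (g ^ i)⁻¹ (Finsupp.single w 1)) ≤
      D.form d (Finsupp.single w 1) := by
    have := Finset.sum_le_sum_of_subset_of_nonpos' (f := fun i =>
        D.form d (permV (g ^ i)⁻¹ (Finsupp.single w 1)))
      (Finset.singleton_subset_iff.2 (Finset.mem_range.2 hk0)) (fun i hi _ => by
        rw [permV_single]
        exact h.form_nonpos (hnot i (Finset.mem_range.1 hi)))
    simpa only [Finset.sum_singleton, pow_zero, inv_one, permV_one] using this
  have hsum2 : ∑ i ∈ Finset.range k, D.a w (permV (g ^ i) y) ≤ D.a w y := by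
    have := Finset.sum_le_sum_of_subset_of_nonpos' (f := fun i => D.a w (permV (g ^ i) y))
      (Finset.singleton_subset_iff.2 (Finset.mem_range.2 hk0)) (fun i hi _ => by
        have h1 := D.a_perm (G.pow_mem hg i) ((g ^ i)⁻¹ w) y
        rw [show (g ^ i) ((g ^ i)⁻¹ w) = w by simp] at h1
        rw [h1]
        exact h.a_nonpos (hnot i (Finset.mem_range.1 hi)))
    simpa only [Finset.sum_singleton, pow_zero, permV_one] using this
  have hcw : c ≠ w := by rintro rfl; exact hgw hc
  have hacw := D.a_nonpos hcw
  have hawc := D.a_nonpos hcw.symm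
  have hle := h.le_mul_of_adj hw hs hsw
  have hone := h.one_le s hs
  have hedge := D.one_le hsw
  have hyw := h.a_nonpos hw
  have hdw := h.form_nonpos hw
  have hL1 : φ (Finsupp.single w 1) * D.a w x ≤ 1 := by
    rcases D.mul_eq_zero_or_one hpair (D.isPair_simple w) hg hgx (by
      rw [permV_single]
      exact fun e => hgw (Finsupp.single_left_injective one_ne_zero e)) with e | e <;> rw [e]
    exact zero_le_one
  rw [hax, hφ] at hL1
  set P := D.a c y
  set Q := D.form d (Finsupp.single c 1)
  set A := D.a w y
  set B := D.form d (Finsupp.single w 1)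
  have e1 : D.a c (Finsupp.single w 1) - P * ∑ i ∈ Finset.range k,
      D.form d (permV (g ^ i)⁻¹ (Finsupp.single w 1)) ≤ -P * B := by
    have := mul_le_mul_of_nonneg_left hsum1 (neg_nonneg.2 hp)
    linarith
  have e2 : D.a w (Finsupp.single c 1) - Q * ∑ i ∈ Finset.range k, D.a w (permV (g ^ i) y) ≤
      -Q * A := by
    have := mul_le_mul_of_nonneg_left hsum2 (neg_nonneg.2 hq)
    linarith
  have f1 : 0 ≤ P * B := mul_nonneg_of_nonpos_of_nonpos hp hdw
  have f2 : 0 ≤ Q * A := mul_nonneg_of_nonpos_of_nonpos hq hyw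
  have hprod := mul_le_mul (neg_le_neg e1) (neg_le_neg e2) (by linarith) (by linarith)
  have h3 : (P * B) * (Q * A) = A * B := by linear_combination (A * B) * hpq
  nlinarith

/-- All edges of the Coxeter graph are simple. -/
lemma mul_eq_one (D : OrthogonalRoots Γ G) (hΓ : Γ.Connected) (hg : g ∈ G) (hg1 : g ≠ 1) {s w : S}
    (hsw : Γ.Adj s w) : D.a s (Finsupp.single w 1) * D.a w (Finsupp.single s 1) = 1 := by
  classical
  obtain ⟨c, m, hc, -, hm⟩ := D.exists_branch hΓ hg hg1
  -- a connected set joining one end of the edge to the set `A`, but avoiding the other end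
  have key : ∀ (A : Set S) (n : ℕ) (s w m : S) (p : Γ.Walk s m), m ∈ A → p.length = n → s ≠ w →
      ∃ T, Γ.FinConn T ∧ (∃ m' ∈ T, m' ∈ A ∧ ∀ z ∈ T, z ∈ A → z = m') ∧
        ((s ∈ T ∧ w ∉ T) ∨ (w ∈ T ∧ s ∉ T)) := by
    intro A n
    induction n using Nat.strong_induction_on with
    | _ n ih =>
      intro s w m p hm hn hne
      by_cases hw : w ∈ p.support
      · have hlt : (p.dropUntil w hw).length < n := by
          have h1 := congrArg SimpleGraph.Walk.length (p.take_spec hw)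
          rw [SimpleGraph.Walk.length_append] at h1
          have h2 : 0 < (p.takeUntil w hw).length := by
            rw [Nat.pos_iff_ne_zero]
            exact fun h0 => hne (SimpleGraph.Walk.eq_of_length_eq_zero h0)
          omega
        obtain ⟨T, hT, hA, hor⟩ := ih _ hlt w s m (p.dropUntil w hw) hm rfl hne.symm
        exact ⟨T, hT, hA, hor.symm⟩
      · obtain ⟨m', hm', q, hq1, hq2⟩ := p.exists_first hm
        refine ⟨_, SimpleGraph.FinConn.of_walk q, ⟨m', by simp, hm', ?_⟩, Or.inl ⟨by simp, ?_⟩⟩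
        · intro z hz hzA
          exact hq2 z (by simpa using hz) hzA
        · intro h
          exact hw (hq1 w (by simpa using h))
  -- edges with a fixed end
  have hfix : ∀ {s w : S}, Γ.Adj s w → g w = w →
      D.a s (Finsupp.single w 1) * D.a w (Finsupp.single s 1) = 1 := by
    intro s w hsw hw
    by_cases hs : g s = s
    · obtain ⟨p⟩ := hΓ.preconnected s m
      obtain ⟨T, hT, ⟨m', hm'T, hm', hun⟩, hor⟩ :=
        key {z | g z ≠ z} _ s w m p hm rfl hsw.ne
      have hgm : g m' ∉ T := fun h => hm' (hun _ h fun e => hm' (g.injective e))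
      rcases hor with ⟨h1, h2⟩ | ⟨h1, h2⟩
      · exact D.mul_eq_one_of_fixed hT hg hm'T hgm hw h2 h1 hsw
      · rw [mul_comm]
        exact D.mul_eq_one_of_fixed hT hg hm'T hgm hs h2 h1 hsw.symm
    · exact D.mul_eq_one_of_fixed (SimpleGraph.FinConn.singleton s) hg
        (Finset.mem_singleton_self s) (by simpa using hs) hw
        (by rw [Finset.mem_singleton]; exact hsw.ne') (Finset.mem_singleton_self s) hsw
  by_cases hw : g w = w
  · exact hfix hsw hw
  by_cases hs : g s = s
  · rw [mul_comm]; exact hfix hsw.symm hs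
  -- both ends are moved
  have hmm : ∀ {s w m' : S} {T : Finset S}, Γ.Adj s w → g s ≠ s → g w ≠ w → Γ.FinConn T →
      m' ∈ T → g m' = m' → s ∈ T → w ∉ T →
      D.a s (Finsupp.single w 1) * D.a w (Finsupp.single s 1) = 1 := by
    intro s w m' T hsw hs hw hT hm'T hm' hsT hwT
    obtain ⟨p, hp⟩ := hT.exists_walk hsT hm'T
    obtain ⟨T', hT', hsT', hTA, u, hu, m, hm, -, hum⟩ :=
      p.exists_finConn_adj (A := {z | g z = z}) hs hm'
    exact D.mul_eq_one_of_moved hT' hg (fun t ht => (hTA t ht).1) hm hu hum hsT'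
      (fun h => hwT (hp w (hTA w h).2)) hw hsw
  obtain ⟨p⟩ := hΓ.preconnected s c
  obtain ⟨T, hT, ⟨m', hm'T, hm', -⟩, hor⟩ := key {z | g z = z} _ s w c p hc rfl hsw.ne
  rcases hor with ⟨h1, h2⟩ | ⟨h1, h2⟩
  · exact hmm hsw hs hw hT hm'T hm' h1 h2
  · rw [mul_comm]
    exact hmm hsw.symm hw hs hT hm'T hm' h1 h2

end OrthogonalRoots
end

/-! ### Cycles in a graph -/

noncomputable section

variable {S : Type*}

namespace SimpleGraph

variable {Γ : SimpleGraph S} [DecidableEq S]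

/-- The vertex set of a cycle: removing any vertex leaves a connected set that contains two
neighbours of that vertex. -/
lemma exists_cycle_finset (h : ¬Γ.IsAcyclic) : ∃ C : Finset S, C.Nonempty ∧ ∀ v ∈ C,
    Γ.FinConn (C.erase v) ∧ ∃ a ∈ C.erase v, ∃ b ∈ C.erase v, a ≠ b ∧ Γ.Adj a v ∧ Γ.Adj b v := by
  simp only [IsAcyclic, not_forall, not_not] at h
  obtain ⟨z, c, hc⟩ := h
  refine ⟨c.support.toFinset, ⟨z, by simp⟩, fun v hv => ?_⟩
  have hv' : v ∈ c.support := by simpa using hv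
  have hrot := hc.rotate hv'
  have hsupp : ∀ x, x ∈ c.support ↔ x ∈ (c.rotate v hv').support := fun x => by
    rw [Walk.mem_support_rotate_iff]
  generalize c.rotate v hv' = c' at hrot hsupp
  cases c' with
  | nil => exact absurd hrot.not_nil (by simp)
  | @cons _ x _ hvx p =>
    rw [Walk.cons_isCycle_iff] at hrot
    obtain ⟨hp, he⟩ := hrot
    have hp' := hp.reverse
    have hsr : ∀ y, y ∈ p.support ↔ y ∈ p.reverse.support := fun y => by simp
    have her : s(v, x) ∉ p.reverse.edges := by simpa using he
    generalize p.reverse = r at hp' hsr her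
    cases r with
    | nil => exact absurd rfl hvx.ne
    | @cons _ b _ hvb q =>
      rw [Walk.cons_isPath_iff] at hp'
      have herase : c.support.toFinset.erase v = q.support.toFinset := by
        ext y
        have h1 := hsupp y
        have h2 := hsr y
        simp only [Walk.support_cons, List.mem_cons] at h1 h2
        simp only [Finset.mem_erase, List.mem_toFinset, h1, h2]
        constructor
        · rintro ⟨hy, hy' | hy' | hy'⟩
          · exact absurd hy' hy
          · exact absurd hy' hy
          · exact hy'
        · exact fun hy => ⟨fun e => hp'.2 (e ▸ hy), Or.inr (Or.inr hy)⟩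
      rw [herase]
      refine ⟨FinConn.of_walk q, x, by simp, b, by simp, ?_, hvx.symm, hvb.symm⟩
      rintro rfl
      exact her (by simp)

lemma finConn_image_range {u : ℕ → S} {n : ℕ} (h : ∀ i < n, Γ.Adj (u i) (u (i + 1))) :
    Γ.FinConn ((Finset.range (n + 1)).image u) := by
  induction n with
  | zero => simpa using FinConn.singleton (u 0)
  | succ n ih =>
    rw [Finset.range_add_one, Finset.image_insert]
    exact (ih fun i hi => h i (by omega)).insert
      (Finset.mem_image_of_mem u (Finset.mem_range.2 (Nat.lt_succ_self n))) (h n (by omega))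

end SimpleGraph

namespace OrthogonalRoots

variable {Γ : SimpleGraph S} {G : Subgroup (Equiv.Perm S)} {D : OrthogonalRoots Γ G}
  {T : Finset S} {x d : S →₀ ℝ} {g : Equiv.Perm S} [DecidableEq S]

/-- A connected set that contains two neighbours of a fixed vertex outside of it is `g`-stable. -/
lemma perm_mem_iff_of_adj (D : OrthogonalRoots Γ G) (hT : Γ.FinConn T) (hg : g ∈ G) {w a b : S}
    (hgw : g w = w) (hw : w ∉ T) (ha : a ∈ T) (hb : b ∈ T) (hab : a ≠ b) (haw : Γ.Adj a w)
    (hbw : Γ.Adj b w) (v : S) : g v ∈ T ↔ v ∈ T := by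
  obtain ⟨x, d, h, -, -⟩ := IsRootOn.exists_of_finConn D hT ha
  have hfix : permV g x = x := by
    by_contra hne
    have h1 := h.mul_le_one hg hne hgw
    have h2 := h.four_le_mul_of_adj hw ha haw hb hbw hab
    linarith
  have hv := permV_apply_apply g x v
  rw [hfix] at hv
  constructor
  · intro h1
    by_contra h2
    rw [h.x_zero v h2] at hv
    exact (h.x_pos _ h1).ne' hv
  · intro h1
    by_contra h2
    rw [h.x_zero _ h2] at hv
    exact (h.x_pos _ h1).ne hv

/-- A cycle contains a vertex that is fixed by `g`. Otherwise a root whose support is the cycle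
together with a path to a fixed vertex `m` would be joined to `m` by a multiple edge. -/
lemma exists_fixed_mem_cycle (D : OrthogonalRoots Γ G) (hΓ : Γ.Connected) (hg : g ∈ G) {c : S}
    (hc : g c = c) {C : Finset S} (hne : C.Nonempty)
    (hC : ∀ v ∈ C, Γ.FinConn (C.erase v) ∧
      ∃ a ∈ C.erase v, ∃ b ∈ C.erase v, a ≠ b ∧ Γ.Adj a v ∧ Γ.Adj b v) :
    ∃ w ∈ C, g w = w := by
  by_contra! hmov
  obtain ⟨e₀, he₀⟩ := hne
  have hconnC : Γ.FinConn C := by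
    obtain ⟨h1, a, ha, b, -, -, hav, -⟩ := hC e₀ he₀
    have := h1.insert ha hav
    rwa [Finset.insert_erase he₀] at this
  have key : ∀ (v e : S) (q : Γ.Walk v e), e ∈ C → q.IsPath → (∀ z ∈ q.support, g z ≠ z) →
      (∀ z ∈ q.support, z ∈ C → z = e) →
      ∃ U x d, Γ.FinConn U ∧ D.IsRootOn U x d ∧ (∀ z, z ∈ U ↔ z ∈ C ∨ z ∈ q.support) ∧
        4 ≤ x v * d v := by
    intro v e q
    induction q with
    | nil =>
      intro he _ _ _
      obtain ⟨h1, a, ha, b, hb, hab, hae, hbe⟩ := hC _ he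
      obtain ⟨x, d, h, -, -⟩ := IsRootOn.exists_of_finConn D h1 ha
      obtain ⟨x', d', h', -, hx', hd'⟩ := h.extend (Finset.notMem_erase _ C) ha hae
      rw [Finset.insert_erase he] at h'
      refine ⟨C, x', d', hconnC, h', fun z => ?_, ?_⟩
      · simp only [SimpleGraph.Walk.support_nil, List.mem_singleton]
        exact ⟨Or.inl, fun h => h.elim id fun h => h ▸ he⟩
      · rw [hx', hd', neg_mul_neg]
        exact h.four_le_mul_of_adj (Finset.notMem_erase _ C) ha hae hb hbe hab
    | @cons v v' e hvv' q ih =>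
      intro he hp hmov' hC'
      rw [SimpleGraph.Walk.cons_isPath_iff] at hp
      obtain ⟨U, x, d, hU, h, hmem, h4⟩ := ih he hp.1
        (fun z hz => hmov' z (by simp [hz])) (fun z hz => hC' z (by simp [hz]))
      have hvC : v ∉ C := fun h => hp.2 (by
        rw [hC' v (by simp) h]; exact q.end_mem_support)
      have hvU : v ∉ U := by
        rw [hmem]; exact not_or.2 ⟨hvC, hp.2⟩
      have hv'U : v' ∈ U := (hmem v').2 (Or.inr q.start_mem_support)
      obtain ⟨x', d', h', -, hx', hd'⟩ := h.extend hvU hv'U hvv'.symm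
      refine ⟨insert v U, x', d', hU.insert hv'U hvv'.symm, h', fun z => ?_, ?_⟩
      · rw [Finset.mem_insert, hmem, SimpleGraph.Walk.support_cons, List.mem_cons]
        tauto
      · rw [hx', hd', neg_mul_neg]
        exact h4.trans (h.one_le_mul_of_adj hvU hv'U hvv'.symm)
  obtain ⟨p⟩ := hΓ.preconnected e₀ c
  obtain ⟨m, hm, q, -, hq⟩ := p.exists_first (A := {z | g z = z}) hc
  obtain ⟨e, he, r, hr1, hr2⟩ := q.reverse.exists_first (A := (C : Set S)) he₀
  have hpath := r.bypass_isPath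
  have hsub : ∀ z ∈ r.bypass.support, (g z = z → z = m) ∧ (z ∈ C → z = e) := fun z hz => by
    have h1 := r.support_bypass_subset_support hz
    exact ⟨fun h => hq z (by simpa using hr1 z h1) h, fun h => hr2 z h1 h⟩
  generalize r.bypass = r' at hpath hsub
  cases r' with
  | nil => exact hmov _ he hm
  | @cons _ v _ hmv q' =>
    rw [SimpleGraph.Walk.cons_isPath_iff] at hpath
    have hq'm : ∀ z ∈ q'.support, z ≠ m := fun z hz hzm => hpath.2 (hzm ▸ hz)
    have hq'mov : ∀ z ∈ q'.support, g z ≠ z := fun z hz h =>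
      hq'm z hz ((hsub z (by simp [hz])).1 h)
    obtain ⟨U, x, d, hU, h, hmem, h4⟩ := key v e q' he hpath.1 hq'mov
      (fun z hz => (hsub z (by simp [hz])).2)
    have hUmov : ∀ z ∈ U, g z ≠ z := fun z hz =>
      ((hmem z).1 hz).elim (hmov z) (hq'mov z)
    have hvU : v ∈ U := (hmem v).2 (Or.inr q'.start_mem_support)
    have hmU : m ∉ U := fun h => hUmov m h hm
    have h1 := h.mul_le_one hg
      (h.permV_ne hvU (D.perm_notMem_of_moved hU hg hUmov hvU)) hm
    have h2 := h.one_le_mul_of_adj hmU hvU hmv.symm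
    linarith

/-- A cycle contains a fixed vertex with a neighbour in the cycle that is moved, and the cycle is
`g`-stable. -/
lemma exists_adj_mem_cycle (D : OrthogonalRoots Γ G) (hΓ : Γ.Connected) (hg : g ∈ G) {c m₀ : S}
    (hc : g c = c) (hm₀ : g m₀ ≠ m₀) {C : Finset S} (hne : C.Nonempty)
    (hC : ∀ v ∈ C, Γ.FinConn (C.erase v) ∧
      ∃ a ∈ C.erase v, ∃ b ∈ C.erase v, a ≠ b ∧ Γ.Adj a v ∧ Γ.Adj b v) :
    ∃ w ∈ C, ∃ t ∈ C, g w = w ∧ g t ≠ t ∧ Γ.Adj w t ∧ g t ∈ C := by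
  obtain ⟨w₁, hw₁, hgw₁⟩ := D.exists_fixed_mem_cycle hΓ hg hc hne hC
  have hconnC : Γ.FinConn C := by
    obtain ⟨h1, a, ha, b, -, -, hav, -⟩ := hC w₁ hw₁
    have := h1.insert ha hav
    rwa [Finset.insert_erase hw₁] at this
  have hmoved : ∃ t ∈ C, g t ≠ t := by
    by_contra! hfix
    obtain ⟨p⟩ := hΓ.preconnected w₁ m₀
    obtain ⟨m, hm, q, -, hq⟩ := p.exists_first (A := {z | g z ≠ z}) hm₀
    obtain ⟨e, he, r, hr1, hr2⟩ := q.reverse.exists_first (A := (C : Set S)) hw₁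
    obtain ⟨-, w, hw, -, -, -, -, -⟩ := hC e he
    have hwe := (Finset.mem_erase.1 hw).1
    have hwC := (Finset.mem_erase.1 hw).2
    obtain ⟨h1, a, ha, b, hb, hab, haw, hbw⟩ := hC w hwC
    have hconn : Γ.FinConn (C.erase w ∪ r.support.toFinset) :=
      h1.union (SimpleGraph.FinConn.of_walk r)
        (Or.inl ⟨e, Finset.mem_erase.2 ⟨hwe.symm, he⟩, by simp⟩)
    have hwT : w ∉ C.erase w ∪ r.support.toFinset := by
      rw [Finset.mem_union, List.mem_toFinset, not_or]
      exact ⟨Finset.notMem_erase _ _, fun h => hwe (hr2 w h hwC)⟩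
    have hmT : m ∈ C.erase w ∪ r.support.toFinset := by simp
    have h2 := (D.perm_mem_iff_of_adj hconn hg (hfix w hwC) hwT (Finset.mem_union_left _ ha)
      (Finset.mem_union_left _ hb) hab haw hbw m).2 hmT
    rcases Finset.mem_union.1 h2 with h2 | h2
    · exact hm (g.injective (hfix _ (Finset.mem_of_mem_erase h2)))
    · rw [List.mem_toFinset] at h2
      exact hm (hq _ (by simpa using hr1 _ h2) fun e => hm (g.injective e))
  obtain ⟨t₁, ht₁, hgt₁⟩ := hmoved
  obtain ⟨w, hw, t, ht, hgw, hgt, hwt⟩ := hconnC.exists_adj (A := {z | g z ≠ z}) hw₁ ht₁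
    (by simpa using hgw₁) hgt₁
  have hgw' : g w = w := by simpa using hgw
  refine ⟨w, hw, t, ht, hgw', hgt, hwt, ?_⟩
  obtain ⟨h1, a, ha, b, hb, hab, haw, hbw⟩ := hC w hw
  exact Finset.mem_of_mem_erase ((D.perm_mem_iff_of_adj h1 hg hgw' (Finset.notMem_erase _ _) ha hb
    hab haw hbw t).2 (Finset.mem_erase.2 ⟨hwt.ne', ht⟩))

end OrthogonalRoots
end

/-! ### Cycles that meet both fixed and moved vertices -/

noncomputable section

variable {S : Type*}

namespace OrthogonalRoots

variable {Γ : SimpleGraph S} {G : Subgroup (Equiv.Perm S)} {D : OrthogonalRoots Γ G}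
  {T : Finset S} {x d : S →₀ ℝ} {g : Equiv.Perm S}

/-- `p 0, …, p N` is an induced path between two distinct `g`-fixed vertices whose interior
vertices are moved by `g`. -/
structure IsArc (Γ : SimpleGraph S) (g : Equiv.Perm S) (N : ℕ) (p : ℕ → S) : Prop where
  two_le : 2 ≤ N
  fixed_zero : g (p 0) = p 0
  fixed_last : g (p N) = p N
  moved : ∀ i, 0 < i → i < N → g (p i) ≠ p i
  adj_iff : ∀ i ≤ N, ∀ j ≤ N, Γ.Adj (p i) (p j) ↔ i + 1 = j ∨ j + 1 = i
  inj : ∀ i ≤ N, ∀ j ≤ N, p i = p j → i = j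

lemma IsArc.reverse {N : ℕ} {p : ℕ → S} (h : IsArc Γ g N p) :
    IsArc Γ g N (fun i => p (N - i)) where
  two_le := h.two_le
  fixed_zero := by simpa using h.fixed_last
  fixed_last := by simpa using h.fixed_zero
  moved i h1 h2 := h.moved (N - i) (by omega) (by omega)
  adj_iff i hi j hj := by rw [h.adj_iff _ (by omega) _ (by omega)]; omega
  inj i hi j hj e := by have := h.inj _ (by omega) _ (by omega) e; omega

section

variable [DecidableEq S]

lemma finConn_interior {N : ℕ} {p : ℕ → S} (hN : 2 ≤ N)
    (hadj : ∀ i < N, Γ.Adj (p i) (p (i + 1))) :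
    Γ.FinConn ((Finset.range (N - 1)).image fun i => p (i + 1)) := by
  obtain ⟨n, rfl⟩ : ∃ n, N = n + 2 := ⟨N - 2, by omega⟩
  exact SimpleGraph.finConn_image_range fun i hi => hadj (i + 1) (by omega)

lemma mem_interior {N : ℕ} {p : ℕ → S} {i : ℕ} (h1 : 0 < i) (h2 : i < N) :
    p i ∈ (Finset.range (N - 1)).image fun i => p (i + 1) :=
  Finset.mem_image.2 ⟨i - 1, Finset.mem_range.2 (by omega), by simp [show i - 1 + 1 = i by omega]⟩

/-- The interior vertices of an arc differ from their images under `g`. -/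
lemma perm_ne_interior (D : OrthogonalRoots Γ G) (hg : g ∈ G) {N : ℕ} {p : ℕ → S} (hN : 2 ≤ N)
    (hadj : ∀ i < N, Γ.Adj (p i) (p (i + 1))) (hmov : ∀ i, 0 < i → i < N → g (p i) ≠ p i) {i j : ℕ}
    (hi : 0 < i) (hi' : i < N) (hj : 0 < j) (hj' : j < N) :
    g (p i) ≠ p j ∧ ¬Γ.Adj (p i) (g (p j)) := by
  have hT := finConn_interior hN hadj
  have hm : ∀ t ∈ (Finset.range (N - 1)).image fun i => p (i + 1), g t ≠ t := by
    intro t ht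
    obtain ⟨i, hi, rfl⟩ := Finset.mem_image.1 ht
    exact hmov _ (by omega) (by have := Finset.mem_range.1 hi; omega)
  have hd : ∀ t ∈ (Finset.range (N - 1)).image fun i => p (i + 1),
      g t ∉ (Finset.range (N - 1)).image fun i => p (i + 1) :=
    fun t ht => D.perm_notMem_of_moved hT hg hm ht
  refine ⟨fun e => hd _ (mem_interior hi hi') (e ▸ mem_interior hj hj'), ?_⟩
  exact D.not_adj_perm hT hg hd (mem_interior hi hi') (mem_interior hj hj')

lemma finConn_tail {N : ℕ} {p : ℕ → S} (hN : 1 ≤ N)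
    (hadj : ∀ i < N, Γ.Adj (p i) (p (i + 1))) :
    Γ.FinConn ((Finset.range N).image fun i => p (i + 1)) := by
  obtain ⟨n, rfl⟩ : ∃ n, N = n + 1 := ⟨N - 1, by omega⟩
  exact SimpleGraph.finConn_image_range fun i hi => hadj (i + 1) (by omega)

/-- A cycle yields an arc: among all walks that leave a fixed vertex through a moved one and end in
another fixed vertex, take a shortest one. -/
lemma exists_arc (D : OrthogonalRoots Γ G) (hΓ : Γ.Connected) (hg : g ∈ G) (hg1 : g ≠ 1)
    (hcyc : ¬Γ.IsAcyclic) : ∃ N p, IsArc Γ g N p := by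
  classical
  obtain ⟨C, hne, hC⟩ := SimpleGraph.exists_cycle_finset hcyc
  obtain ⟨c, m, hc, -, hm⟩ := D.exists_branch hΓ hg hg1
  obtain ⟨w, hw, t, ht, hgw, hgt, hwt, hgtC⟩ := D.exists_adj_mem_cycle hΓ hg hc hm hne hC
  have hconn := (hC w hw).1
  have htE : t ∈ C.erase w := Finset.mem_erase.2 ⟨hwt.ne', ht⟩
  obtain ⟨w', hw'E, hgw'⟩ : ∃ w' ∈ C.erase w, g w' = w' := by
    by_contra! hmov
    refine D.perm_notMem_of_moved hconn hg hmov htE (Finset.mem_erase.2 ⟨?_, hgtC⟩)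
    exact fun e => hgt (g.injective (by rw [e, hgw]))
  obtain ⟨q, hq⟩ := hconn.exists_walk htE hw'E
  let P : ℕ → Prop := fun N => ∃ p : ℕ → S, p 0 = w ∧ g (p 1) ≠ p 1 ∧
    (∀ i < N, Γ.Adj (p i) (p (i + 1))) ∧ g (p N) = p N ∧ ∀ i, 0 < i → i ≤ N → p i ≠ w
  have hP : ∃ N, 0 < N ∧ P N := by
    refine ⟨q.length + 1, Nat.succ_pos _, (SimpleGraph.Walk.cons hwt q).getVert, by simp,
      by simpa using hgt, fun i hi => ?_, ?_, ?_⟩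
    · exact (SimpleGraph.Walk.cons hwt q).adj_getVert_succ (by simpa using hi)
    · simpa using hgw'
    · intro i hi hi'
      obtain ⟨j, rfl⟩ : ∃ j, i = j + 1 := ⟨i - 1, by omega⟩
      rw [SimpleGraph.Walk.getVert_cons_succ]
      exact (Finset.mem_erase.1 (hq _ (q.getVert_mem_support j))).1
  obtain ⟨hN0, p, hp0, hp1, hadj, hpN, hpw⟩ := Nat.find_spec hP
  have hmin : ∀ n, 0 < n → n < Nat.find hP → ¬P n := fun n h1 h2 h3 =>
    Nat.find_min hP h2 ⟨h1, h3⟩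
  generalize Nat.find hP = N at hN0 hadj hpN hpw hmin
  have hN : 2 ≤ N := by
    by_contra hlt
    have : N = 1 := by omega
    subst this
    exact hp1 hpN
  have hmov : ∀ i, 0 < i → i < N → g (p i) ≠ p i := fun i h1 h2 h3 =>
    hmin i h1 h2 ⟨p, hp0, hp1, fun j hj => hadj j (by omega), h3, fun j h4 h5 => hpw j h4 (by omega)⟩
  have hnadj : ∀ i j, i + 1 < j → j ≤ N → ¬Γ.Adj (p i) (p j) := by
    intro i j hij hj hadj'
    by_cases hend : i = 0 ∧ j = N
    · obtain ⟨rfl, rfl⟩ := hend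
      have hmem : ∀ k, 0 < k → k ≤ j → p k ∈ (Finset.range j).image fun i => p (i + 1) :=
        fun k h1 h2 => Finset.mem_image.2
          ⟨k - 1, Finset.mem_range.2 (by omega), by simp [show k - 1 + 1 = k by omega]⟩
      have h1 : g (p 1) ∉ (Finset.range j).image fun i => p (i + 1) := by
        intro h
        obtain ⟨k, hk, hk'⟩ := Finset.mem_image.1 h
        have hk := Finset.mem_range.1 hk
        rcases eq_or_lt_of_le (show k + 1 ≤ j by omega) with e | e
        · rw [e] at hk'
          exact hp1 (g.injective (by rw [← hk', hpN]))
        · exact (D.perm_ne_interior hg hN hadj hmov one_pos (by omega) (Nat.succ_pos k) e).1 hk'.symm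
      have h2 : p 0 ∉ (Finset.range j).image fun i => p (i + 1) := by
        intro h
        obtain ⟨k, hk, hk'⟩ := Finset.mem_image.1 h
        exact hpw (k + 1) (by omega) (by have := Finset.mem_range.1 hk; omega) (by rw [hk', hp0])
      have h3 := D.eq_of_adj_of_adj (finConn_tail (by omega) hadj) hg (hmem 1 one_pos (by omega)) h1
        (by rw [hp0, hgw]) h2 (hmem 1 one_pos (by omega)) (hmem j (by omega) le_rfl)
        (hadj 0 (by omega)).symm hadj'.symm
      exact hp1 (by rw [h3, hpN])
    · refine hmin (N - (j - i - 1)) (by omega) (by omega)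
        ⟨fun k => if k ≤ i then p k else p (k + (j - i - 1)), by simpa using hp0, ?_, ?_, ?_, ?_⟩
      · dsimp only
        split_ifs with h
        · exact hp1
        · exact hmov _ (by omega) (by omega)
      · intro k hk
        dsimp only
        rcases lt_trichotomy k i with h | h | h
        · rw [if_pos h.le, if_pos (by omega)]; exact hadj k (by omega)
        · subst h
          rw [if_pos le_rfl, if_neg (by omega)]
          convert hadj' using 2
          omega
        · rw [if_neg (by omega), if_neg (by omega)]
          convert hadj (k + (j - i - 1)) (by omega) using 2
          omega
      · dsimp only
        rw [if_neg (by omega)]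
        convert hpN using 2 <;> first | omega | (congr 1; omega)
      · intro k h1 h2
        dsimp only
        split_ifs with h
        · exact hpw k h1 (by omega)
        · exact hpw _ (by omega) (by omega)
  have hinj : ∀ i j, i < j → j ≤ N → p i ≠ p j := by
    intro i j hij hj e
    rcases Nat.eq_zero_or_pos i with rfl | hi
    · exact hpw j hij hj (by rw [← e, hp0])
    rcases eq_or_lt_of_le hj with rfl | hj
    · exact hmov i hi hij (by rw [e, hpN])
    · exact hnadj i (j + 1) (by omega) hj (e ▸ hadj j hj)
  refine ⟨N, p, hN, by rw [hp0, hgw], hpN, hmov, fun i hi j hj => ?_, fun i hi j hj e => ?_⟩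
  · constructor
    · intro h
      by_contra hne
      rcases lt_trichotomy i j with h1 | h1 | h1
      · exact hnadj i j (by omega) hj h
      · exact h.ne (by rw [h1])
      · exact hnadj j i (by omega) hi h.symm
    · rintro (rfl | rfl)
      · exact hadj i (by omega)
      · exact (hadj j (by omega)).symm
  · by_contra hne
    rcases Nat.lt_or_gt_of_ne hne with h | h
    · exact hinj i j h hj e
    · exact hinj j i h hi e.symm

end

namespace IsArc

variable [DecidableEq S] {N : ℕ} {p : ℕ → S}

omit [DecidableEq S] in
lemma adj_succ (h : IsArc Γ g N p) {i : ℕ} (hi : i < N) : Γ.Adj (p i) (p (i + 1)) :=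
  (h.adj_iff i hi.le (i + 1) hi).2 (Or.inl rfl)

lemma perm_ne (h : IsArc Γ g N p) (D : OrthogonalRoots Γ G) (hg : g ∈ G) {i j : ℕ} (hi : 0 < i)
    (hi' : i < N) (hj : j ≤ N) : g (p i) ≠ p j := by
  rcases Nat.eq_zero_or_pos j with rfl | hj0
  · exact fun e => h.moved i hi hi' (g.injective (by rw [e, h.fixed_zero]))
  rcases eq_or_lt_of_le hj with rfl | hj
  · exact fun e => h.moved i hi hi' (g.injective (by rw [e, h.fixed_last]))
  · exact (D.perm_ne_interior hg h.two_le (fun _ => h.adj_succ) h.moved hi hi' hj0 hj).1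

lemma adj_perm_iff (h : IsArc Γ g N p) (D : OrthogonalRoots Γ G) (hg : g ∈ G) {i j : ℕ}
    (hi : i ≤ N) (hj : j ≤ N) : Γ.Adj (p i) (g (p j)) ↔
      ((i = 0 ∨ i = N ∨ j = 0 ∨ j = N) ∧ (i + 1 = j ∨ j + 1 = i)) := by
  have hfix : ∀ k, k = 0 ∨ k = N → g (p k) = p k := by
    rintro k (rfl | rfl)
    · exact h.fixed_zero
    · exact h.fixed_last
  by_cases hj0 : j = 0 ∨ j = N
  · rw [hfix j hj0, h.adj_iff i hi j hj]; omega
  by_cases hi0 : i = 0 ∨ i = N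
  · rw [← hfix i hi0, D.adj_perm hg, h.adj_iff i hi j hj]; omega
  · have := (D.perm_ne_interior hg h.two_le (fun _ => h.adj_succ) h.moved (i := i) (j := j)
      (by omega) (by omega) (by omega) (by omega)).2
    simp only [this, false_iff]
    omega

/-- The vertices `p 0, …, p (n - 1)` and their images under `g`. -/
def half (g : Equiv.Perm S) (p : ℕ → S) (n : ℕ) : Finset S :=
  (Finset.range n).image p ∪ (Finset.range n).image fun i => g (p i)

lemma mem_half {n : ℕ} {v : S} : v ∈ half g p n ↔ ∃ i < n, v = p i ∨ v = g (p i) := by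
  simp only [half, Finset.mem_union, Finset.mem_image, Finset.mem_range]
  constructor
  · rintro (⟨i, hi, rfl⟩ | ⟨i, hi, rfl⟩)
    · exact ⟨i, hi, Or.inl rfl⟩
    · exact ⟨i, hi, Or.inr rfl⟩
  · rintro ⟨i, hi, rfl | rfl⟩
    · exact Or.inl ⟨i, hi, rfl⟩
    · exact Or.inr ⟨i, hi, rfl⟩

lemma finConn_half (h : IsArc Γ g N p) (D : OrthogonalRoots Γ G) (hg : g ∈ G) {n : ℕ}
    (hn : n ≤ N) : Γ.FinConn (half g p (n + 1)) := by
  refine (SimpleGraph.finConn_image_range (u := p) (n := n)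
      fun i hi => h.adj_succ (by omega)).union
    (SimpleGraph.finConn_image_range (u := fun i => g (p i)) (n := n)
      fun i hi => (D.adj_perm hg _ _).2 (h.adj_succ (by omega)))
    (Or.inl ⟨p 0, Finset.mem_image_of_mem _ (by simp), ?_⟩)
  exact Finset.mem_image.2 ⟨0, by simp, h.fixed_zero⟩

lemma last_notMem_half (h : IsArc Γ g N p) {n : ℕ} (hn : n ≤ N) : p N ∉ half g p n := by
  rw [mem_half]
  rintro ⟨i, hi, e | e⟩
  · have := h.inj N le_rfl i (by omega) e; omega
  · rw [← h.fixed_last] at e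
    have := h.inj N le_rfl i (by omega) (g.injective e); omega

omit [DecidableEq S] in
lemma adj_last (h : IsArc Γ g N p) (D : OrthogonalRoots Γ G) (hg : g ∈ G) :
    Γ.Adj (p (N - 1)) (p N) ∧ Γ.Adj (g (p (N - 1))) (p N) ∧ p (N - 1) ≠ g (p (N - 1)) := by
  have h2 := h.two_le
  have h1 : Γ.Adj (p (N - 1)) (p N) := (h.adj_iff _ (by omega) _ le_rfl).2 (by omega)
  refine ⟨h1, ?_, (h.moved _ (by omega) (by omega)).symm⟩
  have := (D.adj_perm hg _ _).2 h1
  rwa [h.fixed_last] at this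

/-- The arc and its image under `g`, without their common end `p N`, form a `g`-stable set. -/
lemma perm_mem_half (h : IsArc Γ g N p) (D : OrthogonalRoots Γ G) (hg : g ∈ G) (v : S) :
    g v ∈ half g p N ↔ v ∈ half g p N := by
  have h2 := h.two_le
  obtain ⟨h3, h4, h5⟩ := h.adj_last D hg
  have hc := h.finConn_half D hg (n := N - 1) (by omega)
  rw [show N - 1 + 1 = N by omega] at hc
  exact D.perm_mem_iff_of_adj hc hg h.fixed_last (h.last_notMem_half le_rfl)
    (mem_half.2 ⟨N - 1, by omega, Or.inl rfl⟩) (mem_half.2 ⟨N - 1, by omega, Or.inr rfl⟩) h5 h3 h4 v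

/-- A vertex outside of the cycle that is adjacent to `half g p N` is fixed: otherwise adding it to
`half g p N` yields a set that is not stable. -/
lemma fixed_of_adj_half (h : IsArc Γ g N p) (D : OrthogonalRoots Γ G) (hg : g ∈ G) {u v : S}
    (hu : u ∈ half g p N) (hv : v ∉ half g p N) (hvN : v ≠ p N) (huv : Γ.Adj u v) : g v = v := by
  by_contra hgv
  have h2 := h.two_le
  obtain ⟨h3, h4, h5⟩ := h.adj_last D hg
  have hc := h.finConn_half D hg (n := N - 1) (by omega)
  rw [show N - 1 + 1 = N by omega] at hc
  have := (D.perm_mem_iff_of_adj (hc.insert hu huv) hg h.fixed_last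
    (by rw [Finset.mem_insert, not_or]; exact ⟨hvN.symm, h.last_notMem_half le_rfl⟩)
    (Finset.mem_insert_of_mem (mem_half.2 ⟨N - 1, by omega, Or.inl rfl⟩))
    (Finset.mem_insert_of_mem (mem_half.2 ⟨N - 1, by omega, Or.inr rfl⟩)) h5 h3 h4 v).2
    (Finset.mem_insert_self _ _)
  rcases Finset.mem_insert.1 this with e | e
  · exact hgv e
  · exact hv ((h.perm_mem_half D hg v).1 e)

/-- The vertices of the cycle formed by the arc and its image under `g`. -/
lemma mem_reverse_half {v : S} :
    v ∈ half g (fun i => p (N - i)) N ↔ ∃ i, 0 < i ∧ i ≤ N ∧ (v = p i ∨ v = g (p i)) := by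
  rw [mem_half]
  constructor
  · rintro ⟨i, hi, e⟩
    exact ⟨N - i, by omega, by omega, e⟩
  · rintro ⟨i, h1, h2, e⟩
    exact ⟨N - i, by omega, by simpa [show N - (N - i) = i by omega] using e⟩

lemma not_adj_of_lt (h : IsArc Γ g N p) (D : OrthogonalRoots Γ G) (hg : g ∈ G) {v : S}
    (hgv : g v = v) (hv : ∀ i ≤ N, v ≠ p i ∧ v ≠ g (p i)) {j : ℕ} (hj : 0 < j) (hj' : j + 1 < N) :
    ¬Γ.Adj (p j) v := by
  intro hadj
  have hT : Γ.FinConn (insert (p (j + 1)) (half g p (j + 1))) :=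
    (h.finConn_half D hg (by omega)).insert (mem_half.2 ⟨j, by omega, Or.inl rfl⟩)
      (h.adj_succ (by omega))
  have hadj' := (D.adj_perm hg _ _).2 hadj
  rw [hgv] at hadj'
  refine h.moved j hj (by omega) (D.eq_of_adj_of_adj hT hg (Finset.mem_insert_self _ _) ?_ hgv ?_
    (Finset.mem_insert_of_mem (mem_half.2 ⟨j, by omega, Or.inl rfl⟩))
    (Finset.mem_insert_of_mem (mem_half.2 ⟨j, by omega, Or.inr rfl⟩)) hadj hadj').symm
  · rw [Finset.mem_insert, not_or, mem_half]
    refine ⟨h.perm_ne D hg (by omega) (by omega) (by omega), ?_⟩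
    rintro ⟨i, hi, e | e⟩
    · exact h.perm_ne D hg (by omega) (by omega) (by omega) e
    · have := h.inj _ (by omega) _ (by omega) (g.injective e); omega
  · rw [Finset.mem_insert, not_or, mem_half]
    refine ⟨(hv _ (by omega)).1, ?_⟩
    rintro ⟨i, hi, e | e⟩
    · exact (hv i (by omega)).1 e
    · exact (hv i (by omega)).2 e

end IsArc

end OrthogonalRoots
end

/-! ### Graphs that contain a cycle -/

noncomputable section

variable {S : Type*}

lemma SimpleGraph.Connected.mem_of_closed {Γ : SimpleGraph S} (hΓ : Γ.Connected) {A : Set S} {s : S}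
    (hs : s ∈ A) (hA : ∀ u ∈ A, ∀ v, Γ.Adj u v → v ∈ A) (v : S) : v ∈ A := by
  obtain ⟨p⟩ := hΓ.preconnected s v
  induction p with
  | nil => exact hs
  | cons h p ih => exact ih (hA _ hs _ h)

namespace OrthogonalRoots

variable {Γ : SimpleGraph S} {G : Subgroup (Equiv.Perm S)} {D : OrthogonalRoots Γ G}
  {T : Finset S} {x d : S →₀ ℝ} {g : Equiv.Perm S}

/-- A moved vertex does not have three fixed neighbours: the highest root of the subsystem of type
`D₄` that they generate would not be orthogonal to its image. -/
lemma false_of_three_fixed (D : OrthogonalRoots Γ G) (hg : g ∈ G)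
    (hl : ∀ s w, Γ.Adj s w → D.a s (Finsupp.single w 1) * D.a w (Finsupp.single s 1) = 1)
    {t w₁ w₂ w₃ : S} (ht : g t ≠ t) (h₁ : g w₁ = w₁) (h₂ : g w₂ = w₂) (h₃ : g w₃ = w₃)
    (h₁₂ : w₁ ≠ w₂) (h₁₃ : w₁ ≠ w₃) (h₂₃ : w₂ ≠ w₃) (a₁ : Γ.Adj t w₁) (a₂ : Γ.Adj t w₂)
    (a₃ : Γ.Adj t w₃) : False := by
  classical
  have hzero : ∀ {v w : S}, g v = v → g w = w → v ≠ w → Γ.Adj t v → Γ.Adj t w →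
      D.a v (Finsupp.single w 1) = 0 ∧ D.a w (Finsupp.single v 1) = 0 := by
    intro v w hv hw hvw htv htw
    have hnot : ¬Γ.Adj v w := by
      intro hadj
      have := D.eq_of_adj_of_adj (T := {t, v})
        ((SimpleGraph.FinConn.singleton v).insert (Finset.mem_singleton_self v) htv.symm) hg
        (t := t) (by simp) (by
          simp only [Finset.mem_insert, Finset.mem_singleton, not_or]
          exact ⟨ht, fun e => htv.ne (g.injective (by rw [e, hv]))⟩) hw
        (by simp [htw.ne', hvw.symm]) (u := t) (u' := v) (by simp) (by simp) htw hadj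
      exact htv.ne this
    exact ⟨D.a_eq_zero hvw hnot, D.a_eq_zero hvw.symm fun h => hnot h.symm⟩
  obtain ⟨z12, z21⟩ := hzero h₁ h₂ h₁₂ a₁ a₂
  obtain ⟨z13, z31⟩ := hzero h₁ h₃ h₁₃ a₁ a₃
  obtain ⟨z23, z32⟩ := hzero h₂ h₃ h₂₃ a₂ a₃
  have l1 := hl t w₁ a₁
  have l2 := hl t w₂ a₂
  have l3 := hl t w₃ a₃
  have two := fun s => D.a_self s
  have hgt : D.a t (Finsupp.single (g t) 1) = 0 := D.a_eq_zero ht.symm (D.not_adj_orbit hg t)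
  have hfix : ∀ {w : S}, g w = w → D.a w (Finsupp.single (g t) 1) = D.a w (Finsupp.single t 1) := by
    intro w hw
    have := D.a_perm_single hg w t
    rwa [hw] at this
  have f1 := hfix h₁
  have f2 := hfix h₂
  have f3 := hfix h₃
  have p1 := D.reflect (D.isPair_simple t) (D.isPair_simple w₁)
  have p2 := D.reflect p1 (D.isPair_simple w₂)
  have p3 := D.reflect p2 (D.isPair_simple w₃)
  have p4 := D.reflect p3 (D.isPair_simple t)
  have hne : permV g (Finsupp.single t (1 : ℝ)) - Finsupp.single t 1 ≠ 0 := by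
    rw [permV_single, sub_ne_zero]
    exact fun e => ht (Finsupp.single_left_injective one_ne_zero e)
  simp only [map_sub, map_smul, LinearMap.sub_apply, LinearMap.smul_apply, smul_eq_mul, z12, z21,
    z13, z31, z23, z32, two, mul_zero, sub_zero, l1, l2, l3, mul_comm _ (D.a t _)] at p4
  rcases D.orth p4 hg with h | h
  · simp only [map_sub, map_smul, permV_single, h₁, h₂, h₃] at h
    apply hne
    rw [permV_single]
    have h5 : (2 : ℝ) • (Finsupp.single (g t) (1 : ℝ) - Finsupp.single t 1) = 0 := by
      rw [← sub_eq_zero] at h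
      rw [← h]
      match_scalars <;> ring
    exact (smul_eq_zero.1 h5).resolve_left (by norm_num)
  · simp only [map_sub, map_smul, permV_single, h₁, h₂, h₃, LinearMap.sub_apply,
      LinearMap.smul_apply, smul_eq_mul, hgt, f1, f2, f3, z12, z21, z13, z31, z23, z32, two] at h
    linarith

/-- Let `x` be a root such that the fixed vertex `v` is joined to `x` by a multiple edge. Then `x`
is orthogonal to every moved vertex `a` that is not adjacent to `v`. Otherwise the reflection of `x`
in `a` is a moved root in the same position with respect to `v`. -/
lemma IsRootOn.eq_zero_of_moved (h : D.IsRootOn T x d) (hg : g ∈ G) {v : S} (hv : g v = v)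
    (hgt : 1 < D.a v x * D.form d (Finsupp.single v 1)) {a : S} (ha : g a ≠ a)
    (hav : ¬Γ.Adj a v) : D.a a x = 0 ∧ D.form d (Finsupp.single a 1) = 0 := by
  have hne : a ≠ v := fun e => ha (e ▸ hv)
  have hfix : permV g x = x := by
    by_contra hne
    exact absurd (h.mul_le_one hg hne hv) (not_le.2 hgt)
  have h1 := D.reflect h.pair (D.isPair_simple a)
  have h0 : D.a a x = 0 := by
    by_contra h0
    have hmov : permV g (x - D.a a x • Finsupp.single a 1) ≠ x - D.a a x • Finsupp.single a 1 := by
      intro e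
      rw [map_sub, map_smul, hfix, permV_single] at e
      have h2 := smul_right_injective _ h0 (sub_right_injective e)
      exact ha (Finsupp.single_left_injective one_ne_zero h2)
    have h2 := D.mul_eq_zero_or_one (D.isPair_simple v) h1 hg (by rw [permV_single, hv]) hmov
    rw [map_sub, map_smul, LinearMap.sub_apply, LinearMap.smul_apply, D.a_eq_zero hne hav,
      D.a_eq_zero hne.symm fun h => hav h.symm, smul_zero, smul_zero, sub_zero, sub_zero] at h2
    rcases h2 with h2 | h2 <;> rw [h2] at hgt <;> linarith
  refine ⟨h0, ?_⟩
  rw [h0, zero_smul, sub_zero] at h1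
  have h2 := congrArg (fun f => f (Finsupp.single a (1 : ℝ))) (D.unique h.pair h1)
  simp only [LinearMap.sub_apply, LinearMap.smul_apply, smul_eq_mul, D.a_self] at h2
  linarith

lemma IsRootOn.a_le_sum_of_mem (h : D.IsRootOn T x d) {v : S} {U : Finset S} (hU : U ⊆ T)
    (hv : v ∈ U) : D.a v x ≤ ∑ t ∈ U, x t * D.a v (Finsupp.single t 1) := by
  rw [apply_eq_sum h.x_zero]
  refine Finset.sum_le_sum_of_subset_of_nonpos' hU fun t ht htU => ?_
  exact mul_nonpos_of_nonneg_of_nonpos (h.x_pos t ht).le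
    (D.a_nonpos (ne_of_mem_of_not_mem hv htU))

lemma IsRootOn.form_le_sum_of_mem (h : D.IsRootOn T x d) {v : S} {U : Finset S} (hU : U ⊆ T)
    (hv : v ∈ U) : D.form d (Finsupp.single v 1) ≤ ∑ t ∈ U, d t * D.a t (Finsupp.single v 1) := by
  rw [form_eq_sum D h.d_zero]
  refine Finset.sum_le_sum_of_subset_of_nonpos' hU fun t ht htU => ?_
  exact mul_nonpos_of_nonneg_of_nonpos (h.d_pos t ht).le
    (D.a_nonpos (ne_of_mem_of_not_mem hv htU).symm)

namespace IsArc

variable {N : ℕ} {p : ℕ → S}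

lemma not_adj_interior (h : IsArc Γ g N p) (D : OrthogonalRoots Γ G) (hg : g ∈ G)
    (hl : ∀ s w, Γ.Adj s w → D.a s (Finsupp.single w 1) * D.a w (Finsupp.single s 1) = 1) {v : S}
    (hgv : g v = v) (hv : ∀ i ≤ N, v ≠ p i ∧ v ≠ g (p i)) {j : ℕ} (hj : 0 < j) (hj' : j < N) :
    ¬Γ.Adj (p j) v := by
  classical
  intro hadj
  have h2 := h.two_le
  by_cases h3 : j + 1 < N
  · exact h.not_adj_of_lt D hg hgv hv hj h3 hadj
  by_cases h4 : 1 < j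
  · exact h.reverse.not_adj_of_lt D hg hgv (fun i _ => hv (N - i) (by omega)) (j := 1) one_pos
      (by omega) (by rwa [show N - 1 = j by omega])
  · obtain rfl : j = 1 := by omega
    obtain rfl : N = 2 := by omega
    exact D.false_of_three_fixed hg hl (h.moved 1 one_pos (by omega)) h.fixed_zero h.fixed_last hgv
      (fun e => by have := h.inj 0 (by omega) 2 le_rfl e; omega) (hv 0 (by omega)).1.symm
      (hv 2 le_rfl).1.symm (h.adj_succ (i := 0) (by omega)).symm (h.adj_succ (by omega)) hadj

lemma not_adj_end (h : IsArc Γ g N p) (D : OrthogonalRoots Γ G) (hg : g ∈ G)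
    (hl : ∀ s w, Γ.Adj s w → D.a s (Finsupp.single w 1) * D.a w (Finsupp.single s 1) = 1) {v : S}
    (hgv : g v = v) (hv : ∀ i ≤ N, v ≠ p i ∧ v ≠ g (p i)) : ¬Γ.Adj (p N) v := by
  classical
  intro hadj
  have h2 := h.two_le
  obtain ⟨h3, h4, h5⟩ := h.adj_last D hg
  set a := p (N - 1) with ha
  have hc := h.finConn_half D hg (n := N - 1) (by omega)
  rw [show N - 1 + 1 = N by omega] at hc
  have haT : a ∈ half g p N := mem_half.2 ⟨N - 1, by omega, Or.inl rfl⟩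
  have hgaT : g a ∈ half g p N := mem_half.2 ⟨N - 1, by omega, Or.inr rfl⟩
  have hNT : p N ∉ half g p N := h.last_notMem_half le_rfl
  obtain ⟨x₀, d₀, h₀, hx₀, hd₀⟩ := IsRootOn.exists_of_finConn D hc haT
  obtain ⟨x, d, hr, hxd, hxN, hdN⟩ := h₀.extend hNT haT h3
  have hxa : x a = 1 := by rw [(hxd a h3.ne).1, hx₀]
  have hda : d a = 1 := by rw [(hxd a h3.ne).2, hd₀]
  have hN4 : 4 ≤ x (p N) * d (p N) := by
    rw [hxN, hdN, neg_mul_neg]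
    exact h₀.four_le_mul_of_adj hNT haT h3 hgaT h4 h5
  have hNmem : p N ∈ insert (p N) (half g p N) := Finset.mem_insert_self _ _
  have hvT : v ∉ insert (p N) (half g p N) := by
    rw [Finset.mem_insert, not_or, mem_half]
    refine ⟨(hv N le_rfl).1, ?_⟩
    rintro ⟨i, hi, e | e⟩
    · exact (hv i hi.le).1 e
    · exact (hv i hi.le).2 e
  have hv4 := hr.one_le_mul_of_adj hvT hNmem hadj
  obtain ⟨e1, e2⟩ := hr.eq_zero_of_moved hg hgv (by linarith)
    (h.moved (N - 1) (by omega) (by omega))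
    (h.not_adj_interior D hg hl hgv hv (by omega) (by omega))
  rw [← ha] at e1 e2
  set b := p (N - 2) with hb
  have hab : Γ.Adj a b := (h.adj_iff _ (by omega) _ (by omega)).2 (by omega)
  have hbN : b ≠ p N := fun e => by have := h.inj _ (by omega) _ (by omega) e; omega
  have hbT : b ∈ insert (p N) (half g p N) :=
    Finset.mem_insert_of_mem (mem_half.2 ⟨N - 2, by omega, Or.inl rfl⟩)
  have hsub : ({a, p N, b} : Finset S) ⊆ insert (p N) (half g p N) := by
    simp [Finset.insert_subset_iff, haT, hbT]
  have s1 := hr.a_le_sum_of_mem hsub (Finset.mem_insert_self a _)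
  have s2 := hr.form_le_sum_of_mem hsub (Finset.mem_insert_self a _)
  rw [Finset.sum_insert (by simp [h3.ne, hab.ne]), Finset.sum_pair hbN.symm, D.a_self] at s1 s2
  rw [e1, hxa] at s1
  rw [e2, hda] at s2
  have n1 := mul_neg_of_pos_of_neg (hr.x_pos b hbT) (D.a_neg hab)
  have n2 := mul_neg_of_pos_of_neg (hr.d_pos b hbT) (D.a_neg hab.symm)
  have n3 := D.a_neg h3
  have n4 := D.a_neg h3.symm
  have n5 := hr.x_pos _ hNmem
  have n6 := hr.d_pos _ hNmem
  have n7 := hl a (p N) h3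
  have m1 : -(x (p N) * D.a a (Finsupp.single (p N) 1)) < 2 := by linarith
  have m2 : -(d (p N) * D.a (p N) (Finsupp.single a 1)) < 2 := by linarith
  have m3 : 0 < -(x (p N) * D.a a (Finsupp.single (p N) 1)) := by
    have := mul_neg_of_pos_of_neg n5 n3; linarith
  have m4 : 0 < -(d (p N) * D.a (p N) (Finsupp.single a 1)) := by
    have := mul_neg_of_pos_of_neg n6 n4; linarith
  have m5 := mul_lt_mul'' m1 m2 m3.le m4.le
  have m6 : -(x (p N) * D.a a (Finsupp.single (p N) 1)) *
      -(d (p N) * D.a (p N) (Finsupp.single a 1)) = x (p N) * d (p N) := by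
    linear_combination (x (p N) * d (p N)) * n7
  linarith

/-- The cycle formed by the arc and its image under `g` is the whole graph. -/
lemma exists_eq (h : IsArc Γ g N p) (D : OrthogonalRoots Γ G) (hΓ : Γ.Connected) (hg : g ∈ G)
    (hl : ∀ s w, Γ.Adj s w → D.a s (Finsupp.single w 1) * D.a w (Finsupp.single s 1) = 1) (v : S) :
    ∃ i ≤ N, v = p i ∨ v = g (p i) := by
  classical
  have h2 := h.two_le
  refine hΓ.mem_of_closed (A := {v | ∃ i ≤ N, v = p i ∨ v = g (p i)})
    ⟨0, Nat.zero_le _, Or.inl rfl⟩ ?_ v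
  rintro u ⟨i, hi, hu⟩ v huv
  by_contra hv
  have hv : ∀ i ≤ N, v ≠ p i ∧ v ≠ g (p i) := fun i hi =>
    ⟨fun e => hv ⟨i, hi, Or.inl e⟩, fun e => hv ⟨i, hi, Or.inr e⟩⟩
  have hgv : g v = v := by
    by_cases hiN : i < N
    · refine h.fixed_of_adj_half D hg (mem_half.2 ⟨i, hiN, hu⟩) ?_ (hv N le_rfl).1 huv
      rw [mem_half]
      rintro ⟨j, hj, e | e⟩
      · exact (hv j hj.le).1 e
      · exact (hv j hj.le).2 e
    · refine h.reverse.fixed_of_adj_half D hg (mem_reverse_half.2 ⟨i, by omega, hi, hu⟩) ?_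
        (by simpa using (hv 0 (by omega)).1) huv
      rw [mem_reverse_half]
      rintro ⟨j, -, hj, e | e⟩
      · exact (hv j hj).1 e
      · exact (hv j hj).2 e
  have hadj : Γ.Adj (p i) v := by
    rcases hu with rfl | rfl
    · exact huv
    · rwa [← hgv, D.adj_perm hg] at huv
  rcases Nat.eq_zero_or_pos i with rfl | hi0
  · refine h.reverse.not_adj_end D hg hl hgv (fun j _ => hv (N - j) (by omega)) ?_
    simpa using hadj
  rcases eq_or_lt_of_le hi with rfl | hi
  · exact h.not_adj_end D hg hl hgv hv hadj
  · exact h.not_adj_interior D hg hl hgv hv hi0 hi hadj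

end IsArc

/-- If the Coxeter graph has a cycle, then it is a cycle of even length. -/
lemma exists_iso_cycleGraph (D : OrthogonalRoots Γ G) (hΓ : Γ.Connected) (hg : g ∈ G) (hg1 : g ≠ 1)
    (hcyc : ¬Γ.IsAcyclic) :
    ∃ m, 1 ≤ m ∧ Nonempty (SimpleGraph.cycleGraph (2 * m + 1 + 1) ≃g Γ) := by
  classical
  obtain ⟨N, p, h⟩ := D.exists_arc hΓ hg hg1 hcyc
  have hall := h.exists_eq D hΓ hg fun s w => D.mul_eq_one hΓ hg hg1
  obtain ⟨m, rfl⟩ : ∃ m, N = m + 1 := ⟨N - 1, by have := h.two_le; omega⟩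
  have h2 := h.two_le
  let f : Fin (2 * m + 1 + 1) → S := fun i =>
    if (i : ℕ) ≤ m + 1 then p i else g (p (2 * m + 2 - i))
  have hf : Function.Bijective f := by
    constructor
    · intro i j e
      have hi := i.isLt
      have hj := j.isLt
      dsimp only [f] at e
      split_ifs at e with h1 h3 h3
      · exact Fin.ext (h.inj _ h1 _ h3 e)
      · exact absurd e.symm (h.perm_ne D hg (by omega) (by omega) h1)
      · exact absurd e (h.perm_ne D hg (by omega) (by omega) h3)
      · have := h.inj _ (by omega) _ (by omega) (g.injective e)
        exact Fin.ext (by omega)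
    · intro v
      obtain ⟨i, hi, rfl | rfl⟩ := hall v
      · exact ⟨⟨i, by omega⟩, by simp [f, hi]⟩
      · rcases Nat.eq_zero_or_pos i with rfl | hi0
        · exact ⟨⟨0, by omega⟩, by simp [f, h.fixed_zero]⟩
        rcases eq_or_lt_of_le hi with rfl | hi
        · exact ⟨⟨m + 1, by omega⟩, by simp [f, h.fixed_last]⟩
        · refine ⟨⟨2 * m + 2 - i, by omega⟩, ?_⟩
          simp only [f]
          rw [if_neg (by omega), show 2 * m + 2 - (2 * m + 2 - i) = i by omega]
  refine ⟨m, by omega, ⟨⟨Equiv.ofBijective f hf, ?_⟩⟩⟩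
  intro i j
  have hi := i.isLt
  have hj := j.isLt
  have hsub : ∀ i j : Fin (2 * m + 1 + 1), ((i - j : Fin (2 * m + 1 + 1)) : ℕ) =
      if (j : ℕ) ≤ i then (i : ℕ) - j else 2 * m + 1 + 1 + i - j := by
    intro i j
    split_ifs with h1
    · exact Fin.coe_sub_iff_le.2 h1
    · exact Fin.coe_sub_iff_lt.2 (not_le.1 h1)
  rw [SimpleGraph.cycleGraph_adj', hsub, hsub]
  simp only [Equiv.ofBijective_apply, f]
  split_ifs with h1 h3 <;>
  first
  | (rw [h.adj_iff _ (by omega) _ (by omega)]; omega)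
  | (rw [h.adj_perm_iff D hg (by omega) (by omega)]; omega)
  | (rw [Γ.adj_comm, h.adj_perm_iff D hg (by omega) (by omega)]; omega)
  | (rw [D.adj_perm hg, h.adj_iff _ (by omega) _ (by omega)]; omega)

end OrthogonalRoots
end

/-! ### Rooted trees and their integral roots -/

noncomputable section

variable {S : Type*}

/-- The tree `Γ` with root `c`: the parent `P v` of a vertex `v` (the root is its own parent) and
the depth `ℓ v`. -/
structure IsRooted (Γ : SimpleGraph S) (c : S) (P : S → S) (ℓ : S → ℕ) : Prop where
  P_root : P c = c
  ℓ_root : ℓ c = 0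
  ℓ_P : ∀ v, v ≠ c → ℓ (P v) + 1 = ℓ v
  adj_iff : ∀ u v, Γ.Adj u v ↔ u ≠ v ∧ (P u = v ∨ P v = u)

lemma SimpleGraph.IsTree.exists_isRooted {Γ : SimpleGraph S} (hΓ : Γ.IsTree) (c : S) :
    ∃ P ℓ, IsRooted Γ c P ℓ := by
  choose Q hQ _ using hΓ.existsUnique_path c
  have hac := hΓ.isAcyclic
  have hc : Q c = SimpleGraph.Walk.nil := (SimpleGraph.Walk.isPath_iff_nil.1 (hQ c)).eq_nil
  have hconcat : ∀ {u v : S} (h : Γ.Adj u v), u ∈ (Q v).support →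
      (Q v).penultimate = u ∧ (Q u).length + 1 = (Q v).length := by
    intro u v h hu
    have := hac.path_concat (hQ u) (hQ v) h hu
    rw [this]
    simp
  have hadj : ∀ v, v ≠ c → Γ.Adj (Q v).penultimate v := fun v hv =>
    (Q v).adj_penultimate (SimpleGraph.Walk.not_nil_of_ne hv.symm)
  refine ⟨fun v => (Q v).penultimate, fun v => (Q v).length, by rw [hc]; rfl, by rw [hc]; rfl,
    fun v hv => (hconcat (hadj v hv) ((Q v).getVert_mem_support _)).2, fun u v => ⟨fun h => ⟨h.ne, ?_⟩, ?_⟩⟩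
  · by_cases hu : u ∈ (Q v).support
    · exact Or.inr (hconcat h hu).1
    · have hv := hac.mem_support_of_ne_mem_support_of_adj_of_isPath (hQ u) (hQ v) h hu
      exact Or.inl (hconcat h.symm hv).1
  · rintro ⟨hne, rfl | rfl⟩
    · refine (hadj u ?_).symm
      rintro rfl
      rw [hc] at hne
      exact hne rfl
    · refine hadj v ?_
      rintro rfl
      rw [hc] at hne
      exact hne rfl

namespace IsRooted

variable {Γ : SimpleGraph S} {c : S} {P : S → S} {ℓ : S → ℕ}

lemma adj_P (h : IsRooted Γ c P ℓ) {v : S} (hv : v ≠ c) : Γ.Adj (P v) v := by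
  rw [h.adj_iff]
  refine ⟨fun e => ?_, Or.inr rfl⟩
  have := h.ℓ_P v hv
  rw [e] at this
  omega

lemma P_ne (h : IsRooted Γ c P ℓ) {v : S} (hv : v ≠ c) : P v ≠ v := (h.adj_P hv).ne

lemma ℓ_eq_zero (h : IsRooted Γ c P ℓ) {v : S} : ℓ v = 0 ↔ v = c := by
  refine ⟨fun h0 => ?_, fun e => e ▸ h.ℓ_root⟩
  by_contra hv
  have := h.ℓ_P v hv
  omega

/-- Induction from the root of a tree. -/
lemma induction (h : IsRooted Γ c P ℓ) {Q : S → Prop} (base : Q c)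
    (step : ∀ v, v ≠ c → Q (P v) → Q v) (v : S) : Q v := by
  have key : ∀ n v, ℓ v = n → Q v := by
    intro n
    induction n with
    | zero => intro v hv; rw [h.ℓ_eq_zero.1 hv]; exact base
    | succ n ih =>
      intro v hv
      have hvc : v ≠ c := by rintro rfl; rw [h.ℓ_root] at hv; omega
      exact step v hvc (ih _ (by have := h.ℓ_P v hvc; omega))
  exact key _ v rfl

lemma P_ℓ_perm (h : IsRooted Γ c P ℓ) {g : Equiv.Perm S} (hc : g c = c)
    (hg : ∀ s t, Γ.Adj (g s) (g t) ↔ Γ.Adj s t) (v : S) : P (g v) = g (P v) ∧ ℓ (g v) = ℓ v := by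
  refine h.induction (Q := fun v => P (g v) = g (P v) ∧ ℓ (g v) = ℓ v) ?_ (fun v hv ih => ?_) v
  · rw [hc, h.P_root, hc]; exact ⟨rfl, rfl⟩
  · have hgv : g v ≠ c := fun e => hv (g.injective (by rw [e, hc]))
    have hP : P (g v) = g (P v) := by
      rcases ((h.adj_iff _ _).1 ((hg _ _).2 (h.adj_P hv))).2 with e | e
      · exfalso
        rw [ih.1] at e
        have e := g.injective e
        by_cases hPv : P v = c
        · rw [hPv, h.P_root] at e
          exact hv e.symm
        · have h1 := h.ℓ_P v hv
          have h2 := h.ℓ_P _ hPv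
          rw [e] at h2
          omega
      · exact e
    refine ⟨hP, ?_⟩
    have h1 := h.ℓ_P _ hgv
    have h2 := h.ℓ_P _ hv
    rw [hP, ih.2] at h1
    omega

end IsRooted

open Classical in
/-- The entries of the Gram matrix of the simple roots of a simply laced tree with parent map
`P`. -/
def gram (P : S → S) (s t : S) : ℤ := if s = t then 2 else if P s = t ∨ P t = s then -1 else 0

/-- The bilinear form of a simply laced tree, in the basis of the simple roots. -/
def bform (P : S → S) : (S →₀ ℤ) →ₗ[ℤ] (S →₀ ℤ) →ₗ[ℤ] ℤ :=
  Finsupp.linearCombination ℤ fun s => Finsupp.linearCombination ℤ (gram P s)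

@[simp] lemma bform_single (P : S → S) (s t : S) :
    bform P (Finsupp.single s 1) (Finsupp.single t 1) = gram P s t := by
  simp [bform]

lemma gram_comm (P : S → S) (s t : S) : gram P s t = gram P t s := by
  classical
  unfold gram
  exact if_congr eq_comm rfl (if_congr or_comm rfl rfl)

lemma bform_comm (P : S → S) (x y : S →₀ ℤ) : bform P x y = bform P y x := by
  have h : bform P = (bform P).flip := by
    apply Finsupp.lhom_ext'
    intro s
    ext t
    simp [gram_comm P s t]
  conv_lhs => rw [h]
  rfl

/-- The action of a permutation of `S` on `S →₀ ℤ`. -/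
abbrev permZ (g : Equiv.Perm S) : (S →₀ ℤ) →ₗ[ℤ] (S →₀ ℤ) := Finsupp.lmapDomain ℤ ℤ g

lemma permZ_single (g : Equiv.Perm S) (s : S) (n : ℤ) :
    permZ g (Finsupp.single s n) = Finsupp.single (g s) n := by simp

/-- A set `R` of roots for the simply laced tree `Γ` with root `c`, in the basis of the simple
roots, that is closed under the simple reflections, together with a symmetry `g` of `Γ` that fixes
`c` and maps every root either to itself or to an orthogonal root. -/
structure TreeRoots (Γ : SimpleGraph S) (g : Equiv.Perm S) (c : S) where
  P : S → S
  ℓ : S → ℕ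
  R : (S →₀ ℤ) → Prop
  rooted : IsRooted Γ c P ℓ
  g_c : g c = c
  P_perm : ∀ v, P (g v) = g (P v)
  ℓ_perm : ∀ v, ℓ (g v) = ℓ v
  R_single : ∀ s, R (Finsupp.single s 1)
  R_reflect : ∀ x y, R x → R y → R (x - bform P x y • y)
  R_self : ∀ x, R x → bform P x x = 2
  R_orth : ∀ x, R x → permZ g x = x ∨ bform P x (permZ g x) = 0

namespace OrthogonalRoots

variable {Γ : SimpleGraph S} {G : Subgroup (Equiv.Perm S)} {D : OrthogonalRoots Γ G}
  {g : Equiv.Perm S}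

/-- In a simply laced tree the simple roots can be rescaled, starting from a fixed vertex `c`, so
that they all have the same length. The scaling factor of a vertex is the product of the entries of
the Cartan matrix along the path that joins it to `c`, up to sign. -/
lemma exists_scaling (D : OrthogonalRoots Γ G) (hg : g ∈ G)
    (hl : ∀ s w, Γ.Adj s w → D.a s (Finsupp.single w 1) * D.a w (Finsupp.single s 1) = 1)
    {c : S} {P : S → S} {ℓ : S → ℕ} (h : IsRooted Γ c P ℓ) (hc : g c = c) :
    ∃ L : S → ℝ, (∀ s, L s ≠ 0) ∧ (∀ s, L (g s) = L s) ∧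
      ∀ s t, (L s)⁻¹ * L t * D.a s (Finsupp.single t 1) = gram P s t := by
  have hperm := h.P_ℓ_perm hc (D.adj_perm hg)
  have hiter : ∀ i v, P^[i] (g v) = g (P^[i] v) := by
    intro i v
    induction i with
    | zero => rfl
    | succ i ih => rw [Function.iterate_succ_apply', ih, (hperm _).1, Function.iterate_succ_apply']
  let L : S → ℝ := fun v => ∏ i ∈ Finset.range (ℓ v),
    -(D.a (P^[i] v) (Finsupp.single (P^[i + 1] v) 1))
  have hLP : ∀ v, v ≠ c → L v = -L (P v) * D.a v (Finsupp.single (P v) 1) := by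
    intro v hv
    simp only [L, ← h.ℓ_P v hv, Finset.prod_range_succ', Function.iterate_succ_apply,
      Function.iterate_zero, id]
    ring
  have hL0 : ∀ v, L v ≠ 0 := by
    refine h.induction ?_ fun v hv ih => ?_
    · simp [L, h.ℓ_root]
    · rw [hLP v hv]
      exact mul_ne_zero (neg_ne_zero.2 ih) (D.a_neg (h.adj_P hv).symm).ne
  refine ⟨L, hL0, fun s => ?_, fun s t => ?_⟩
  · simp only [L, (hperm s).2, hiter, D.a_perm_single hg]
  · have hedge : ∀ v, v ≠ c → (L v)⁻¹ * L (P v) * D.a v (Finsupp.single (P v) 1) = -1 ∧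
        (L (P v))⁻¹ * L v * D.a (P v) (Finsupp.single v 1) = -1 := by
      intro v hv
      have h1 := hl _ _ (h.adj_P hv)
      have h2 := hL0 (P v)
      have h3 := hL0 v
      constructor
      · field_simp
        rw [hLP v hv]; ring
      · field_simp
        rw [hLP v hv]
        linear_combination (-L (P v)) * h1
    have hroot : ∀ u v, u ≠ v → P u = v → u ≠ c := by
      rintro u v huv rfl rfl
      exact huv h.P_root.symm
    unfold gram
    split_ifs with h1 h2
    · subst h1
      rw [inv_mul_cancel₀ (hL0 s), D.a_self]; norm_num
    · rcases h2 with h2 | h2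
      · have := (hedge s (hroot s t h1 h2)).1
        rw [h2] at this
        rw [this]; norm_num
      · have := (hedge t (hroot t s (Ne.symm h1) h2)).2
        rw [h2] at this
        rw [this]; norm_num
    · rw [D.a_eq_zero h1, mul_zero, Int.cast_zero]
      rw [h.adj_iff]
      tauto

/-- The integral roots of a simply laced tree. -/
lemma nonempty_treeRoots (D : OrthogonalRoots Γ G) (hΓ : Γ.IsTree) (hg : g ∈ G)
    (hl : ∀ s w, Γ.Adj s w → D.a s (Finsupp.single w 1) * D.a w (Finsupp.single s 1) = 1)
    {c : S} (hc : g c = c) : Nonempty (TreeRoots Γ g c) := by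
  obtain ⟨P, ℓ, h⟩ := hΓ.exists_isRooted c
  obtain ⟨L, hL0, hLg, hL⟩ := D.exists_scaling hg hl h hc
  have hperm := h.P_ℓ_perm hc (D.adj_perm hg)
  let V : (S →₀ ℤ) →ₗ[ℤ] (S →₀ ℝ) := Finsupp.linearCombination ℤ fun s => Finsupp.single s (L s)
  let W : (S →₀ ℤ) →ₗ[ℤ] Module.Dual ℝ (S →₀ ℝ) :=
    Finsupp.linearCombination ℤ fun s => (L s)⁻¹ • D.a s
  have hV1 : ∀ s, V (Finsupp.single s 1) = L s • Finsupp.single s (1 : ℝ) := fun s => by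
    simp [V]
  have hW1 : ∀ s, W (Finsupp.single s 1) = (L s)⁻¹ • D.a s := fun s => by simp [W]
  have hWV : ∀ x y, W x (V y) = (bform P x y : ℝ) := by
    intro x y
    induction x using Finsupp.induction_linear with
    | zero => simp
    | add x x' hx hx' => rw [map_add, LinearMap.add_apply, hx, hx', map_add, LinearMap.add_apply]; push_cast; rfl
    | single s m =>
      induction y using Finsupp.induction_linear with
      | zero => simp
      | add y y' hy hy' => rw [map_add, map_add, hy, hy', map_add]; push_cast; rfl
      | single t n =>
        have e1 : Finsupp.single s m = m • Finsupp.single s (1 : ℤ) := by simp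
        have e2 : Finsupp.single t n = n • Finsupp.single t (1 : ℤ) := by simp
        rw [e1, e2]
        simp only [map_smul, map_zsmul, LinearMap.smul_apply, bform_single, hV1, hW1, smul_eq_mul, zsmul_eq_mul]
        push_cast
        rw [← hL s t]
        ring
  have hVg : ∀ x, V (permZ g x) = permV g (V x) := by
    intro x
    induction x using Finsupp.induction_linear with
    | zero => simp
    | add x x' hx hx' => rw [map_add, map_add, map_add, map_add, hx, hx']
    | single s m =>
      rw [permZ_single]
      simp only [V, Finsupp.linearCombination_single, map_zsmul, permV_single, hLg]
  have hVinj : Function.Injective V := by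
    intro x y e
    ext s
    have hs : ∀ z, V z s = z s * L s := by
      intro z
      induction z using Finsupp.induction_linear with
      | zero => simp
      | add x x' hx hx' => rw [map_add, Finsupp.add_apply, Finsupp.add_apply, hx, hx']; push_cast; ring
      | single t m =>
        simp only [V, Finsupp.linearCombination_single, Finsupp.smul_apply, zsmul_eq_mul]
        by_cases hts : t = s
        · subst hts; simp
        · simp [hts]
    have h1 := congrArg (fun f => f s) e
    simp only [hs] at h1
    exact_mod_cast mul_right_cancel₀ (hL0 s) h1
  refine ⟨⟨P, ℓ, fun x => D.IsPair (V x) (W x), h, hc, fun v => (hperm v).1, fun v => (hperm v).2,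
    fun s => ?_, fun x y hx hy => ?_, fun x hx => ?_, fun x hx => ?_⟩⟩
  · rw [hV1, hW1]
    exact D.smul (D.isPair_simple s) (hL0 s)
  · have := D.reflect hx hy
    rw [hWV, hWV, bform_comm P y x] at this
    convert this using 1
    · rw [map_sub, map_zsmul, Int.cast_smul_eq_zsmul]
    · rw [map_sub, map_zsmul]
      congr 1
      ext z
      simp
  · have := D.apply_self hx
    rw [hWV] at this
    exact_mod_cast this
  · refine (D.orth hx hg).imp (fun e => hVinj ?_) fun e => ?_
    · rw [hVg, e]
    · rw [← hVg, hWV] at e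
      exact_mod_cast e

end OrthogonalRoots
end

/-! ### Lower sets of vertices and configurations of roots -/

noncomputable section

variable {S : Type*}

lemma gram_P {P : S → S} {s t : S} (h : P s = t) (hst : s ≠ t) : gram P s t = -1 := by
  unfold gram
  rw [if_neg hst, if_pos (Or.inl h)]

lemma gram_eq_zero {P : S → S} {s t : S} (hst : s ≠ t) (h : P s ≠ t) (h' : P t ≠ s) :
    gram P s t = 0 := by
  unfold gram
  rw [if_neg hst, if_neg (by tauto)]

/-- The sum of the simple roots in `T`. -/
def ind (T : Finset S) : S →₀ ℤ := ∑ s ∈ T, Finsupp.single s 1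

namespace TreeRoots

variable {Γ : SimpleGraph S} {g : Equiv.Perm S} {c : S} (E : TreeRoots Γ g c)

/-- `T` is the vertex set of a finite subtree that contains the root. -/
def IsLower (T : Finset S) : Prop := c ∈ T ∧ ∀ s ∈ T, E.P s ∈ T

variable {E} {T : Finset S}

lemma bform_ind (hT : E.IsLower T) {v : S} (hv : v ∉ T) [Decidable (E.P v ∈ T)] :
    bform E.P (ind T) (Finsupp.single v 1) = if E.P v ∈ T then -1 else 0 := by
  classical
  have h1 : bform E.P (ind T) (Finsupp.single v 1) =
      ∑ s ∈ T, if E.P v = s then (-1 : ℤ) else 0 := by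
    rw [ind, map_sum, LinearMap.sum_apply]
    refine Finset.sum_congr rfl fun s hs => ?_
    have hsv : s ≠ v := ne_of_mem_of_not_mem hs hv
    rw [bform_single]
    split_ifs with h
    · rw [gram_comm, gram_P h hsv.symm]
    · exact gram_eq_zero hsv (fun e => hv (e ▸ hT.2 s hs)) h
  rw [h1, Finset.sum_ite_eq]
  congr

/-- The sum of the simple roots of a subtree is a root. -/
lemma R_ind (hT : E.IsLower T) : E.R (ind T) := by
  classical
  have key : ∀ n, ∀ T : Finset S, T.card = n → E.IsLower T → E.R (ind T) := by
    intro n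
    induction n with
    | zero => intro T hn hT; rw [Finset.card_eq_zero.1 hn] at hT; exact absurd hT.1 (by simp)
    | succ n ih =>
      intro T hn hT
      obtain ⟨v, hv, hmax⟩ := T.exists_max_image E.ℓ ⟨c, hT.1⟩
      by_cases hvc : v = c
      · have : T = {c} := by
          refine Finset.eq_singleton_iff_unique_mem.2 ⟨hT.1, fun s hs => ?_⟩
          have := hmax s hs
          rw [hvc, E.rooted.ℓ_root] at this
          exact E.rooted.ℓ_eq_zero.1 (by omega)
        rw [this, ind, Finset.sum_singleton]
        exact E.R_single c
      · have hlow : E.IsLower (T.erase v) := by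
          refine ⟨Finset.mem_erase.2 ⟨Ne.symm hvc, hT.1⟩, fun s hs => ?_⟩
          obtain ⟨hsv, hs⟩ := Finset.mem_erase.1 hs
          refine Finset.mem_erase.2 ⟨fun e => ?_, hT.2 s hs⟩
          by_cases hsc : s = c
          · rw [hsc, E.rooted.P_root] at e; exact hvc e.symm
          · have h1 := hmax s hs
            have h2 := E.rooted.ℓ_P s hsc
            rw [e] at h2
            omega
        have hr := E.R_reflect _ _ (ih (T.erase v) (by rw [Finset.card_erase_of_mem hv, hn]; rfl)
          hlow) (E.R_single v)
        rw [bform_ind hlow (Finset.notMem_erase v T),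
          if_pos (Finset.mem_erase.2 ⟨E.rooted.P_ne hvc, hT.2 v hv⟩), neg_one_smul,
          sub_neg_eq_add] at hr
        have : ind T = ind (T.erase v) + Finsupp.single v 1 := (Finset.sum_erase_add T _ hv).symm
        rwa [this]
  exact key _ T rfl hT

lemma permZ_ind (hg : ∀ s ∈ T, g s ∈ T) : permZ g (ind T) = ind T := by
  classical
  have himg : T.image g = T := Finset.eq_of_subset_of_card_le
    (Finset.image_subset_iff.2 hg) (by rw [Finset.card_image_of_injective _ g.injective])
  rw [ind, map_sum]
  simp only [permZ_single]
  conv_rhs => rw [← himg, Finset.sum_image (fun _ _ _ _ h => g.injective h)]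

lemma perm_notMem (hg : ∀ s ∈ T, g s ∈ T) {v : S} (hv : v ∉ T) : g v ∉ T := by
  classical
  have himg : T.image g = T := Finset.eq_of_subset_of_card_le
    (Finset.image_subset_iff.2 hg) (by rw [Finset.card_image_of_injective _ g.injective])
  intro h
  rw [← himg] at h
  obtain ⟨s, hs, e⟩ := Finset.mem_image.1 h
  exact hv (g.injective e ▸ hs)

/-- The moved neighbours of a `g`-stable subtree `T` form (part of) a single orbit. Otherwise two of
them, `v` and `w`, would give the root `∑_{s ∈ T} α_s + α_v + α_w`, which is neither equal nor
orthogonal to its image. -/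
lemma eq_or_eq_of_moved (hT : E.IsLower T) (hgT : ∀ s ∈ T, g s ∈ T) {v w : S} (hv : v ∉ T)
    (hw : w ∉ T) (hPv : E.P v ∈ T) (hPw : E.P w ∈ T) (hgv : g v ≠ v) (hgw : g w ≠ w) :
    w = v ∨ w = g v ∨ v = g w := by
  classical
  by_contra! hcon
  obtain ⟨h1, h2, h3⟩ := hcon
  have hgv' := perm_notMem hgT hv
  have hgw' := perm_notMem hgT hw
  have hPgv : E.P (g v) ∈ T := by rw [E.P_perm]; exact hgT _ hPv
  have hPgw : E.P (g w) ∈ T := by rw [E.P_perm]; exact hgT _ hPw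
  have b0 : ∀ {x y : S}, x ∉ T → y ∉ T → E.P x ∈ T → E.P y ∈ T → x ≠ y → gram E.P x y = 0 :=
    fun hx hy hPx hPy hxy => gram_eq_zero hxy (ne_of_mem_of_not_mem hPx hy)
      (ne_of_mem_of_not_mem hPy hx)
  have b1 : ∀ {x : S}, x ∉ T → E.P x ∈ T → bform E.P (ind T) (Finsupp.single x 1) = -1 :=
    fun hx hPx => by rw [bform_ind hT hx, if_pos hPx]
  have bT := E.R_self _ (R_ind hT)
  have r1 := E.R_reflect _ _ (R_ind hT) (E.R_single v)
  rw [b1 hv hPv, neg_one_smul, sub_neg_eq_add] at r1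
  have r2 := E.R_reflect _ _ r1 (E.R_single w)
  rw [map_add, LinearMap.add_apply, b1 hw hPw, bform_single, b0 hv hw hPv hPw h1.symm, add_zero,
    neg_one_smul, sub_neg_eq_add] at r2
  have hval : bform E.P (ind T + Finsupp.single v 1 + Finsupp.single w 1)
      (permZ g (ind T + Finsupp.single v 1 + Finsupp.single w 1)) = -2 := by
    rw [map_add (permZ g), map_add (permZ g), permZ_ind hgT, permZ_single, permZ_single]
    simp only [map_add, LinearMap.add_apply, bform_single, bT, b1 hgv' hPgv, b1 hgw' hPgw,
      b0 hv hgv' hPv hPgv hgv.symm, b0 hv hgw' hPv hPgw h3, b0 hw hgv' hPw hPgv h2,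
      b0 hw hgw' hPw hPgw hgw.symm, bform_comm E.P (Finsupp.single v 1) (ind T),
      bform_comm E.P (Finsupp.single w 1) (ind T), b1 hv hPv, b1 hw hPw]
    norm_num
  rcases E.R_orth _ r2 with h | h
  · rw [h, E.R_self _ r2] at hval
    norm_num at hval
  · rw [h] at hval
    norm_num at hval

section Configuration

/-- The entries of the Gram matrix of the tree on `Fin n` with parent map `par`. -/
def treeGram {n : ℕ} (par : Fin n → Fin n) (i j : Fin n) : ℤ :=
  if i = j then 2 else if par i = j ∨ par j = i then -1 else 0

/-- Starting from the vector `x`, the entries `i` and values `v` in the list describe successive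
simple reflections, each of which changes the coordinate `i` to `v`. The function checks this and
that the final root is neither fixed by the automorphism `π` of the tree nor orthogonal to its
image. -/
def refutes {n : ℕ} (par π : Fin n → Fin n) : (Fin n → ℤ) → List (Fin n × ℤ) → Bool
  | x, [] => let v := ∑ i, ∑ j, x i * x j * treeGram par i (π j)
    decide (v ≠ 0 ∧ v ≠ 2)
  | x, (i, v) :: l => decide (v = x i - ∑ j, x j * treeGram par j i) &&
    refutes par π (Function.update x i v) l

lemma not_refutes {n : ℕ} {par π : Fin n → Fin n} {y : Fin n → S →₀ ℤ} (hR : ∀ i, E.R (y i))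
    (hy : ∀ i j, bform E.P (y i) (y j) = treeGram par i j) (hπ : ∀ i, permZ g (y i) = y (π i))
    (l : List (Fin n × ℤ)) (x : Fin n → ℤ) (hx : E.R (∑ i, x i • y i)) :
    refutes par π x l = false := by
  induction l generalizing x with
  | nil =>
    have hval : bform E.P (∑ i, x i • y i) (permZ g (∑ i, x i • y i)) =
        ∑ i, ∑ j, x i * x j * treeGram par i (π j) := by
      simp only [map_sum, LinearMap.sum_apply, map_smul, LinearMap.smul_apply, hπ, hy, smul_eq_mul,
        Finset.mul_sum]
      rw [Finset.sum_comm]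
      exact Finset.sum_congr rfl fun i _ => Finset.sum_congr rfl fun j _ => by ring
    simp only [refutes, decide_eq_false_iff_not, not_and_or, not_not]
    rw [← hval]
    rcases E.R_orth _ hx with h | h
    · right; rw [h, E.R_self _ hx]
    · exact Or.inl h
  | cons a l ih =>
    obtain ⟨i, v⟩ := a
    rw [refutes]
    by_cases hv : v = x i - ∑ j, x j * treeGram par j i
    · rw [ih, Bool.and_false]
      have h1 := E.R_reflect _ _ hx (hR i)
      have h2 : bform E.P (∑ j, x j • y j) (y i) = ∑ j, x j * treeGram par j i := by
        simp only [map_sum, LinearMap.sum_apply, map_smul, LinearMap.smul_apply, hy, smul_eq_mul]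
      rw [h2] at h1
      convert h1 using 1
      have h3 : Function.update x i v = fun j => x j + if j = i then v - x i else 0 := by
        funext j
        by_cases hj : j = i
        · subst hj; simp
        · simp [hj]
      simp only [h3, add_smul, Finset.sum_add_distrib, ite_smul, zero_smul,
        Finset.sum_ite_eq', Finset.mem_univ, if_true]
      rw [hv, sub_sub_cancel_left, neg_smul, ← sub_eq_add_neg]
    · rw [decide_eq_false hv, Bool.false_and]

/-- A configuration of vertices that contains a root neither fixed by `g` nor orthogonal to its
image does not occur. The `g`-stable subtree `T`, or rather the root `∑_{s ∈ T} α_s`, plays the role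
of the vertex `0` of a tree on `Fin (n + 1)`, and the vertices `ι i` are attached to it as prescribed
by the parent map `par`; `g` acts on this tree by `π`. The list `l` leads from the simple root `i₀`
to the offending root. -/
lemma false_of_configuration (hT : E.IsLower T) (hgT : ∀ s ∈ T, g s ∈ T) {n : ℕ}
    (par π : Fin (n + 1) → Fin (n + 1)) (ι : Fin n → S) (i₀ : Fin (n + 1))
    (l : List (Fin (n + 1) × ℤ)) (hι : ∀ i, ι i ∉ T)
    (hP : ∀ i, (par i.succ = 0 ∧ E.P (ι i) ∈ T) ∨ ∃ j, par i.succ = Fin.succ j ∧ E.P (ι i) = ι j)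
    (hsib : ∀ i j, i < j → par i.succ = par j.succ → ι i ≠ ι j)
    (hπ : ∀ i, ∃ j, π i.succ = Fin.succ j ∧ g (ι i) = ι j)
    (hl : refutes par π (Pi.single i₀ 1) l = true) (hpar : par 0 = 0 := by rfl)
    (hπ0 : π 0 = 0 := by rfl) : False := by
  classical
  have hne : ∀ i, ι i ≠ c := fun i e => hι i (e ▸ hT.1)
  have hinj : ∀ N i j, E.ℓ (ι i) = N → ι i = ι j → i = j := by
    intro N
    induction N with
    | zero => intro i j h0; exact absurd (E.rooted.ℓ_eq_zero.1 h0) (hne i)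
    | succ N ih =>
      intro i j hN e
      have hpp : par i.succ = par j.succ := by
        rcases hP i with ⟨hi, hi'⟩ | ⟨k, hk, hk'⟩ <;> rcases hP j with ⟨hj, hj'⟩ | ⟨m, hm, hm'⟩
        · rw [hi, hj]
        · rw [e, hm'] at hi'; exact absurd hi' (hι m)
        · rw [← e, hk'] at hj'; exact absurd hj' (hι k)
        · rw [hk, hm]
          congr 1
          refine ih k m ?_ (by rw [← hk', ← hm', e])
          have := E.rooted.ℓ_P _ (hne i)
          rw [← hk']; omega
      by_contra hij
      rcases lt_or_gt_of_ne hij with h | h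
      · exact hsib i j h hpp e
      · exact hsib j i h hpp.symm e.symm
  have hinj' : ∀ {i j}, ι i = ι j → i = j := fun e => hinj _ _ _ rfl e
  let y : Fin (n + 1) → S →₀ ℤ := Fin.cons (ind T) fun i => Finsupp.single (ι i) 1
  have hR : ∀ i, E.R (y i) := by
    refine Fin.cases (R_ind hT) fun i => ?_
    simpa [y] using E.R_single (ι i)
  have hpar_iff : ∀ i j, par i.succ = Fin.succ j ↔ E.P (ι i) = ι j := by
    intro i j
    rcases hP i with ⟨hi, hi'⟩ | ⟨k, hk, hk'⟩
    · rw [hi]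
      exact iff_of_false (Fin.succ_ne_zero j).symm fun e => hι j (e ▸ hi')
    · rw [hk, hk', Fin.succ_inj]
      exact ⟨fun e => e ▸ rfl, fun e => hinj' e⟩
  have hpar_zero : ∀ i, par i.succ = 0 ↔ E.P (ι i) ∈ T := by
    intro i
    rcases hP i with ⟨hi, hi'⟩ | ⟨k, hk, hk'⟩
    · exact iff_of_true hi hi'
    · rw [hk, hk']
      exact iff_of_false (Fin.succ_ne_zero k) (hι k)
  have h0 : ∀ i, bform E.P (ind T) (Finsupp.single (ι i) 1) = treeGram par 0 i.succ := by
    intro i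
    rw [bform_ind hT (hι i), treeGram, if_neg (Fin.succ_ne_zero i).symm, hpar]
    simp only [(Fin.succ_ne_zero i).symm, false_or, hpar_zero]
  have hcomm : ∀ i j, treeGram par i j = treeGram par j i := by
    intro i j
    simp only [treeGram, eq_comm (a := i) (b := j), or_comm (a := par i = j)]
  have hy : ∀ i j, bform E.P (y i) (y j) = treeGram par i j := by
    intro i j
    refine Fin.cases ?_ (fun i => ?_) i <;> refine Fin.cases ?_ (fun j => ?_) j
    · simpa [y, treeGram] using E.R_self _ (R_ind hT)
    · simpa [y] using h0 j
    · rw [bform_comm, hcomm]; simpa [y] using h0 i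
    · simp only [y, Fin.cons_succ, bform_single, gram, treeGram, Fin.succ_inj, hpar_iff]
      by_cases hij : i = j
      · subst hij; simp
      · rw [if_neg hij, if_neg fun e => hij (hinj' e)]
  have hπ' : ∀ i, permZ g (y i) = y (π i) := by
    refine Fin.cases ?_ fun i => ?_
    · rw [hπ0]; exact permZ_ind hgT
    · obtain ⟨j, hj, hj'⟩ := hπ i
      rw [hj]
      simp only [y, Fin.cons_succ, permZ_single, hj']
  have := not_refutes hR hy hπ' l (Pi.single i₀ 1) (by
    simpa [Pi.single_apply, ite_smul] using hR i₀)
  rw [this] at hl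
  exact Bool.false_ne_true hl

end Configuration

end TreeRoots

end

/-! ### Branches of moved vertices -/

noncomputable section

variable {S : Type*}

lemma SimpleGraph.fromRel_adj_iff_of_parent {I : Type*} {r : I → I → Prop} {par : I → I}
    (h : ∀ i j, i ≠ j → (r i j ∨ r j i ↔ par i = j ∨ par j = i)) (i j : I) :
    (SimpleGraph.fromRel r).Adj i j ↔ i ≠ j ∧ (par i = j ∨ par j = i) := by
  rw [SimpleGraph.fromRel_adj]
  exact and_congr_right (h i j)

namespace TreeRoots

variable {Γ : SimpleGraph S} {g : Equiv.Perm S} {c : S} (E : TreeRoots Γ g c)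

lemma iterate_perm (i : ℕ) (v : S) : E.P^[i] (g v) = g (E.P^[i] v) := by
  induction i with
  | zero => rfl
  | succ i ih => rw [Function.iterate_succ_apply', ih, E.P_perm, Function.iterate_succ_apply']

lemma iterate_root (i : ℕ) : E.P^[i] c = c := by
  induction i with
  | zero => rfl
  | succ i ih => rw [Function.iterate_succ_apply', ih, E.rooted.P_root]

lemma ℓ_iterate (i : ℕ) (v : S) : E.ℓ (E.P^[i] v) = E.ℓ v - i := by
  induction i with
  | zero => rfl
  | succ i ih =>
    rw [Function.iterate_succ_apply']
    by_cases hv : E.P^[i] v = c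
    · rw [hv, E.rooted.ℓ_root] at ih
      rw [hv, E.rooted.P_root, E.rooted.ℓ_root]
      omega
    · have := E.rooted.ℓ_P _ hv
      omega

lemma iterate_ℓ (v : S) : E.P^[E.ℓ v] v = c := by
  rw [← E.rooted.ℓ_eq_zero, E.ℓ_iterate, Nat.sub_self]

open Classical in
/-- The vertices of the path from `v` to the root. -/
def anc (v : S) : Finset S := (Finset.range (E.ℓ v + 1)).image fun i => E.P^[i] v

variable {E}

lemma mem_anc {u v : S} : u ∈ E.anc v ↔ ∃ i ≤ E.ℓ v, E.P^[i] v = u := by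
  simp [anc]

lemma self_mem_anc (v : S) : v ∈ E.anc v := mem_anc.2 ⟨0, Nat.zero_le _, rfl⟩

lemma isLower_anc (v : S) : E.IsLower (E.anc v) := by
  refine ⟨mem_anc.2 ⟨_, le_rfl, E.iterate_ℓ v⟩, fun s hs => ?_⟩
  obtain ⟨i, hi, rfl⟩ := mem_anc.1 hs
  rcases eq_or_lt_of_le hi with rfl | hi
  · rw [E.iterate_ℓ, E.rooted.P_root]
    exact mem_anc.2 ⟨_, le_rfl, E.iterate_ℓ v⟩
  · exact mem_anc.2 ⟨i + 1, hi, Function.iterate_succ_apply' _ _ _⟩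

lemma ℓ_le_of_mem_anc {u v : S} (h : u ∈ E.anc v) : E.ℓ u ≤ E.ℓ v := by
  obtain ⟨i, -, rfl⟩ := mem_anc.1 h
  rw [E.ℓ_iterate]
  exact Nat.sub_le _ _

lemma fixed_of_mem_anc {u v : S} (hv : g v = v) (h : u ∈ E.anc v) : g u = u := by
  obtain ⟨i, -, rfl⟩ := mem_anc.1 h
  rw [← E.iterate_perm, hv]

lemma P_fixed {v : S} (hv : g v = v) : g (E.P v) = E.P v := by rw [← E.P_perm, hv]

lemma ne_root_of_moved (E : TreeRoots Γ g c) {v : S} (hv : g v ≠ v) : v ≠ c :=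
  fun e => hv (by rw [e, E.g_c])

/-- The moved children of fixed vertices are children of the root and form a single orbit. -/
lemma moved_child_of_fixed {t y : S} (ht : E.P t = c) (hgt : g t ≠ t) (hy : g y ≠ y)
    (hPy : g (E.P y) = E.P y) : E.P y = c ∧ (y = t ∨ y = g t ∨ t = g y) := by
  have h1 : ∀ s ∈ E.anc (E.P y), g s = s := fun s hs => fixed_of_mem_anc hPy hs
  have h2 := eq_or_eq_of_moved (isLower_anc (E.P y)) (fun s hs => by rwa [h1 s hs])
    (fun h => hgt (h1 t h)) (fun h => hy (h1 y h)) (by rw [ht]; exact (isLower_anc _).1)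
    (self_mem_anc _) hgt hy
  refine ⟨?_, h2⟩
  rcases h2 with rfl | rfl | h2
  · exact ht
  · rw [E.P_perm, ht, E.g_c]
  · rw [h2, E.P_perm] at ht
    exact g.injective (ht.trans E.g_c.symm)

/-- An orbit of moved children of the root has two or three elements. -/
lemma perm_orbit {t : S} (ht : E.P t = c) (hgt : g t ≠ t) : g (g t) = t ∨ g (g (g t)) = t := by
  have hggt : g (g (g t)) ≠ g (g t) := fun e => hgt (g.injective (g.injective e))
  have hP : E.P (g (g t)) = c := by rw [E.P_perm, E.P_perm, ht, E.g_c, E.g_c]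
  rcases (moved_child_of_fixed ht hgt hggt (by rw [hP, E.g_c])).2 with h | h | h
  · exact Or.inl h
  · exact absurd (g.injective h) hgt
  · exact Or.inr h.symm

/-- A moved vertex `v` with `g^k v = v` has at most one child, and `g^k` fixes the child too. The
children of `v` and of its images are neighbours of the union of the paths from the root to these
images, so they form a single orbit; the parent map is injective on it. -/
lemma child_unique {v : S} {k : ℕ} (hk : 0 < k) (hv : (g ^ k) v = v) (hgv : g v ≠ v) {y y' : S}
    (hy : E.P y = v) (hy' : E.P y' = v) : y' = y ∧ (g ^ k) y = y := by
  classical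
  have hmov : ∀ {y}, E.P y = v → g y ≠ y := fun hy e => hgv (by rw [← hy, P_fixed e])
  have hPpow : ∀ i u, E.P ((g ^ i) u) = (g ^ i) (E.P u) := by
    intro i u
    induction i with
    | zero => rfl
    | succ i ih => rw [pow_succ', Equiv.Perm.mul_apply, E.P_perm, ih, ← Equiv.Perm.mul_apply]
  have hℓpow : ∀ i u, E.ℓ ((g ^ i) u) = E.ℓ u := by
    intro i u
    induction i with
    | zero => rfl
    | succ i ih => rw [pow_succ', Equiv.Perm.mul_apply, E.ℓ_perm, ih]
  have hanc : ∀ u ∈ E.anc v, (g ^ k) u = u := by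
    intro u hu
    obtain ⟨i, -, rfl⟩ := mem_anc.1 hu
    have : ∀ i, (g ^ k) (E.P^[i] v) = E.P^[i] v := by
      intro i
      induction i with
      | zero => exact hv
      | succ i ih => rw [Function.iterate_succ_apply', ← hPpow, ih]
    exact this i
  let T : Finset S := (Finset.range k).biUnion fun i => (E.anc v).image (g ^ i)
  have hmem : ∀ u, u ∈ T ↔ ∃ i < k, ∃ s ∈ E.anc v, (g ^ i) s = u := by
    intro u; simp [T]
  have hsub : ∀ u ∈ E.anc v, u ∈ T := fun u hu => (hmem u).2 ⟨0, hk, u, hu, rfl⟩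
  have hlow : E.IsLower T := by
    refine ⟨hsub c (isLower_anc v).1, fun s hs => ?_⟩
    obtain ⟨i, hi, u, hu, rfl⟩ := (hmem s).1 hs
    exact (hmem _).2 ⟨i, hi, E.P u, (isLower_anc v).2 u hu, (hPpow i u).symm⟩
  have hgT : ∀ s ∈ T, g s ∈ T := by
    intro s hs
    obtain ⟨i, hi, u, hu, rfl⟩ := (hmem s).1 hs
    rw [← Equiv.Perm.mul_apply, ← pow_succ']
    rcases eq_or_lt_of_le (show i + 1 ≤ k from hi) with e | e
    · rw [e, hanc u hu]; exact hsub u hu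
    · exact (hmem _).2 ⟨i + 1, e, u, hu, rfl⟩
  have hnot : ∀ {y}, E.P y = v → y ∉ T := by
    intro y hy hyT
    obtain ⟨i, -, u, hu, rfl⟩ := (hmem y).1 hyT
    have h1 := ℓ_le_of_mem_anc hu
    have h2 := E.rooted.ℓ_P _ (E.ne_root_of_moved (hmov hy))
    rw [hy, hℓpow] at h2
    omega
  have huniq : ∀ {y y'}, E.P y = v → E.P y' = v → y' = y := by
    intro y y' hy hy'
    rcases eq_or_eq_of_moved hlow hgT (hnot hy) (hnot hy') (by rw [hy]; exact hsub _ (self_mem_anc v))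
      (by rw [hy']; exact hsub _ (self_mem_anc v)) (hmov hy) (hmov hy') with h | h | h
    · exact h
    · rw [h, E.P_perm, hy] at hy'; exact absurd hy' hgv
    · rw [h, E.P_perm, hy'] at hy; exact absurd hy hgv
  exact ⟨huniq hy hy', huniq hy (by rw [hPpow, hy, hv])⟩

/-- A set `Q` of vertices that contains with every vertex other than `s` its parent, and in which
every vertex has at most one child, is a finite or infinite path that starts at `s`. -/
lemma exists_chain {Q : S → Prop} {s : S} (hs : Q s)
    (huniq : ∀ v v', Q v → Q v' → v ≠ s → v' ≠ s → E.P v = E.P v' → v = v')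
    (hP : ∀ v, Q v → v ≠ s → v ≠ c ∧ Q (E.P v)) :
    ∃ (r : ℕ → S) (L : ℕ∞), r 0 = s ∧
      (∀ j : ℕ, ((j + 1 : ℕ) : ℕ∞) ≤ L → r (j + 1) ≠ s ∧ E.P (r (j + 1)) = r j) ∧
      ∀ v, Q v ↔ ∃ j : ℕ, (j : ℕ∞) ≤ L ∧ v = r j := by
  classical
  let ch : S → S := fun v => if h : ∃ w, Q w ∧ w ≠ s ∧ E.P w = v then h.choose else v
  let r : ℕ → S := fun j => ch^[j] s
  have hr : ∀ j, r (j + 1) = ch (r j) := fun j => Function.iterate_succ_apply' _ _ _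
  let N : ℕ → Prop := fun j => ∃ w, Q w ∧ w ≠ s ∧ E.P w = r j
  have hN : ∀ j, N j → Q (r (j + 1)) ∧ r (j + 1) ≠ s ∧ E.P (r (j + 1)) = r j := by
    intro j hj
    rw [hr]
    simp only [ch]
    rw [dif_pos hj]
    exact hj.choose_spec
  obtain ⟨L, hL1, hL2⟩ : ∃ L : ℕ∞, (∀ j : ℕ, ((j + 1 : ℕ) : ℕ∞) ≤ L → N j) ∧
      ∀ j : ℕ, (j : ℕ∞) ≤ L → N j → ((j + 1 : ℕ) : ℕ∞) ≤ L := by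
    by_cases hall : ∀ j, N j
    · exact ⟨⊤, fun j _ => hall j, fun j _ _ => le_top⟩
    · push Not at hall
      refine ⟨(Nat.find hall : ℕ), fun j hj => ?_, fun j hj hNj => ?_⟩
      · by_contra h
        have := Nat.find_min' hall h
        have := Nat.cast_le.1 hj
        omega
      · rw [Nat.cast_le] at hj ⊢
        rcases eq_or_lt_of_le hj with e | e
        · exact absurd hNj (e ▸ Nat.find_spec hall)
        · exact e
  refine ⟨r, L, rfl, fun j hj => (hN j (hL1 j hj)).2, fun v => ⟨fun hv => ?_, ?_⟩⟩
  · have key : ∀ n v, E.ℓ v = n → Q v → ∃ j : ℕ, (j : ℕ∞) ≤ L ∧ v = r j := by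
      intro n
      induction n using Nat.strong_induction_on with
      | _ n ih =>
        intro v hn hv
        by_cases hvs : v = s
        · exact ⟨0, by simp, hvs⟩
        · obtain ⟨hvc, hPv⟩ := hP v hv hvs
          obtain ⟨j, hj, e⟩ := ih _ (by have := E.rooted.ℓ_P v hvc; omega) (E.P v) rfl hPv
          have hNj : N j := ⟨v, hv, hvs, e⟩
          obtain ⟨h1, h2, h3⟩ := hN j hNj
          exact ⟨j + 1, hL2 j hj hNj, huniq _ _ hv h1 hvs h2 (by rw [h3, e])⟩
    exact key _ v rfl hv
  · rintro ⟨j, hj, rfl⟩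
    cases j with
    | zero => exact hs
    | succ j => exact (hN j (hL1 j hj)).1

variable (E)

/-- An identification of the tree with the tree on `I` that is described by the parent map
`par`. -/
lemma isIsomorphic {M : CoxeterMatrix S} (E : TreeRoots M.coxeterGraph g c)
    (h3 : ∀ s t, M.coxeterGraph.Adj s t → M s t = 3) {I : Type*} [DecidableEq I]
    {N : CoxeterMatrix I} (f : I → S) (par : I → I) (i₀ : I) (h0 : f i₀ = c)
    (hf : ∀ i, i ≠ i₀ → f i ≠ c ∧ E.P (f i) = f (par i))
    (hsib : ∀ i j, i ≠ i₀ → j ≠ i₀ → par i = par j → f i = f j → i = j)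
    (hsurj : ∀ v, ∃ i, f i = v)
    (hN : ∀ i j, N i j = if i = j then 1 else if par i = j ∨ par j = i then 3 else 2)
    (hpar : par i₀ = i₀) : M.IsIsomorphic N := by
  have hinj : ∀ n i j, E.ℓ (f i) = n → f i = f j → i = j := by
    intro n
    induction n with
    | zero =>
      intro i j hi e
      have hzero : ∀ i, f i = c → i = i₀ := fun i hi => by
        by_contra h
        exact (hf i h).1 hi
      have hi := E.rooted.ℓ_eq_zero.1 hi
      rw [hzero i hi, hzero j (e ▸ hi)]
    | succ n ih =>
      intro i j hi e
      have hne : ∀ i, E.ℓ (f i) = n + 1 → i ≠ i₀ := by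
        rintro i hi rfl
        rw [h0, E.rooted.ℓ_root] at hi
        omega
      have h1 := hne i hi
      have h2 := hne j (e ▸ hi)
      refine hsib i j h1 h2 (ih _ _ ?_ ?_) e
      · rw [← (hf i h1).2]
        have := E.rooted.ℓ_P _ (hf i h1).1
        omega
      · rw [← (hf i h1).2, ← (hf j h2).2, e]
  have hinj' : Function.Injective f := fun i j e => hinj _ i j rfl e
  have hPf : ∀ i j, E.P (f i) = f j ↔ par i = j := by
    intro i j
    by_cases hi : i = i₀
    · subst hi
      rw [h0, E.rooted.P_root, hpar]
      conv_lhs => rw [← h0]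
      exact hinj'.eq_iff
    · rw [(hf i hi).2]
      exact hinj'.eq_iff
  refine ⟨(Equiv.ofBijective f ⟨hinj', hsurj⟩).symm, fun s t => ?_⟩
  obtain ⟨i, rfl⟩ := hsurj s
  obtain ⟨j, rfl⟩ := hsurj t
  have hsymm : ∀ i, (Equiv.ofBijective f ⟨hinj', hsurj⟩).symm (f i) = i := fun i =>
    (Equiv.ofBijective f ⟨hinj', hsurj⟩).symm_apply_apply i
  rw [hsymm, hsymm, hN]
  have hadj := E.rooted.adj_iff (f i) (f j)
  rw [hPf, hPf, hinj'.ne_iff] at hadj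
  split_ifs with h1 h2
  · rw [h1, M.diagonal]
  · exact (h3 _ _ (hadj.2 ⟨h1, h2⟩)).symm
  · by_contra h
    exact h2 (hadj.1 ⟨hinj'.ne h1, Ne.symm h⟩).2

end TreeRoots

lemma CoxeterMatrix.ofGraph_apply_of_parent {I : Type*} [DecidableEq I] {H : SimpleGraph I}
    {par : I → I} (h : ∀ i j, H.Adj i j ↔ i ≠ j ∧ (par i = j ∨ par j = i)) (i j : I) :
    CoxeterMatrix.ofGraph H i j = if i = j then 1 else if par i = j ∨ par j = i then 3 else 2 := by
  classical
  trans (if i = j then 1 else if H.Adj i j then 3 else 2)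
  · simp only [ofGraph, Matrix.of_apply]
    congr
  by_cases hij : i = j
  · simp [hij]
  · simp only [hij, h, if_false, not_false_eq_true, true_and, ne_eq]

end

/-! ### Forbidden configurations -/

noncomputable section

variable {S : Type*}

namespace TreeRoots

variable {Γ : SimpleGraph S} {g : Equiv.Perm S} {c : S} {E : TreeRoots Γ g c}

lemma isLower_singleton (E : TreeRoots Γ g c) : E.IsLower {c} := by
  refine ⟨Finset.mem_singleton_self c, fun s hs => ?_⟩
  rw [Finset.mem_singleton.1 hs, E.rooted.P_root]
  exact Finset.mem_singleton_self c

lemma perm_mem_singleton (E : TreeRoots Γ g c) : ∀ s ∈ ({c} : Finset S), g s ∈ ({c} : Finset S) := by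
  intro s hs
  rw [Finset.mem_singleton.1 hs, E.g_c]
  exact Finset.mem_singleton_self c

lemma perm_child {u v : S} (h : E.P v = u) : E.P (g v) = g u := by rw [E.P_perm, h]

lemma perm_child_root {v : S} (h : E.P v = c) : E.P (g v) = c := by rw [E.P_perm, h, E.g_c]

lemma child_moved {u v : S} (h : E.P v = u) (hu : g u ≠ u) : g v ≠ v := fun e =>
  hu (by rw [← h, P_fixed e])

lemma perm_ne_root (E : TreeRoots Γ g c) {v : S} (h : v ≠ c) : g v ≠ c := fun e =>
  h (g.injective (e.trans E.g_c.symm))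

lemma ne_of_moved_of_fixed {a v : S} (ha : g a ≠ a) (hv : g v = v) : a ≠ v := fun e =>
  ha (by rw [e, hv])

lemma perm_moved {a : S} (ha : g a ≠ a) : g (g a) ≠ g a := fun e => ha (g.injective e)

section Three

variable {t : S} (ht : E.P t = c) (hgt : g t ≠ t) (hggt : g (g t) ≠ t) (hgggt : g (g (g t)) = t)

include ht hgt hggt hgggt

/-- If the root has three moved children, then it has at most one fixed child: otherwise there is a
root of an affine subsystem of type `D̃₄` that is not orthogonal to its image. -/
lemma three_fixed_unique {u u' : S} (hu : E.P u = c) (hu' : E.P u' = c) (huc : u ≠ c)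
    (huc' : u' ≠ c) (hgu : g u = u) (hgu' : g u' = u') : u = u' := by
  by_contra hne
  have m1 := perm_moved hgt
  have m2 := perm_moved m1
  have r0 := E.ne_root_of_moved hgt
  have r1 := E.perm_ne_root r0
  have r2 := E.perm_ne_root r1
  have p1 := perm_child_root ht
  have p2 := perm_child_root p1
  have d := fun {v : S} (hv : g v = v) => And.intro (ne_of_moved_of_fixed hgt hv)
    (And.intro (ne_of_moved_of_fixed m1 hv) (ne_of_moved_of_fixed m2 hv))
  have d1 := d hgu
  have d2 := d hgu'
  refine false_of_configuration E.isLower_singleton E.perm_mem_singleton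
    ![0, 0, 0, 0, 0, 0] ![0, 2, 3, 1, 4, 5] ![t, g t, g (g t), u, u'] 0
    [(1, 1), (4, 1), (5, 1), (0, 2), (2, 2)] ?_ ?_ ?_ ?_ (by decide)
  · intro i
    fin_cases i <;> simp [*]
  · intro i
    left
    fin_cases i <;> simp [*]
  · intro i j hij _
    fin_cases i <;> fin_cases j <;>
      first | exact absurd hij (by decide) | simp [*, Ne.symm hgt, Ne.symm hggt, Ne.symm m1]
  · intro i
    match i with
    | 0 => exact ⟨1, rfl, rfl⟩
    | 1 => exact ⟨2, rfl, rfl⟩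
    | 2 => exact ⟨0, rfl, hgggt⟩
    | 3 => exact ⟨3, rfl, hgu⟩
    | 4 => exact ⟨4, rfl, hgu'⟩

/-- If the root has three moved children, then these have no children. -/
lemma three_no_child {w : S} (hw : E.P w = t) : False := by
  have m1 := perm_moved hgt
  have m2 := perm_moved m1
  have r0 := E.ne_root_of_moved hgt
  have r1 := E.perm_ne_root r0
  have r2 := E.perm_ne_root r1
  have p1 := perm_child_root ht
  have p2 := perm_child_root p1
  have hgw := child_moved hw hgt
  have s0 := E.ne_root_of_moved hgw
  have s1 := E.perm_ne_root s0
  have s2 := E.perm_ne_root s1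
  have hgggw : g (g (g w)) = w :=
    (child_unique (k := 3) (by omega) (by simpa [pow_succ] using hgggt) hgt hw hw).2
  refine false_of_configuration E.isLower_singleton E.perm_mem_singleton
    ![0, 0, 0, 0, 1, 2, 3] ![0, 2, 3, 1, 5, 6, 4] ![t, g t, g (g t), w, g w, g (g w)] 0
    [(1, 1), (2, 1), (4, 1)] ?_ ?_ ?_ ?_ (by decide)
  · intro i
    fin_cases i <;> simp [*]
  · intro i
    match i with
    | 0 => exact Or.inl ⟨rfl, by simpa using ht⟩
    | 1 => exact Or.inl ⟨rfl, by simpa using p1⟩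
    | 2 => exact Or.inl ⟨rfl, by simpa using p2⟩
    | 3 => exact Or.inr ⟨0, rfl, hw⟩
    | 4 => exact Or.inr ⟨1, rfl, perm_child hw⟩
    | 5 => exact Or.inr ⟨2, rfl, perm_child (perm_child hw)⟩
  · intro i j hij hpar
    fin_cases i <;> fin_cases j <;>
      first
      | exact absurd hij (by decide)
      | exact absurd hpar (by decide)
      | simp [*, Ne.symm hgt, Ne.symm hggt, Ne.symm m1]
  · intro i
    match i with
    | 0 => exact ⟨1, rfl, rfl⟩
    | 1 => exact ⟨2, rfl, rfl⟩
    | 2 => exact ⟨0, rfl, hgggt⟩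
    | 3 => exact ⟨4, rfl, rfl⟩
    | 4 => exact ⟨5, rfl, rfl⟩
    | 5 => exact ⟨3, rfl, hgggw⟩

/-- If the root has three moved children, then a fixed child of the root has no fixed child. -/
lemma three_no_grandchild {u y : S} (hu : E.P u = c) (huc : u ≠ c) (hgu : g u = u)
    (hy : E.P y = u) (hgy : g y = y) : False := by
  have m1 := perm_moved hgt
  have m2 := perm_moved m1
  have r0 := E.ne_root_of_moved hgt
  have r1 := E.perm_ne_root r0
  have r2 := E.perm_ne_root r1
  have p1 := perm_child_root ht
  have p2 := perm_child_root p1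
  have hyc : y ≠ c := fun e => huc (by rw [← hy, e, E.rooted.P_root])
  have d1 := ne_of_moved_of_fixed hgt hgu
  have d2 := ne_of_moved_of_fixed m1 hgu
  have d3 := ne_of_moved_of_fixed m2 hgu
  refine false_of_configuration E.isLower_singleton E.perm_mem_singleton
    ![0, 0, 0, 0, 0, 4] ![0, 2, 3, 1, 4, 5] ![t, g t, g (g t), u, y] 0
    [(1, 1), (2, 1), (4, 1), (0, 2), (3, 2), (5, 1), (4, 2), (0, 4), (1, 3)] ?_ ?_ ?_ ?_ (by decide)
  · intro i
    fin_cases i <;> simp [*]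
  · intro i
    match i with
    | 0 => exact Or.inl ⟨rfl, by simpa using ht⟩
    | 1 => exact Or.inl ⟨rfl, by simpa using p1⟩
    | 2 => exact Or.inl ⟨rfl, by simpa using p2⟩
    | 3 => exact Or.inl ⟨rfl, by simpa using hu⟩
    | 4 => exact Or.inr ⟨3, rfl, hy⟩
  · intro i j hij hpar
    fin_cases i <;> fin_cases j <;>
      first
      | exact absurd hij (by decide)
      | exact absurd hpar (by decide)
      | simp [*, Ne.symm hgt, Ne.symm hggt, Ne.symm m1]
  · intro i
    match i with
    | 0 => exact ⟨1, rfl, rfl⟩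
    | 1 => exact ⟨2, rfl, rfl⟩
    | 2 => exact ⟨0, rfl, hgggt⟩
    | 3 => exact ⟨3, rfl, hgu⟩
    | 4 => exact ⟨4, rfl, hgy⟩

end Three

section Two

variable {t : S} (ht : E.P t = c) (hgt : g t ≠ t) (hggt : g (g t) = t)

section Fork

variable {T : Finset S} (hT : E.IsLower T) (hfix : ∀ s ∈ T, g s = s) {w w' : S} (hw : w ∉ T)
  (hw' : w' ∉ T) (hPw : E.P w ∈ T) (hPw' : E.P w' ∈ T) (hgw : g w = w) (hgw' : g w' = w')
  (hne : w ≠ w')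

include ht hgt hggt hT hfix hw hw' hPw hPw' hgw hgw' hne

/-- The path from the root to a fork has no third fixed neighbour. -/
lemma fork_no_third {v : S} (hv : v ∉ T) (hPv : E.P v ∈ T) (hgv : g v = v) : v = w ∨ v = w' := by
  by_contra! hcon
  have m1 := perm_moved hgt
  have r0 : t ∉ T := fun h => hgt (hfix t h)
  have r1 : g t ∉ T := fun h => m1 (hfix _ h)
  have p0 : E.P t ∈ T := by rw [ht]; exact hT.1
  have p1 : E.P (g t) ∈ T := by rw [perm_child_root ht]; exact hT.1
  have d := fun {v : S} (hv : g v = v) => And.intro (ne_of_moved_of_fixed hgt hv)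
    (ne_of_moved_of_fixed m1 hv)
  have d1 := d hgw
  have d2 := d hgw'
  have d3 := d hgv
  refine false_of_configuration hT (fun s hs => by rwa [hfix s hs])
    ![0, 0, 0, 0, 0, 0] ![0, 2, 1, 3, 4, 5] ![t, g t, w, w', v] 0
    [(3, 1), (4, 1), (5, 1), (0, 2), (1, 2)] ?_ ?_ ?_ ?_ (by decide)
  · intro i
    fin_cases i <;> assumption
  · intro i
    left
    fin_cases i <;> exact ⟨rfl, by assumption⟩
  · intro i j hij _
    fin_cases i <;> fin_cases j <;>
      first | exact absurd hij (by decide) | simp [*, Ne.symm hgt, hcon.1.symm, hcon.2.symm]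
  · intro i
    match i with
    | 0 => exact ⟨1, rfl, rfl⟩
    | 1 => exact ⟨0, rfl, hggt⟩
    | 2 => exact ⟨2, rfl, hgw⟩
    | 3 => exact ⟨3, rfl, hgw'⟩
    | 4 => exact ⟨4, rfl, hgv⟩

/-- If there is a fork of fixed vertices, then `t` has no child. -/
lemma fork_no_moved_child {y : S} (hy : E.P y = t) : False := by
  have m1 := perm_moved hgt
  have r0 : t ∉ T := fun h => hgt (hfix t h)
  have r1 : g t ∉ T := fun h => m1 (hfix _ h)
  have p0 : E.P t ∈ T := by rw [ht]; exact hT.1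
  have p1 : E.P (g t) ∈ T := by rw [perm_child_root ht]; exact hT.1
  have hgy := child_moved hy hgt
  have n1 := perm_moved hgy
  have s0 : y ∉ T := fun h => hgy (hfix y h)
  have s1 : g y ∉ T := fun h => n1 (hfix _ h)
  have hggy : g (g y) = y :=
    (child_unique (k := 2) (by omega) (by simpa [pow_succ] using hggt) hgt hy hy).2
  have d := fun {v : S} (hv : g v = v) => And.intro (ne_of_moved_of_fixed hgt hv)
    (ne_of_moved_of_fixed m1 hv)
  have d1 := d hgw
  have d2 := d hgw'
  refine false_of_configuration hT (fun s hs => by rwa [hfix s hs])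
    ![0, 0, 0, 0, 0, 1, 2] ![0, 2, 1, 3, 4, 6, 5] ![t, g t, w, w', y, g y] 0
    [(1, 1), (3, 1), (4, 1), (0, 2), (2, 2), (5, 1)] ?_ ?_ ?_ ?_ (by decide)
  · intro i
    fin_cases i <;> assumption
  · intro i
    match i with
    | 0 => exact Or.inl ⟨rfl, p0⟩
    | 1 => exact Or.inl ⟨rfl, p1⟩
    | 2 => exact Or.inl ⟨rfl, hPw⟩
    | 3 => exact Or.inl ⟨rfl, hPw'⟩
    | 4 => exact Or.inr ⟨0, rfl, hy⟩
    | 5 => exact Or.inr ⟨1, rfl, perm_child hy⟩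
  · intro i j hij hpar
    fin_cases i <;> fin_cases j <;>
      first
      | exact absurd hij (by decide)
      | exact absurd hpar (by decide)
      | simp [*, Ne.symm hgt]
  · intro i
    match i with
    | 0 => exact ⟨1, rfl, rfl⟩
    | 1 => exact ⟨0, rfl, hggt⟩
    | 2 => exact ⟨2, rfl, hgw⟩
    | 3 => exact ⟨3, rfl, hgw'⟩
    | 4 => exact ⟨5, rfl, rfl⟩
    | 5 => exact ⟨4, rfl, hggy⟩

/-- The two vertices of a fork have no fixed child. -/
lemma fork_no_fixed_child {v : S} (hv : E.P v = w) (hgv : g v = v) : False := by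
  have m1 := perm_moved hgt
  have r0 : t ∉ T := fun h => hgt (hfix t h)
  have r1 : g t ∉ T := fun h => m1 (hfix _ h)
  have p0 : E.P t ∈ T := by rw [ht]; exact hT.1
  have p1 : E.P (g t) ∈ T := by rw [perm_child_root ht]; exact hT.1
  have hvT : v ∉ T := fun h => hw (hv ▸ hT.2 v h)
  have d := fun {v : S} (hv : g v = v) => And.intro (ne_of_moved_of_fixed hgt hv)
    (ne_of_moved_of_fixed m1 hv)
  have d1 := d hgw
  have d2 := d hgw'
  refine false_of_configuration hT (fun s hs => by rwa [hfix s hs])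
    ![0, 0, 0, 0, 0, 3] ![0, 2, 1, 3, 4, 5] ![t, g t, w, w', v] 0
    [(1, 1), (2, 1), (3, 1), (0, 2), (4, 2), (5, 1), (3, 2), (0, 4), (1, 3)] ?_ ?_ ?_ ?_ (by decide)
  · intro i
    fin_cases i <;> assumption
  · intro i
    match i with
    | 0 => exact Or.inl ⟨rfl, p0⟩
    | 1 => exact Or.inl ⟨rfl, p1⟩
    | 2 => exact Or.inl ⟨rfl, hPw⟩
    | 3 => exact Or.inl ⟨rfl, hPw'⟩
    | 4 => exact Or.inr ⟨2, rfl, hv⟩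
  · intro i j hij hpar
    fin_cases i <;> fin_cases j <;>
      first
      | exact absurd hij (by decide)
      | exact absurd hpar (by decide)
      | simp [*, Ne.symm hgt]
  · intro i
    match i with
    | 0 => exact ⟨1, rfl, rfl⟩
    | 1 => exact ⟨0, rfl, hggt⟩
    | 2 => exact ⟨2, rfl, hgw⟩
    | 3 => exact ⟨3, rfl, hgw'⟩
    | 4 => exact ⟨4, rfl, hgv⟩

end Fork

include ht hgt hggt

/-- The arms of moved vertices have length at most two if the root has a fixed child: a tree of
type `Ẽ₇` contains a root that is not orthogonal to its image. -/
lemma two_no_great_grandchild {u w x : S} (hu : E.P u = c) (huc : u ≠ c) (hgu : g u = u)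
    (hw : E.P w = t) (hx : E.P x = w) : False := by
  have m1 := perm_moved hgt
  have r0 := E.ne_root_of_moved hgt
  have r1 := E.perm_ne_root r0
  have p1 := perm_child_root ht
  have hgw := child_moved hw hgt
  have hgx := child_moved hx hgw
  have s0 := E.ne_root_of_moved hgw
  have s1 := E.perm_ne_root s0
  have q0 := E.ne_root_of_moved hgx
  have q1 := E.perm_ne_root q0
  have hggw : g (g w) = w :=
    (child_unique (k := 2) (by omega) (by simpa [pow_succ] using hggt) hgt hw hw).2
  have hggx : g (g x) = x :=
    (child_unique (k := 2) (by omega) (by simpa [pow_succ] using hggw) hgw hx hx).2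
  have d1 := ne_of_moved_of_fixed hgt hgu
  have d2 := ne_of_moved_of_fixed m1 hgu
  refine false_of_configuration E.isLower_singleton E.perm_mem_singleton
    ![0, 0, 0, 1, 2, 3, 4, 0] ![0, 2, 1, 4, 3, 6, 5, 7] ![t, g t, w, g w, x, g x, u] 0
    [(1, 1), (2, 1), (3, 1), (4, 1), (5, 1), (7, 1), (0, 2), (1, 2)] ?_ ?_ ?_ ?_ (by decide)
  · intro i
    fin_cases i <;> simp [*]
  · intro i
    match i with
    | 0 => exact Or.inl ⟨rfl, by simpa using ht⟩
    | 1 => exact Or.inl ⟨rfl, by simpa using p1⟩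
    | 2 => exact Or.inr ⟨0, rfl, hw⟩
    | 3 => exact Or.inr ⟨1, rfl, perm_child hw⟩
    | 4 => exact Or.inr ⟨2, rfl, hx⟩
    | 5 => exact Or.inr ⟨3, rfl, perm_child hx⟩
    | 6 => exact Or.inl ⟨rfl, by simpa using hu⟩
  · intro i j hij hpar
    fin_cases i <;> fin_cases j <;>
      first
      | exact absurd hij (by decide)
      | exact absurd hpar (by decide)
      | simp [*, Ne.symm hgt]
  · intro i
    match i with
    | 0 => exact ⟨1, rfl, rfl⟩
    | 1 => exact ⟨0, rfl, hggt⟩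
    | 2 => exact ⟨3, rfl, rfl⟩
    | 3 => exact ⟨2, rfl, hggw⟩
    | 4 => exact ⟨5, rfl, rfl⟩
    | 5 => exact ⟨4, rfl, hggx⟩
    | 6 => exact ⟨6, rfl, hgu⟩

/-- If the arms of moved vertices have length at least two, then the arm of fixed vertices has
length at most two. -/
lemma two_no_fixed_great_grandchild {w u v y : S} (hw : E.P w = t) (hu : E.P u = c) (huc : u ≠ c)
    (hgu : g u = u) (hv : E.P v = u) (hgv : g v = v) (hy : E.P y = v) (hgy : g y = y) : False := by
  have m1 := perm_moved hgt
  have r0 := E.ne_root_of_moved hgt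
  have r1 := E.perm_ne_root r0
  have p1 := perm_child_root ht
  have hgw := child_moved hw hgt
  have s0 := E.ne_root_of_moved hgw
  have s1 := E.perm_ne_root s0
  have hggw : g (g w) = w :=
    (child_unique (k := 2) (by omega) (by simpa [pow_succ] using hggt) hgt hw hw).2
  have hvc : v ≠ c := fun e => huc (by rw [← hv, e, E.rooted.P_root])
  have hyc : y ≠ c := fun e => hvc (by rw [← hy, e, E.rooted.P_root])
  have d1 := ne_of_moved_of_fixed hgt hgu
  have d2 := ne_of_moved_of_fixed m1 hgu
  refine false_of_configuration E.isLower_singleton E.perm_mem_singleton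
    ![0, 0, 0, 1, 2, 0, 5, 6] ![0, 2, 1, 4, 3, 5, 6, 7] ![t, g t, w, g w, u, v, y] 0
    [(1, 1), (2, 1), (3, 1), (5, 1), (0, 2), (1, 2), (6, 1), (5, 2), (0, 3), (2, 2), (4, 2), (7, 1),
      (6, 2), (5, 3), (0, 4), (1, 3)] ?_ ?_ ?_ ?_ (by decide)
  · intro i
    fin_cases i <;> simp [*]
  · intro i
    match i with
    | 0 => exact Or.inl ⟨rfl, by simpa using ht⟩
    | 1 => exact Or.inl ⟨rfl, by simpa using p1⟩
    | 2 => exact Or.inr ⟨0, rfl, hw⟩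
    | 3 => exact Or.inr ⟨1, rfl, perm_child hw⟩
    | 4 => exact Or.inl ⟨rfl, by simpa using hu⟩
    | 5 => exact Or.inr ⟨4, rfl, hv⟩
    | 6 => exact Or.inr ⟨5, rfl, hy⟩
  · intro i j hij hpar
    fin_cases i <;> fin_cases j <;>
      first
      | exact absurd hij (by decide)
      | exact absurd hpar (by decide)
      | simp [*, Ne.symm hgt]
  · intro i
    match i with
    | 0 => exact ⟨1, rfl, rfl⟩
    | 1 => exact ⟨0, rfl, hggt⟩
    | 2 => exact ⟨3, rfl, rfl⟩
    | 3 => exact ⟨2, rfl, hggw⟩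
    | 4 => exact ⟨4, rfl, hgu⟩
    | 5 => exact ⟨5, rfl, hgv⟩
    | 6 => exact ⟨6, rfl, hgy⟩

end Two

end TreeRoots
end

/-! ### Three branches, and forks of fixed vertices -/

noncomputable section

variable {S : Type*} {M : CoxeterMatrix S}

namespace TreeRoots

variable {g : Equiv.Perm S} {c : S} {E : TreeRoots M.coxeterGraph g c} {t : S}

/-- The classification if the root has three moved children. -/
lemma classification_three (E : TreeRoots M.coxeterGraph g c)
    (h3 : ∀ s t, M.coxeterGraph.Adj s t → M s t = 3) (ht : E.P t = c) (hgt : g t ≠ t)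
    (hggt : g (g t) ≠ t) (hgggt : g (g (g t)) = t) :
    M.IsIsomorphic (CoxeterMatrix.typeD 4) ∨ M.IsIsomorphic (CoxeterMatrix.affineD 4) := by
  have m1 := perm_moved hgt
  have r0 := E.ne_root_of_moved hgt
  have r1 := E.perm_ne_root r0
  have r2 := E.perm_ne_root r1
  have p1 := perm_child_root ht
  have p2 := perm_child_root p1
  have hall : ∀ v, v = c ∨ v = t ∨ v = g t ∨ v = g (g t) ∨ (E.P v = c ∧ v ≠ c ∧ g v = v) := by
    refine E.rooted.induction (Or.inl rfl) fun v hv ih => ?_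
    rcases ih with h | h | h | h | ⟨h, hne, hfix⟩
    · by_cases hgv : g v = v
      · exact Or.inr (Or.inr (Or.inr (Or.inr ⟨h, hv, hgv⟩)))
      · rcases (moved_child_of_fixed ht hgt hgv (by rw [h, E.g_c])).2 with e | e | e
        · exact Or.inr (Or.inl e)
        · exact Or.inr (Or.inr (Or.inl e))
        · refine Or.inr (Or.inr (Or.inr (Or.inl (g.injective ?_))))
          rw [hgggt, e]
    · exact (three_no_child ht hgt hggt hgggt h).elim
    · exact (three_no_child ht hgt hggt hgggt
        ((perm_child (perm_child h)).trans hgggt)).elim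
    · exact (three_no_child ht hgt hggt hgggt ((perm_child h).trans hgggt)).elim
    · by_cases hgv : g v = v
      · exact (three_no_grandchild ht hgt hggt hgggt h hne hfix rfl hgv).elim
      · exact absurd (moved_child_of_fixed ht hgt hgv hfix).1 hne
  by_cases hu : ∃ u, E.P u = c ∧ u ≠ c ∧ g u = u
  · right
    obtain ⟨u, hPu, huc, hgu⟩ := hu
    have d1 := ne_of_moved_of_fixed hgt hgu
    have d2 := ne_of_moved_of_fixed m1 hgu
    have d3 := ne_of_moved_of_fixed (perm_moved m1) hgu
    refine E.isIsomorphic h3 ![t, g t, c, g (g t), u] (fun _ => 2) 2 rfl ?_ ?_ ?_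
      (CoxeterMatrix.ofGraph_apply_of_parent
        (SimpleGraph.fromRel_adj_iff_of_parent (by decide))) rfl
    · intro i hi
      fin_cases i <;> simp_all
    · intro i j hi hj _ e
      fin_cases i <;> fin_cases j <;>
        first
        | rfl
        | exact absurd rfl hi
        | exact absurd rfl hj
        | (revert e; simp [hgt, hggt, m1, Ne.symm hgt, Ne.symm hggt, Ne.symm m1, d1, d2, d3, d1.symm,
            d2.symm, d3.symm])
    · intro v
      rcases hall v with rfl | rfl | rfl | rfl | ⟨h, hne, hfix⟩
      · exact ⟨2, rfl⟩
      · exact ⟨0, rfl⟩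
      · exact ⟨1, rfl⟩
      · exact ⟨3, rfl⟩
      · exact ⟨4, three_fixed_unique ht hgt hggt hgggt hPu h huc hne hgu hfix⟩
  · left
    refine E.isIsomorphic h3 ![t, c, g t, g (g t)] (fun _ => 1) 1 rfl ?_ ?_ ?_
      (CoxeterMatrix.ofGraph_apply_of_parent
        (SimpleGraph.fromRel_adj_iff_of_parent (by decide))) rfl
    · intro i hi
      fin_cases i <;> simp_all
    · intro i j hi hj _ e
      fin_cases i <;> fin_cases j <;>
        first
        | rfl
        | exact absurd rfl hi
        | exact absurd rfl hj
        | (revert e; simp [hgt, hggt, m1, Ne.symm hgt, Ne.symm hggt, Ne.symm m1])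
    · intro v
      rcases hall v with rfl | rfl | rfl | rfl | h
      · exact ⟨1, rfl⟩
      · exact ⟨0, rfl⟩
      · exact ⟨2, rfl⟩
      · exact ⟨3, rfl⟩
      · exact absurd ⟨v, h⟩ hu

/-- The classification if the root has two moved children and there is a fork of fixed
vertices. -/
lemma classification_fork (E : TreeRoots M.coxeterGraph g c)
    (h3 : ∀ s t, M.coxeterGraph.Adj s t → M s t = 3) (ht : E.P t = c) (hgt : g t ≠ t)
    (hggt : g (g t) = t)
    (hfork : ∃ f w w', g w = w ∧ g w' = w' ∧ w ≠ c ∧ w' ≠ c ∧ E.P w = f ∧ E.P w' = f ∧ w ≠ w') :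
    ∃ m : ℕ, 4 ≤ m ∧ M.IsIsomorphic (CoxeterMatrix.affineD m) := by
  classical
  -- the fork `f` that is closest to the root
  have hex : ∃ n f, E.ℓ f = n ∧
      ∃ w w', g w = w ∧ g w' = w' ∧ w ≠ c ∧ w' ≠ c ∧ E.P w = f ∧ E.P w' = f ∧ w ≠ w' := by
    obtain ⟨f, h⟩ := hfork
    exact ⟨_, f, rfl, h⟩
  obtain ⟨f, hk, w, w', hgw, hgw', hwc, hw'c, hPw, hPw', hne⟩ := Nat.find_spec hex
  have hmin := fun n (hn : n < Nat.find hex) => Nat.find_min hex hn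
  generalize Nat.find hex = k at hk hmin
  have m1 := perm_moved hgt
  have hgf : g f = f := by rw [← hPw]; exact P_fixed hgw
  have hT := isLower_anc (E := E) f
  have hfix : ∀ s ∈ E.anc f, g s = s := fun s hs => fixed_of_mem_anc hgf hs
  have hfT := self_mem_anc (E := E) f
  have hnot : ∀ {v}, v ≠ c → E.P v = f → v ∉ E.anc f := by
    intro v hv hPv h
    have h1 := ℓ_le_of_mem_anc h
    have h2 := E.rooted.ℓ_P v hv
    rw [hPv] at h2
    omega
  let p : ℕ → S := fun j => E.P^[k - j] f
  have hpk : p k = f := by simp [p]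
  have hp0 : p 0 = c := by simp only [p, Nat.sub_zero, ← hk]; exact E.iterate_ℓ f
  have hPp : ∀ j < k, E.P (p (j + 1)) = p j := by
    intro j hj
    simp only [p]
    rw [← Function.iterate_succ_apply' E.P, show (k - (j + 1)).succ = k - j by omega]
  have hℓp : ∀ j ≤ k, E.ℓ (p j) = j := by
    intro j hj
    simp only [p]
    rw [E.ℓ_iterate, hk]
    omega
  have hgp : ∀ j, g (p j) = p j := by
    intro j
    simp only [p]
    rw [← E.iterate_perm, hgf]
  have hpc : ∀ j ≤ k, 0 < j → p j ≠ c := by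
    intro j hj h0 e
    have := hℓp j hj
    rw [e, E.rooted.ℓ_root] at this
    omega
  have hmt : ∀ {y}, E.P y ≠ t := fun hy => fork_no_moved_child ht hgt hggt hT hfix (hnot hwc hPw)
    (hnot hw'c hPw') (hPw ▸ hfT) (hPw' ▸ hfT) hgw hgw' hne hy
  have hall : ∀ v, (∃ j ≤ k, v = p j) ∨ v = t ∨ v = g t ∨ v = w ∨ v = w' := by
    refine E.rooted.induction (Or.inl ⟨0, Nat.zero_le _, hp0.symm⟩) fun v hv ih => ?_
    rcases ih with ⟨j, hj, h⟩ | h | h | h | h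
    · by_cases hgv : g v = v
      · rcases eq_or_lt_of_le hj with rfl | hj
        · rw [hpk] at h
          rcases fork_no_third ht hgt hggt hT hfix (hnot hwc hPw) (hnot hw'c hPw') (hPw ▸ hfT)
            (hPw' ▸ hfT) hgw hgw' hne (hnot hv h) (h ▸ hfT) hgv with e | e
          · exact Or.inr (Or.inr (Or.inr (Or.inl e)))
          · exact Or.inr (Or.inr (Or.inr (Or.inr e)))
        · left
          refine ⟨j + 1, hj, ?_⟩
          by_contra hne'
          exact hmin j hj ⟨p j, hℓp j hj.le, v, p (j + 1), hgv, hgp _, hv, hpc _ hj (Nat.succ_pos j),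
            h, hPp j hj, hne'⟩
      · rcases (moved_child_of_fixed ht hgt hgv (by rw [h, hgp])).2 with e | e | e
        · exact Or.inr (Or.inl e)
        · exact Or.inr (Or.inr (Or.inl e))
        · exact Or.inr (Or.inr (Or.inl (g.injective (by rw [hggt, e]))))
    · exact absurd h hmt
    · exact absurd ((perm_child h).trans hggt) hmt
    · by_cases hgv : g v = v
      · exact (fork_no_fixed_child ht hgt hggt hT hfix (hnot hwc hPw)
          (hnot hw'c hPw') (hPw ▸ hfT) (hPw' ▸ hfT) hgw hgw' hne h hgv).elim
      · exact absurd (h.symm.trans (moved_child_of_fixed ht hgt hgv (by rw [h, hgw])).1) hwc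
    · by_cases hgv : g v = v
      · exact (fork_no_fixed_child ht hgt hggt hT hfix (hnot hw'c hPw')
          (hnot hwc hPw) (hPw' ▸ hfT) (hPw ▸ hfT) hgw' hgw hne.symm h hgv).elim
      · exact absurd (h.symm.trans (moved_child_of_fixed ht hgt hgv (by rw [h, hgw'])).1) hw'c
  refine ⟨k + 4, by omega, ?_⟩
  -- `t, g t` are attached to the end `p 0 = c` of the path `p 0, …, p k`, and `w, w'` to `p k = f`
  let f' : ℕ → S := fun i => if i = 0 then t else if i = 1 then g t else if i = k + 3 then w else
    if i = k + 4 then w' else p (i - 2)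
  let par' : ℕ → ℕ := fun i => if i ≤ 2 then 2 else if i = k + 4 then k + 2 else i - 1
  have f0 : f' 0 = t := rfl
  have f1 : f' 1 = g t := rfl
  have f3 : f' (k + 3) = w := by simp [f']
  have f4 : f' (k + 4) = w' := by simp [f']
  have f2 : ∀ j ≤ k, f' (j + 2) = p j := by
    intro j hj
    simp only [f']
    rw [if_neg (by omega), if_neg (by omega), if_neg (by omega), if_neg (by omega),
      Nat.add_sub_cancel]
  have hcases : ∀ i ≤ k + 4, i = 0 ∨ i = 1 ∨ i = 2 ∨ (∃ j < k, i = j + 1 + 2) ∨ i = k + 3 ∨ i = k + 4 := by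
    intro i hi
    by_cases h : 3 ≤ i ∧ i ≤ k + 2
    · exact Or.inr (Or.inr (Or.inr (Or.inl ⟨i - 3, by omega, by omega⟩)))
    · omega
  have hpar' : ∀ i ≤ k + 4, par' i ≤ k + 4 := by
    intro i hi; simp only [par']; split_ifs <;> omega
  refine E.isIsomorphic h3 (fun i : Fin (k + 4 + 1) => f' i)
    (fun i => ⟨par' i, by have := hpar' i (by omega); omega⟩) ⟨2, by omega⟩ ?_ ?_ ?_ ?_
    (CoxeterMatrix.ofGraph_apply_of_parent (SimpleGraph.fromRel_adj_iff_of_parent ?_)) ?_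
  · simpa using (f2 0 (Nat.zero_le k)).trans hp0
  · rintro ⟨i, hi⟩ hi2
    have hi2 : i ≠ 2 := fun e => hi2 (Fin.ext e)
    have hc2 : f' 2 = c := (f2 0 (Nat.zero_le k)).trans hp0
    dsimp only
    rcases hcases i (by omega) with rfl | rfl | rfl | ⟨j, hj, rfl⟩ | rfl | rfl
    · exact ⟨E.ne_root_of_moved hgt, by rw [f0, ht]; exact hc2.symm⟩
    · exact ⟨E.ne_root_of_moved m1, by rw [f1, perm_child_root ht]; exact hc2.symm⟩
    · exact absurd rfl hi2
    · rw [f2 _ hj, show par' (j + 1 + 2) = j + 2 by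
        simp only [par']; rw [if_neg (by omega), if_neg (by omega)]; omega, f2 _ hj.le]
      exact ⟨hpc _ hj (Nat.succ_pos j), hPp j hj⟩
    · rw [f3, show par' (k + 3) = k + 2 by
        simp only [par']; rw [if_neg (by omega), if_neg (by omega)]; omega, f2 _ le_rfl, hpk]
      exact ⟨hwc, hPw⟩
    · rw [f4, show par' (k + 4) = k + 2 by
        simp only [par']; rw [if_neg (by omega), if_pos trivial], f2 _ le_rfl, hpk]
      exact ⟨hw'c, hPw'⟩
  · rintro ⟨i, hi⟩ ⟨j, hj⟩ hi2 hj2 hij e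
    have hi2 : i ≠ 2 := fun e => hi2 (Fin.ext e)
    have hj2 : j ≠ 2 := fun e => hj2 (Fin.ext e)
    have hij := Fin.mk.inj hij
    dsimp only at e
    refine Fin.ext ?_
    change i = j
    have hpar : ∀ i, 2 < i → i ≤ k + 4 → par' i = if i = k + 4 then k + 2 else i - 1 :=
      fun i h _ => by simp only [par']; rw [if_neg (by omega)]
    have hfixf : ∀ i, 2 < i → i ≤ k + 4 → g (f' i) = f' i := by
      intro i h h'
      rcases hcases i h' with rfl | rfl | rfl | ⟨j, hj, rfl⟩ | rfl | rfl
      · omega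
      · omega
      · omega
      · rw [f2 _ hj]; exact hgp _
      · rw [f3, hgw]
      · rw [f4, hgw']
    have hmovf : ∀ i, i < 2 → g (f' i) ≠ f' i := by
      intro i hi
      interval_cases i
      · exact hgt
      · exact m1
    by_cases h1 : i < 2 <;> by_cases h2 : j < 2
    · interval_cases i <;> interval_cases j <;> first | rfl | (exfalso; rw [f0, f1] at e)
      · exact hgt e.symm
      · exact hgt e
    · exact absurd (by rw [e]; exact hfixf j (by omega) (by omega)) (hmovf i h1)
    · exact absurd (by rw [← e]; exact hfixf i (by omega) (by omega)) (hmovf j h2)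
    · rw [hpar i (by omega) (by omega), hpar j (by omega) (by omega)] at hij
      split_ifs at hij with h5 h6 h6
      · omega
      · obtain rfl : j = k + 3 := by omega
        subst h5
        rw [f3, f4] at e
        exact absurd e.symm hne
      · obtain rfl : i = k + 3 := by omega
        subst h6
        rw [f3, f4] at e
        exact absurd e hne
      · omega
  · intro v
    rcases hall v with ⟨j, hj, rfl⟩ | rfl | rfl | rfl | rfl
    · exact ⟨⟨j + 2, by omega⟩, f2 j hj⟩
    · exact ⟨⟨0, by omega⟩, f0⟩
    · exact ⟨⟨1, by omega⟩, f1⟩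
    · exact ⟨⟨k + 3, by omega⟩, f3⟩
    · exact ⟨⟨k + 4, by omega⟩, f4⟩
  · rintro ⟨i, hi⟩ ⟨j, hj⟩ hij
    simp only [ne_eq, Fin.mk.injEq, par'] at hij ⊢
    split_ifs <;> omega
  · exact Fin.ext (by simp [par'])

end TreeRoots
end

/-! ### Two branches and a path of fixed vertices -/

noncomputable section

variable {S : Type*} {M : CoxeterMatrix S}

namespace TreeRoots

variable {g : Equiv.Perm S} {c : S} {E : TreeRoots M.coxeterGraph g c} {t : S}

/-- In the branch of `t`, all vertices are moved by `g`, and fixed by `g²`. -/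
lemma branch_moved (hgt : g t ≠ t) (hggt : g (g t) = t) {i : ℕ} {v : S} (hv : E.P^[i] v = t) :
    g v ≠ v ∧ g (g v) = v := by
  induction i generalizing v with
  | zero => rw [show v = t from hv]; exact ⟨hgt, hggt⟩
  | succ i ih =>
    obtain ⟨h1, h2⟩ := ih (show E.P^[i] (E.P v) = t from hv)
    exact ⟨child_moved rfl h1,
      (child_unique (k := 2) (by omega) (by simpa [pow_succ] using h2) h1 rfl rfl).2⟩

/-- The vertices of the branch of `t` form a path. -/
lemma exists_branch_chain (ht : E.P t = c) (hgt : g t ≠ t) (hggt : g (g t) = t) :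
    ∃ (r : ℕ → S) (L : ℕ∞), r 0 = t ∧
      (∀ j : ℕ, ((j + 1 : ℕ) : ℕ∞) ≤ L → E.P (r (j + 1)) = r j) ∧
      (∀ j : ℕ, (j : ℕ∞) ≤ L → g (r j) ≠ r j) ∧
      ∀ v, g v ≠ v → ∃ j : ℕ, (j : ℕ∞) ≤ L ∧ (v = r j ∨ v = g (r j)) := by
  have htc := E.ne_root_of_moved hgt
  have hbc : ∀ {i v}, E.P^[i] v = t → v ≠ c := by
    rintro i v h rfl
    rw [E.iterate_root] at h
    exact htc h.symm
  have hstep : ∀ v, (∃ i, E.P^[i] v = t) → v ≠ t → v ≠ c ∧ ∃ i, E.P^[i] (E.P v) = t := by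
    rintro v ⟨i, hi⟩ hv
    refine ⟨hbc hi, ?_⟩
    cases i with
    | zero => exact absurd hi hv
    | succ i => exact ⟨i, hi⟩
  obtain ⟨r, L, h0, hr, hQ⟩ := exists_chain (E := E) (Q := fun v => ∃ i, E.P^[i] v = t) (s := t)
    ⟨0, rfl⟩ (fun v v' hv hv' hvt hvt' e => by
      obtain ⟨-, i, hi⟩ := hstep v hv hvt
      obtain ⟨h1, h2⟩ := branch_moved hgt hggt hi
      exact (child_unique (k := 2) (by omega) (by simpa [pow_succ] using h2) h1 e.symm rfl).1) hstep
  refine ⟨r, L, h0, fun j hj => (hr j hj).2, fun j hj => ?_, ?_⟩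
  · obtain ⟨i, hi⟩ := (hQ (r j)).2 ⟨j, hj, rfl⟩
    exact (branch_moved hgt hggt hi).1
  · refine E.rooted.induction (fun h => absurd E.g_c h) fun v hv ih hgv => ?_
    by_cases hfix : g (E.P v) = E.P v
    · rcases (moved_child_of_fixed ht hgt hgv hfix).2 with e | e | e
      · exact ⟨0, by simp, Or.inl (by rw [h0, e])⟩
      · exact ⟨0, by simp, Or.inr (by rw [h0, e])⟩
      · exact ⟨0, by simp, Or.inr (g.injective (by rw [h0, hggt, e]))⟩
    · obtain ⟨j, hj, e | e⟩ := ih hfix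
      · obtain ⟨i, hi⟩ := (hQ (r j)).2 ⟨j, hj, rfl⟩
        obtain ⟨k, hk, e'⟩ := (hQ v).1 ⟨i + 1, by rw [Function.iterate_succ_apply, e, hi]⟩
        exact ⟨k, hk, Or.inl e'⟩
      · obtain ⟨i, hi⟩ := (hQ (r j)).2 ⟨j, hj, rfl⟩
        have h1 := (branch_moved hgt hggt hi).2
        obtain ⟨k, hk, e'⟩ := (hQ (g v)).1
          ⟨i + 1, by rw [Function.iterate_succ_apply, E.P_perm, e, h1, hi]⟩
        obtain ⟨m, hm⟩ := (hQ (r k)).2 ⟨k, hk, rfl⟩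
        refine ⟨k, hk, Or.inr (g.injective ?_)⟩
        rw [(branch_moved hgt hggt hm).2, e']

/-- Without forks, the fixed vertices form a path. -/
lemma exists_fixed_chain (E : TreeRoots M.coxeterGraph g c)
    (hnf : ∀ v v', g v = v → g v' = v' → v ≠ c → v' ≠ c → E.P v = E.P v' → v = v') :
    ∃ (q : ℕ → S) (L : ℕ∞), q 0 = c ∧
      (∀ j : ℕ, ((j + 1 : ℕ) : ℕ∞) ≤ L → q (j + 1) ≠ c ∧ E.P (q (j + 1)) = q j) ∧
      (∀ j : ℕ, (j : ℕ∞) ≤ L → g (q j) = q j) ∧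
      ∀ v, g v = v → ∃ j : ℕ, (j : ℕ∞) ≤ L ∧ v = q j := by
  obtain ⟨q, L, h0, hq, hQ⟩ := exists_chain (E := E) (Q := fun v => g v = v) (s := c) E.g_c hnf
    (fun v hv hvc => ⟨hvc, P_fixed hv⟩)
  exact ⟨q, L, h0, hq, fun j hj => (hQ _).2 ⟨j, hj, rfl⟩, fun v hv => (hQ v).1 hv⟩

variable (E : TreeRoots M.coxeterGraph g c) (h3 : ∀ s t, M.coxeterGraph.Adj s t → M s t = 3)
  (ht : E.P t = c) (hgt : g t ≠ t)

include h3 ht hgt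

lemma isIsomorphic_A {r : ℕ → S} {n : ℕ} (h0 : r 0 = t)
    (hr : ∀ j < n, E.P (r (j + 1)) = r j) (hmov : ∀ j ≤ n, g (r j) ≠ r j)
    (hall : ∀ v, v = c ∨ ∃ j ≤ n, v = r j ∨ v = g (r j)) :
    M.IsIsomorphic (CoxeterMatrix.A (2 * (n + 1) + 1)) := by
  let f' : ℕ → S := fun i => if i < n + 1 then r (n - i) else if i = n + 1 then c else
    g (r (i - n - 2))
  let par' : ℕ → ℕ := fun i => if i < n + 1 then i + 1 else if i = n + 1 then n + 1 else i - 1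
  have fl : ∀ j ≤ n, f' (n - j) = r j := by
    intro j hj
    simp only [f']
    rw [if_pos (by omega), show n - (n - j) = j by omega]
  have fc : f' (n + 1) = c := by simp [f']
  have fr : ∀ j ≤ n, f' (n + 2 + j) = g (r j) := by
    intro j hj
    simp only [f']
    rw [if_neg (by omega), if_neg (by omega), show n + 2 + j - n - 2 = j by omega]
  have hcases : ∀ i ≤ 2 * n + 2, (∃ j ≤ n, i = n - j) ∨ i = n + 1 ∨ ∃ j ≤ n, i = n + 2 + j := by
    intro i hi
    rcases lt_trichotomy i (n + 1) with h | h | h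
    · exact Or.inl ⟨n - i, by omega, by omega⟩
    · exact Or.inr (Or.inl h)
    · exact Or.inr (Or.inr ⟨i - n - 2, by omega, by omega⟩)
  refine E.isIsomorphic h3 (fun i : Fin (2 * (n + 1) + 1) => f' i)
    (fun i => ⟨par' i, by have := i.isLt; simp only [par']; split_ifs <;> omega⟩)
    ⟨n + 1, by omega⟩ fc ?_ ?_ ?_ ?_ ?_
  · rintro ⟨i, hi⟩ hi0
    have hi0 : i ≠ n + 1 := fun e => hi0 (Fin.ext e)
    dsimp only
    rcases hcases i (by omega) with ⟨j, hj, rfl⟩ | rfl | ⟨j, hj, rfl⟩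
    · rw [fl j hj, show par' (n - j) = n - j + 1 by simp only [par']; rw [if_pos (by omega)]]
      refine ⟨E.ne_root_of_moved (hmov j hj), ?_⟩
      cases j with
      | zero => rw [Nat.sub_zero, fc, h0, ht]
      | succ j => rw [show n - (j + 1) + 1 = n - j by omega, fl j (by omega), hr j (by omega)]
    · exact absurd rfl hi0
    · rw [fr j hj, show par' (n + 2 + j) = n + 1 + j by
        simp only [par']; rw [if_neg (by omega), if_neg (by omega)]; omega]
      refine ⟨E.ne_root_of_moved (perm_moved (hmov j hj)), ?_⟩
      cases j with
      | zero => rw [Nat.add_zero, fc, h0]; exact perm_child_root ht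
      | succ j =>
        rw [show n + 1 + (j + 1) = n + 2 + j by omega, fr j (by omega)]
        exact perm_child (hr j (by omega))
  · rintro ⟨i, hi⟩ ⟨j, hj⟩ hi0 hj0 hij e
    have hi0 : i ≠ n + 1 := fun e => hi0 (Fin.ext e)
    have hj0 : j ≠ n + 1 := fun e => hj0 (Fin.ext e)
    have hij := Fin.mk.inj hij
    dsimp only at e
    refine Fin.ext ?_
    change i = j
    have f1 : f' n = t := by rw [← h0]; simpa using fl 0 (Nat.zero_le n)
    have f2 : f' (n + 2) = g t := by rw [← h0]; simpa using fr 0 (Nat.zero_le n)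
    simp only [par'] at hij
    rw [if_neg hi0, if_neg hj0] at hij
    split_ifs at hij with h1 h2 h2
    · omega
    · obtain rfl : i = n := by omega
      obtain rfl : j = i + 2 := by omega
      rw [f1, f2] at e
      exact absurd e.symm hgt
    · obtain rfl : j = n := by omega
      obtain rfl : i = j + 2 := by omega
      rw [f1, f2] at e
      exact absurd e hgt
    · omega
  · intro v
    rcases hall v with rfl | ⟨j, hj, rfl | rfl⟩
    · exact ⟨⟨n + 1, by omega⟩, fc⟩
    · exact ⟨⟨n - j, by omega⟩, fl j hj⟩
    · exact ⟨⟨n + 2 + j, by omega⟩, fr j hj⟩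
  · rintro ⟨i, hi⟩ ⟨j, hj⟩
    change (if _ then _ else if _ then _ else _) = _
    simp only [Fin.mk.injEq, par']
    split_ifs <;> omega
  · exact Fin.ext (by simp [par'])

lemma isIsomorphic_biinfiniteA {r : ℕ → S} (h0 : r 0 = t)
    (hr : ∀ j, E.P (r (j + 1)) = r j) (hmov : ∀ j, g (r j) ≠ r j)
    (hall : ∀ v, v = c ∨ ∃ j, v = r j ∨ v = g (r j)) :
    M.IsIsomorphic CoxeterMatrix.biinfiniteA := by
  let f : ℤ → S := fun i => if i < 0 then r (-i - 1).toNat else if i = 0 then c else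
    g (r (i - 1).toNat)
  let par : ℤ → ℤ := fun i => if i < 0 then i + 1 else if i = 0 then 0 else i - 1
  have fl : ∀ j : ℕ, f (-j - 1) = r j := by
    intro j
    simp only [f]
    rw [if_pos (by omega), show (-(-(j : ℤ) - 1) - 1).toNat = j by omega]
  have fc : f 0 = c := rfl
  have fr : ∀ j : ℕ, f (j + 1) = g (r j) := by
    intro j
    simp only [f]
    rw [if_neg (by omega), if_neg (by omega), show ((j : ℤ) + 1 - 1).toNat = j by omega]
  have hcases : ∀ i : ℤ, (∃ j : ℕ, i = -j - 1) ∨ i = 0 ∨ ∃ j : ℕ, i = j + 1 := by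
    intro i
    rcases lt_trichotomy i 0 with h | h | h
    · exact Or.inl ⟨(-i - 1).toNat, by omega⟩
    · exact Or.inr (Or.inl h)
    · exact Or.inr (Or.inr ⟨(i - 1).toNat, by omega⟩)
  refine E.isIsomorphic h3 f par 0 rfl ?_ ?_ ?_
    (CoxeterMatrix.ofGraph_apply_of_parent (SimpleGraph.fromRel_adj_iff_of_parent ?_)) rfl
  · intro i hi0
    rcases hcases i with ⟨j, rfl⟩ | rfl | ⟨j, rfl⟩
    · rw [fl j, show par (-j - 1) = -j by simp only [par]; rw [if_pos (by omega)]; omega]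
      refine ⟨E.ne_root_of_moved (hmov j), ?_⟩
      cases j with
      | zero => rw [h0, ht]; rfl
      | succ j =>
        rw [hr j, ← fl j]
        congr 1
        push_cast
        ring
    · exact absurd rfl hi0
    · rw [fr j, show par (j + 1) = j by
        simp only [par]; rw [if_neg (by omega), if_neg (by omega)]; omega]
      refine ⟨E.ne_root_of_moved (perm_moved (hmov j)), ?_⟩
      cases j with
      | zero => rw [h0]; exact perm_child_root ht
      | succ j => rw [perm_child (hr j), ← fr j]; push_cast; rfl
  · intro i j hi0 hj0 hij e
    have f1 : f (-1) = t := by rw [← h0]; simpa using fl 0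
    have f2 : f 1 = g t := by rw [← h0]; simpa using fr 0
    simp only [par] at hij
    rw [if_neg hi0, if_neg hj0] at hij
    split_ifs at hij with h1 h2 h2
    · omega
    · obtain rfl : i = -1 := by omega
      obtain rfl : j = 1 := by omega
      rw [f1, f2] at e
      exact absurd e.symm hgt
    · obtain rfl : j = -1 := by omega
      obtain rfl : i = 1 := by omega
      rw [f1, f2] at e
      exact absurd e hgt
    · omega
  · intro v
    rcases hall v with rfl | ⟨j, rfl | rfl⟩
    · exact ⟨0, fc⟩
    · exact ⟨_, fl j⟩
    · exact ⟨_, fr j⟩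
  · intro i j hij
    simp only [par]
    split_ifs <;> omega

lemma isIsomorphic_typeD {q : ℕ → S} {n : ℕ} (hn : 1 ≤ n) (h0 : q 0 = c)
    (hq : ∀ j < n, q (j + 1) ≠ c ∧ E.P (q (j + 1)) = q j) (hfix : ∀ j ≤ n, g (q j) = q j)
    (hall : ∀ v, v = t ∨ v = g t ∨ ∃ j ≤ n, v = q j) :
    M.IsIsomorphic (CoxeterMatrix.typeD (n + 3)) := by
  have m1 := perm_moved hgt
  let f' : ℕ → S := fun i => if i ≤ n then q (n - i) else if i = n + 1 then t else g t
  let par' : ℕ → ℕ := fun i => if i < n then i + 1 else n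
  have fl : ∀ j ≤ n, f' (n - j) = q j := by
    intro j hj
    simp only [f']
    rw [if_pos (by omega), show n - (n - j) = j by omega]
  have fc : f' n = c := by rw [← h0]; simpa using fl 0 (Nat.zero_le n)
  have f1 : f' (n + 1) = t := by simp [f']
  have f2 : f' (n + 2) = g t := by simp [f']
  have hcases : ∀ i ≤ n + 2, (∃ j < n, i = n - (j + 1)) ∨ i = n ∨ i = n + 1 ∨ i = n + 2 := by
    intro i hi
    by_cases h : i < n
    · exact Or.inl ⟨n - i - 1, by omega, by omega⟩
    · omega
  refine E.isIsomorphic h3 (fun i : Fin (n + 3) => f' i)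
    (fun i => ⟨par' i, by have := i.isLt; simp only [par']; split_ifs <;> omega⟩)
    ⟨n, by omega⟩ fc ?_ ?_ ?_
    (CoxeterMatrix.ofGraph_apply_of_parent (SimpleGraph.fromRel_adj_iff_of_parent ?_)) ?_
  · rintro ⟨i, hi⟩ hi0
    have hi0 : i ≠ n := fun e => hi0 (Fin.ext e)
    dsimp only
    rcases hcases i (by omega) with ⟨j, hj, rfl⟩ | rfl | rfl | rfl
    · rw [fl (j + 1) hj, show par' (n - (j + 1)) = n - j by
        simp only [par']; rw [if_pos (by omega)]; omega, fl j hj.le]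
      exact hq j hj
    · exact absurd rfl hi0
    · rw [f1, show par' (n + 1) = n by simp [par'], fc]
      exact ⟨E.ne_root_of_moved hgt, ht⟩
    · rw [f2, show par' (n + 2) = n by simp [par'], fc]
      exact ⟨E.ne_root_of_moved m1, perm_child_root ht⟩
  · rintro ⟨i, hi⟩ ⟨j, hj⟩ hi0 hj0 hij e
    have hi0 : i ≠ n := fun e => hi0 (Fin.ext e)
    have hj0 : j ≠ n := fun e => hj0 (Fin.ext e)
    have hij := Fin.mk.inj hij
    dsimp only at e
    refine Fin.ext ?_
    change i = j
    have hfixf : ∀ i < n, g (f' i) = f' i := by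
      intro i hi
      have := fl (n - i) (by omega)
      rw [show n - (n - i) = i by omega] at this
      rw [this]
      exact hfix _ (by omega)
    have hmovf : ∀ i, n < i → i < n + 3 → g (f' i) ≠ f' i := by
      intro i hi hi'
      rcases (show i = n + 1 ∨ i = n + 2 by omega) with rfl | rfl
      · rw [f1]; exact hgt
      · rw [f2]; exact m1
    by_cases h1 : i < n <;> by_cases h2 : j < n
    · simp only [par'] at hij
      rw [if_pos h1, if_pos h2] at hij
      omega
    · exact absurd (by rw [← e]; exact hfixf i h1) (hmovf j (by omega) hj)
    · exact absurd (by rw [e]; exact hfixf j h2) (hmovf i (by omega) hi)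
    · by_contra hne
      rcases (show (i = n + 1 ∧ j = n + 2) ∨ (i = n + 2 ∧ j = n + 1) by omega) with ⟨rfl, rfl⟩ | ⟨rfl, rfl⟩
      · rw [f1, f2] at e; exact hgt e.symm
      · rw [f1, f2] at e; exact hgt e
  · intro v
    rcases hall v with rfl | rfl | ⟨j, hj, rfl⟩
    · exact ⟨⟨n + 1, by omega⟩, f1⟩
    · exact ⟨⟨n + 2, by omega⟩, f2⟩
    · exact ⟨⟨n - j, by omega⟩, fl j hj⟩
  · rintro ⟨i, hi⟩ ⟨j, hj⟩ hij
    simp only [ne_eq, Fin.mk.injEq, par'] at hij ⊢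
    split_ifs <;> omega
  · exact Fin.ext (by simp [par'])

lemma isIsomorphic_infiniteD {q : ℕ → S} (h0 : q 0 = c)
    (hq : ∀ j, q (j + 1) ≠ c ∧ E.P (q (j + 1)) = q j) (hfix : ∀ j, g (q j) = q j)
    (hall : ∀ v, v = t ∨ v = g t ∨ ∃ j, v = q j) :
    M.IsIsomorphic CoxeterMatrix.infiniteD := by
  have m1 := perm_moved hgt
  let f : ℕ → S := fun i => if i = 0 then t else if i = 1 then g t else q (i - 2)
  let par : ℕ → ℕ := fun i => if i ≤ 2 then 2 else i - 1
  have fq : ∀ j, f (j + 2) = q j := fun j => rfl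
  have hcases : ∀ i, i = 0 ∨ i = 1 ∨ i = 2 ∨ ∃ j, i = j + 1 + 2 := by
    intro i
    by_cases h : 3 ≤ i
    · exact Or.inr (Or.inr (Or.inr ⟨i - 3, by omega⟩))
    · omega
  refine E.isIsomorphic h3 f par 2 h0 ?_ ?_ ?_
    (CoxeterMatrix.ofGraph_apply_of_parent (SimpleGraph.fromRel_adj_iff_of_parent ?_)) rfl
  · intro i hi0
    rcases hcases i with rfl | rfl | rfl | ⟨j, rfl⟩
    · exact ⟨E.ne_root_of_moved hgt, ht.trans h0.symm⟩
    · exact ⟨E.ne_root_of_moved m1, (perm_child_root ht).trans h0.symm⟩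
    · exact absurd rfl hi0
    · rw [fq, show par (j + 1 + 2) = j + 2 by simp only [par]; rw [if_neg (by omega)]; omega, fq]
      exact hq j
  · intro i j hi0 hj0 hij e
    have hfixf : ∀ i, 2 ≤ i → g (f i) = f i := by
      intro i hi
      obtain ⟨j, rfl⟩ : ∃ j, i = j + 2 := ⟨i - 2, by omega⟩
      exact hfix j
    have hmovf : ∀ i, i < 2 → g (f i) ≠ f i := by
      intro i hi
      interval_cases i
      · exact hgt
      · exact m1
    by_cases h1 : i < 2 <;> by_cases h2 : j < 2
    · interval_cases i <;> interval_cases j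
      · rfl
      · exact absurd e.symm hgt
      · exact absurd e hgt
      · rfl
    · exact absurd (by rw [e]; exact hfixf j (by omega)) (hmovf i h1)
    · exact absurd (by rw [← e]; exact hfixf i (by omega)) (hmovf j h2)
    · simp only [par] at hij
      rw [if_neg (by omega), if_neg (by omega)] at hij
      omega
  · intro v
    rcases hall v with rfl | rfl | ⟨j, rfl⟩
    · exact ⟨0, rfl⟩
    · exact ⟨1, rfl⟩
    · exact ⟨j + 2, rfl⟩
  · intro i j hij
    simp only [par]
    split_ifs <;> omega

lemma isIsomorphic_E₆ {w u : S} (hw : E.P w = t) (hu : E.P u = c) (huc : u ≠ c) (hgu : g u = u)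
    (hall : ∀ v, v = c ∨ v = t ∨ v = g t ∨ v = w ∨ v = g w ∨ v = u) :
    M.IsIsomorphic CoxeterMatrix.E₆ := by
  have m1 := perm_moved hgt
  have hgw := child_moved hw hgt
  have d1 := ne_of_moved_of_fixed hgt hgu
  have d2 := ne_of_moved_of_fixed m1 hgu
  refine E.isIsomorphic h3 ![w, u, t, c, g t, g w] ![2, 3, 3, 3, 3, 4] 3 rfl ?_ ?_ ?_
    (fun i j => by fin_cases i <;> fin_cases j <;> rfl) rfl
  · intro i hi
    match i with
    | 0 => exact ⟨E.ne_root_of_moved hgw, hw⟩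
    | 1 => exact ⟨huc, hu⟩
    | 2 => exact ⟨E.ne_root_of_moved hgt, ht⟩
    | 3 => exact absurd rfl hi
    | 4 => exact ⟨E.ne_root_of_moved m1, perm_child_root ht⟩
    | 5 => exact ⟨E.ne_root_of_moved (perm_moved hgw), perm_child hw⟩
  · intro i j hi hj hij e
    fin_cases i <;> fin_cases j <;>
      first
      | rfl
      | exact absurd rfl hi
      | exact absurd rfl hj
      | exact absurd hij (by decide)
      | (revert e; simp [hgt, Ne.symm hgt, d1, d2, d1.symm, d2.symm])
  · intro v
    rcases hall v with rfl | rfl | rfl | rfl | rfl | rfl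
    · exact ⟨3, rfl⟩
    · exact ⟨2, rfl⟩
    · exact ⟨4, rfl⟩
    · exact ⟨0, rfl⟩
    · exact ⟨5, rfl⟩
    · exact ⟨1, rfl⟩

lemma isIsomorphic_affineE₆ {w u y : S} (hw : E.P w = t) (hu : E.P u = c) (huc : u ≠ c)
    (hgu : g u = u) (hy : E.P y = u) (hyc : y ≠ c)
    (hall : ∀ v, v = c ∨ v = t ∨ v = g t ∨ v = w ∨ v = g w ∨ v = u ∨ v = y) :
    M.IsIsomorphic CoxeterMatrix.affineE₆ := by
  have m1 := perm_moved hgt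
  have hgw := child_moved hw hgt
  have d1 := ne_of_moved_of_fixed hgt hgu
  have d2 := ne_of_moved_of_fixed m1 hgu
  refine E.isIsomorphic h3 ![y, w, u, t, c, g t, g w] ![2, 3, 4, 4, 4, 4, 5] 4 rfl ?_ ?_ ?_
    (CoxeterMatrix.ofGraph_apply_of_parent
      (SimpleGraph.fromRel_adj_iff_of_parent (by decide))) rfl
  · intro i hi
    match i with
    | 0 => exact ⟨hyc, hy⟩
    | 1 => exact ⟨E.ne_root_of_moved hgw, hw⟩
    | 2 => exact ⟨huc, hu⟩
    | 3 => exact ⟨E.ne_root_of_moved hgt, ht⟩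
    | 4 => exact absurd rfl hi
    | 5 => exact ⟨E.ne_root_of_moved m1, perm_child_root ht⟩
    | 6 => exact ⟨E.ne_root_of_moved (perm_moved hgw), perm_child hw⟩
  · intro i j hi hj hij e
    fin_cases i <;> fin_cases j <;>
      first
      | rfl
      | exact absurd rfl hi
      | exact absurd rfl hj
      | exact absurd hij (by decide)
      | (revert e; simp [hgt, Ne.symm hgt, d1, d2, d1.symm, d2.symm])
  · intro v
    rcases hall v with rfl | rfl | rfl | rfl | rfl | rfl | rfl
    · exact ⟨4, rfl⟩
    · exact ⟨3, rfl⟩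
    · exact ⟨5, rfl⟩
    · exact ⟨1, rfl⟩
    · exact ⟨6, rfl⟩
    · exact ⟨2, rfl⟩
    · exact ⟨0, rfl⟩

/-- The classification if the root has two moved children and the fixed vertices form a path. -/
lemma classification_path (hggt : g (g t) = t)
    (hnf : ∀ v v', g v = v → g v' = v' → v ≠ c → v' ≠ c → E.P v = E.P v' → v = v') :
    (∃ m : ℕ, 1 ≤ m ∧ M.IsIsomorphic (CoxeterMatrix.A (2 * m + 1))) ∨
    (∃ m : ℕ, 4 ≤ m ∧ M.IsIsomorphic (CoxeterMatrix.typeD m)) ∨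
    M.IsIsomorphic CoxeterMatrix.E₆ ∨ M.IsIsomorphic CoxeterMatrix.affineE₆ ∨
    M.IsIsomorphic CoxeterMatrix.biinfiniteA ∨ M.IsIsomorphic CoxeterMatrix.infiniteD := by
  obtain ⟨r, K, hr0, hr, hrm, hrall⟩ := exists_branch_chain ht hgt hggt
  obtain ⟨q, L, hq0, hq, hqf, hqall⟩ := E.exists_fixed_chain hnf
  by_cases hL : ((0 + 1 : ℕ) : ℕ∞) ≤ L
  · by_cases hK : ((0 + 1 : ℕ) : ℕ∞) ≤ K
    · -- `t` has a child and the root has a fixed child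
      have hw := hr 0 hK
      obtain ⟨huc, hu⟩ := hq 0 hL
      have hgu := hqf _ hL
      rw [hr0] at hw
      rw [hq0] at hu
      have hK2 : ¬((1 + 1 : ℕ) : ℕ∞) ≤ K := fun h =>
        two_no_great_grandchild ht hgt hggt hu huc hgu hw (hr 1 h)
      have hL3 : ¬((2 + 1 : ℕ) : ℕ∞) ≤ L := fun h =>
        two_no_fixed_great_grandchild ht hgt hggt hw hu huc hgu
          (hq 1 (le_trans (by norm_num) h)).2 (hqf 2 (le_trans (by norm_num) h)) (hq 2 h).2 (hqf 3 h)
      have hmoved : ∀ v, g v ≠ v → v = t ∨ v = g t ∨ v = r 1 ∨ v = g (r 1) := by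
        intro v hv
        obtain ⟨j, hj, e⟩ := hrall v hv
        have hj1 : j < 2 := by
          by_contra h
          exact hK2 (le_trans (Nat.cast_le.2 (by omega)) hj)
        interval_cases j
        · rw [hr0] at e; tauto
        · tauto
      by_cases hL2 : ((1 + 1 : ℕ) : ℕ∞) ≤ L
      · refine Or.inr (Or.inr (Or.inr (Or.inl ?_)))
        obtain ⟨hyc, hy⟩ := hq 1 hL2
        refine E.isIsomorphic_affineE₆ h3 ht hgt hw hu huc hgu hy hyc fun v => ?_
        by_cases hv : g v = v
        · obtain ⟨j, hj, e⟩ := hqall v hv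
          have hj1 : j < 3 := by
            by_contra h
            exact hL3 (le_trans (Nat.cast_le.2 (by omega)) hj)
          interval_cases j
          · rw [hq0] at e; tauto
          · tauto
          · tauto
        · have := hmoved v hv; tauto
      · refine Or.inr (Or.inr (Or.inl ?_))
        refine E.isIsomorphic_E₆ h3 ht hgt hw hu huc hgu fun v => ?_
        by_cases hv : g v = v
        · obtain ⟨j, hj, e⟩ := hqall v hv
          have hj1 : j < 2 := by
            by_contra h
            exact hL2 (le_trans (Nat.cast_le.2 (by omega)) hj)
          interval_cases j
          · rw [hq0] at e; tauto
          · tauto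
        · have := hmoved v hv; tauto
    · -- the moved vertices are `t` and `g t`
      have hmoved : ∀ v, g v ≠ v → v = t ∨ v = g t := by
        intro v hv
        obtain ⟨j, hj, e⟩ := hrall v hv
        have hj1 : j = 0 := by
          by_contra h
          exact hK (le_trans (Nat.cast_le.2 (by omega)) hj)
        subst hj1
        rwa [hr0] at e
      cases L using ENat.recTopCoe with
      | top =>
        refine Or.inr (Or.inr (Or.inr (Or.inr (Or.inr ?_))))
        refine E.isIsomorphic_infiniteD h3 ht hgt hq0 (fun j => hq j le_top)
          (fun j => hqf j le_top) fun v => ?_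
        by_cases hv : g v = v
        · obtain ⟨j, -, e⟩ := hqall v hv
          exact Or.inr (Or.inr ⟨j, e⟩)
        · have := hmoved v hv; tauto
      | coe n =>
        simp only [Nat.cast_le] at hL hq hqf hqall
        refine Or.inr (Or.inl ⟨n + 3, by omega, ?_⟩)
        refine E.isIsomorphic_typeD h3 ht hgt (by omega) hq0 (fun j hj => hq j hj) hqf fun v => ?_
        by_cases hv : g v = v
        · exact Or.inr (Or.inr (hqall v hv))
        · have := hmoved v hv; tauto
  · -- the root is the only fixed vertex
    have hfixed : ∀ v, g v = v → v = c := by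
      intro v hv
      obtain ⟨j, hj, e⟩ := hqall v hv
      have hj1 : j = 0 := by
        by_contra h
        exact hL (le_trans (Nat.cast_le.2 (by omega)) hj)
      rw [e, hj1, hq0]
    cases K using ENat.recTopCoe with
    | top =>
      refine Or.inr (Or.inr (Or.inr (Or.inr (Or.inl ?_))))
      refine E.isIsomorphic_biinfiniteA h3 ht hgt hr0 (fun j => hr j le_top)
        (fun j => hrm j le_top) fun v => ?_
      by_cases hv : g v = v
      · exact Or.inl (hfixed v hv)
      · obtain ⟨j, -, e⟩ := hrall v hv
        exact Or.inr ⟨j, e⟩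
    | coe n =>
      simp only [Nat.cast_le] at hr hrm hrall
      refine Or.inl ⟨n + 1, by omega, ?_⟩
      refine E.isIsomorphic_A h3 ht hgt hr0 (fun j hj => hr j hj) hrm fun v => ?_
      by_cases hv : g v = v
      · exact Or.inl (hfixed v hv)
      · exact Or.inr (hrall v hv)

end TreeRoots
end

/-! ### The classification -/

noncomputable section

variable {S : Type*} {M : CoxeterMatrix S}

namespace RootPrebasis

variable {B : RootPrebasis M} {G : Subgroup M.symmetryGroup}

lemma IsPair.actV {x : S →₀ ℝ} {φ : Module.Dual ℝ (S →₀ ℝ)} (hB : B.IsSymmetric G)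
    (h : B.IsPair x φ) {g : M.symmetryGroup} (hg : g ∈ G) :
    B.IsPair (RootPrebasis.actV g x)
      (φ.comp (RootPrebasis.actV g⁻¹ : (S →₀ ℝ) →ₗ[ℝ] (S →₀ ℝ))) := by
  obtain ⟨d, w, s, hd, rfl, hφ⟩ := h
  refine ⟨d, M.symmetryAct g w, g • s, hd, ?_, fun y => ?_⟩
  · rw [hB.rep_symmetryAct hg, ← actV_simpleRoot, map_smul, LinearEquiv.mul_apply,
      LinearEquiv.mul_apply]
    congr 3
    exact ((RootPrebasis.actV g).symm_apply_apply _).symm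
  · rw [← map_inv, hB.rep_symmetryAct hg, LinearEquiv.mul_apply, LinearEquiv.mul_apply,
      hB.coroot_actV hg, LinearMap.comp_apply, hφ]
    rfl

/-- A reduced symmetric root basis with the `Φ̂⁺`-basis property provides the input of the
classification. -/
lemma IsReduced.nonempty_orthogonalRoots (hr : B.IsReduced) (hB : B.IsSymmetric G)
    (hfin : ∀ s : S, (MulAction.orbit G s).Finite) {K : Type*} [Field K]
    (hbasis : HatBasisProperty K hB) :
    ∃ D : OrthogonalRoots M.coxeterGraph (G.map M.symmetryGroup.subtype), D.a = B.coroot := by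
  have hpos : ∀ β ∈ B.posRoots, ∃ w ∈ CoxeterMatrix.fixedSubgroup G, ∃ r,
      β = B.rep w (simpleRoot r) := fun β hβ => exists_fixed_rep_eq hfin hB hbasis hβ
  refine ⟨{
    a := B.coroot
    IsPair := B.IsPair
    isPair_simple := isPair_simple
    smul := fun h _ hc => h.smul hc
    reflect := fun hx hy => hx.reflect hy
    apply_self := fun h => h.apply_self
    unique := fun h h' => hr.isPair_unique h h'
    perm := ?_
    orth := ?_
    a_perm := ?_
    a_nonpos := fun h => hr.1.coroot_nonpos h
    adj_iff := ?_
    one_le := ?_ }, rfl⟩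
  · rintro x φ h _ ⟨g, hg, rfl⟩
    exact h.actV hB hg
  · rintro x φ h _ ⟨g, hg, rfl⟩
    exact h.actV_eq_or_apply_eq_zero hfin hr hB hpos hg
  · rintro _ ⟨g, hg, rfl⟩ s x
    exact hB.coroot_actV hg s x
  · intro s t
    refine and_congr_right fun hst => not_congr
      ⟨coroot_eq_zero_of_matrix_eq_two hst, fun h => ?_⟩
    exact matrix_eq_two_of_coroot_eq_zero hst h (hr.1.coroot_eq_zero_comm hst h)
  · intro s t h
    refine hr.1.one_le_mul h.ne fun h0 => h.2 ?_
    exact matrix_eq_two_of_coroot_eq_zero h.ne h0 (hr.1.coroot_eq_zero_comm h.ne h0)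

end RootPrebasis

lemma CoxeterMatrix.isIsomorphic_ofGraph {V : Type*} {H : SimpleGraph V}
    (h3 : ∀ s t, M.coxeterGraph.Adj s t → M s t = 3) (e : H ≃g M.coxeterGraph) :
    M.IsIsomorphic (CoxeterMatrix.ofGraph H) := by
  classical
  refine ⟨e.symm.toEquiv, fun s t => ?_⟩
  have h : H.Adj (e.symm s) (e.symm t) ↔ M.coxeterGraph.Adj s t := e.symm.map_adj_iff
  change (if e.symm s = e.symm t then 1 else if H.Adj (e.symm s) (e.symm t) then 3 else 2) = M s t
  rw [e.symm.injective.eq_iff]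
  simp only [h]
  split_ifs with hst hadj
  · rw [hst, M.diagonal]
  · exact (h3 s t hadj).symm
  · by_contra hne
    exact hadj ⟨hst, Ne.symm hne⟩

end

theorem proposition2p11 {S : Type*} (M : CoxeterMatrix S)
    (hconn : M.coxeterGraph.Connected)
    (G : Subgroup M.symmetryGroup) (hG : G ≠ ⊥)
    (hfin : ∀ s : S, (MulAction.orbit G s).Finite)
    (B : RootPrebasis M) (hred : B.IsReduced) (hsymm : B.IsSymmetric G)
    (K : Type*) [Field K]
    (hbasis : RootPrebasis.HatBasisProperty K hsymm) :
    (∃ m : ℕ, 1 ≤ m ∧ M.IsIsomorphic (CoxeterMatrix.A (2 * m + 1))) ∨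
    (∃ m : ℕ, 4 ≤ m ∧ M.IsIsomorphic (CoxeterMatrix.typeD m)) ∨
    M.IsIsomorphic CoxeterMatrix.E₆ ∨
    (∃ m : ℕ, 1 ≤ m ∧ M.IsIsomorphic (CoxeterMatrix.affineA (2 * m + 1))) ∨
    (∃ m : ℕ, 4 ≤ m ∧ M.IsIsomorphic (CoxeterMatrix.affineD m)) ∨
    M.IsIsomorphic CoxeterMatrix.affineE₆ ∨
    M.IsIsomorphic CoxeterMatrix.affineE₇ ∨
    M.IsIsomorphic CoxeterMatrix.biinfiniteA ∨
    M.IsIsomorphic CoxeterMatrix.infiniteD := by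
  obtain ⟨D, hD⟩ := hred.nonempty_orthogonalRoots hsymm hfin hbasis
  obtain ⟨⟨γ, hγ⟩, hγ0⟩ := Subgroup.ne_bot_iff_exists_ne_one.1 hG
  have hg : (γ : Equiv.Perm S) ∈ G.map M.symmetryGroup.subtype := ⟨γ, hγ, rfl⟩
  have hg1 : (γ : Equiv.Perm S) ≠ 1 := fun e => hγ0 (Subtype.ext (Subtype.ext e))
  have hl : ∀ s w, M.coxeterGraph.Adj s w →
      D.a s (Finsupp.single w 1) * D.a w (Finsupp.single s 1) = 1 :=
    fun s w h => D.mul_eq_one hconn hg hg1 h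
  have h3 : ∀ s t, M.coxeterGraph.Adj s t → M s t = 3 := fun s t h => by
    have := hl s t h
    rw [hD] at this
    exact RootPrebasis.matrix_eq_three_of_mul_eq_one h.ne this
  by_cases hac : M.coxeterGraph.IsAcyclic
  swap
  · obtain ⟨m, hm, ⟨e⟩⟩ := D.exists_iso_cycleGraph hconn hg hg1 hac
    exact .inr (.inr (.inr (.inl ⟨m, hm, CoxeterMatrix.isIsomorphic_ofGraph h3 e⟩)))
  obtain ⟨c, t, hc, hct, hgt⟩ := D.exists_branch hconn hg hg1
  obtain ⟨E⟩ := D.nonempty_treeRoots ⟨hconn, hac⟩ hg hl hc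
  have ht : E.P t = c := by
    refine ((E.rooted.adj_iff c t).1 hct).2.resolve_left fun h => hct.ne ?_
    rw [← h, E.rooted.P_root]
  by_cases hggt : (γ : Equiv.Perm S) ((γ : Equiv.Perm S) t) = t
  · by_cases hfork : ∃ f w w', (γ : Equiv.Perm S) w = w ∧ (γ : Equiv.Perm S) w' = w' ∧ w ≠ c ∧
        w' ≠ c ∧ E.P w = f ∧ E.P w' = f ∧ w ≠ w'
    · exact .inr (.inr (.inr (.inr (.inl (E.classification_fork h3 ht hgt hggt hfork)))))
    · have hnf : ∀ v v', (γ : Equiv.Perm S) v = v → (γ : Equiv.Perm S) v' = v' → v ≠ c → v' ≠ c →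
          E.P v = E.P v' → v = v' := fun v v' h h' hv hv' e => by
        by_contra hne
        exact hfork ⟨_, v, v', h, h', hv, hv', rfl, e.symm, hne⟩
      rcases E.classification_path h3 ht hgt hggt hnf with h | h | h | h | h | h
      · exact .inl h
      · exact .inr (.inl h)
      · exact .inr (.inr (.inl h))
      · exact .inr (.inr (.inr (.inr (.inr (.inl h)))))
      · exact .inr (.inr (.inr (.inr (.inr (.inr (.inr (.inl h)))))))
      · exact .inr (.inr (.inr (.inr (.inr (.inr (.inr (.inr h)))))))
  · have hgggt := (E.perm_orbit ht hgt).resolve_left hggt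
    rcases E.classification_three h3 ht hgt hggt hgggt with h | h
    · exact .inr (.inl ⟨4, le_rfl, h⟩)
    · exact .inr (.inr (.inr (.inr (.inl ⟨4, le_rfl, h⟩))))
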